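/- **Setting.** Let $A(n)$, $n\in\mathbb N$, be invertible real $d\times d$ matrices (in particular matrices in $\mathrm{GL}_d(\mathbf Q)$ for a real number field $\mathbf Q$) converging to a finite matrix $A$. Assume that $A$ has a unique simple dominant eigenvalue $\lambda$ ($\lambda$ is a simple root of the characteristic polynomial and all other complex eigenvalues have smaller modulus), that $\lambda\neq0$, and that $A$ has an eigenvector $e>0$ for $\lambda$. Inequalities between vectors or matrices and $0$ are meant entrywise. Let $U_{n+1}=A(n)U_n$ with $U_0\in\mathbb R^d$. The solution is *positive* if $U_n\ge 0$ for all $n$. The vector $U_0$ is *generic* if there are nonzero $v',w\in\mathbb R^d$ with $Av'=\lambda v'$, $$\lim_{n\to\infty}\operatorname{sgn}(\lambda)^n\frac{A(n-1)\cdots A(0)}{\|A(n-1)\cdots A(0)\|}=v'w^T\qquad\text{and}\qquad w^TU_0\ne0 .$$ For $v\in\mathbb R^d$ and $r\in\mathbb Q$, let $B_r(v)=\{x\in\mathbb R_{>0}^d: x_iv_j\le r\,x_jv_i\ \text{for all } i,j\}$, and let $B_\infty(v)=\mathbb R^d_{>0}$. A *valid certificate* is a quadruple $(T,r,N,m)$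 with $T\in \mathrm{GL}_d(\mathbb Q)$, $r\in\mathbb Q_{>1}\cup\{\infty\}$, $N\in\mathbb N$, $m\in\mathbb N_{>0}$ such that, with $v=Te$ and $C_r(v)=T^{-1}B_r(v)$: $\lambda>0$, $v>0$ and $C_r(v)\subset\mathbb R^d_{>0}$; $U_n\ge0$ for $n\le N$ and $U_N,\dots,U_{N+m-1}\in C_r(v)$; and $A(n+m-1)\cdots A(n)\,C_r(v)\subset C_r(v)$ for all $n\ge N$. **Algorithm PositivityProof.** 1. If $\lambda<0$, return Non-positive. 2. Find $T\in\mathrm{GL}_d(\mathbb Q)$ and $m>0$ with $TA^mT^{-1}>0$. 3. If $Te<0$, replace $T$ by $-T$. Put $v=Te$. 4. Find $r\in\mathbb Q_{>1}\cup\{\infty\}$ with $T^{-1}B_r(v)\subset\mathbb R^d_{>0}$. 5. Find $K$ such that $TA(n+m-1)\cdots A(n)T^{-1}B_r(v)\subset B_r(v)$ for all $n\ge K$. 6. If $U_i\not\ge0$ for some $i\le K$, return Non-positive. 7. For $i=K,K+1,\dots$: if $U_i\not\ge0$, return Non-positive; if $TU_j\in B_r(v)$ for $j=i,\dots,i+m-1$,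 return the certificate $(T,r,i,m)$. **Theorem.** (a) *Correctness and termination.* If $\lambda>0$, the searches in steps 2, 4 and 5 have a solution, whatever solutions were chosen in the earlier steps, and $v>0$ after step 3. For every choice of these solutions: if $U_0$ is generic, or if the solution is not positive, the algorithm terminates. If $U_0$ is generic or $\lambda>0$, then whatever it returns is correct: either it returns Non-positive and the solution is not positive, or it returns a valid certificate. Every valid certificate $(T,r,N,m)$ proves positivity: $U_n\in C_r(v)\subset\mathbb R^d_{>0}$ for all $n\ge N$, and $U_n\ge0$ for all $n$. (b) *Effectivity.* The algorithm can be carried out by a machine: there is a partial recursive function, with inputs $d$, a real number field $\mathbf Q=\mathbb Q(\alpha)$ ($\alpha$ given by a squarefree rational polynomial and an isolating interval), a matrix $A(n)\in\mathbf Q(n)^{d\times d}$ of rational functions given by numerators and denominators whose denominators have no zero in $\mathbb N$, and $U_0\in\mathbf Q^d$, that for every input satisfying the hypotheses of the setting performs the algorithm for some choice of solutions in steps 2, 4 and 5: it halts if and only if that run terminates, and then it outputs what the run returns. (c) *Reduction.* For the same inputs, proving positivity reduces to deciding genericity of $U_0$: there is a partial recursive function that, given an input satisfying the hypotheses and the truth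 value of "$U_0$ is generic", always halts, and reports "not generic" (only if $U_0$ is not generic), or correctly reports that the solution is not positive, or outputs a valid certificate. -/

import Mathlib

open Filter Topology Polynomial Matrix

noncomputable section

namespace PosProof

/-! ### The recurrence `U (n+1) = A n * U n` -/

/-- All coordinates are positive. -/
def PosVec {d : ℕ} (x : Fin d → ℝ) : Prop := ∀ i, 0 < x i

/-- All coordinates are nonnegative. -/
def NonnegVec {d : ℕ} (x : Fin d → ℝ) : Prop := ∀ i, 0 ≤ x i

/-- All entries are positive. -/
def PosMat {d : ℕ} (M : Matrix (Fin d) (Fin d) ℝ) : Prop := ∀ i j, 0 < M i j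

/-- The solution of `U (n+1) = A n * U n` with `U 0 = U₀`. -/
def orbit {d : ℕ} (A : ℕ → Matrix (Fin d) (Fin d) ℝ) (U₀ : Fin d → ℝ) : ℕ → Fin d → ℝ
  | 0 => U₀
  | n + 1 => A n *ᵥ orbit A U₀ n

/-- Positivity of the solution (in the usual sense of the "positivity problem"):
all terms are nonnegative. -/
def IsPositiveSolution {d : ℕ} (A : ℕ → Matrix (Fin d) (Fin d) ℝ) (U₀ : Fin d → ℝ) : Prop :=
  ∀ n, NonnegVec (orbit A U₀ n)

/-- The matrix product `A (n+k-1) * ... * A (n+1) * A n` (with `k` factors). -/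
def stepProd {d : ℕ} (A : ℕ → Matrix (Fin d) (Fin d) ℝ) (n : ℕ) :
    ℕ → Matrix (Fin d) (Fin d) ℝ
  | 0 => 1
  | k + 1 => A (n + k) * stepProd A n k

/-- The real number `lam` is the unique dominant eigenvalue of `M` and it is simple: it is a simple
root of the characteristic polynomial, and every other complex eigenvalue has smaller modulus. -/
def IsSimpleDominantEigenvalue {d : ℕ} (M : Matrix (Fin d) (Fin d) ℝ) (lam : ℝ) : Prop :=
  (M.map (Complex.ofReal)).charpoly.rootMultiplicity (lam : ℂ) = 1 ∧
    ∀ μ : ℂ, (M.map (Complex.ofReal)).charpoly.IsRoot μ → μ ≠ (lam : ℂ) → ‖μ‖ < |lam|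

/-- The hypotheses on the recurrence: `A n` is invertible for all `n` and tends to the finite limit
`L`, which has the unique simple dominant eigenvalue `lam`, with the positive eigenvector `e`.
The condition `lam ≠ 0` is automatic for `d ≥ 2`. -/
structure Hypotheses {d : ℕ} (A : ℕ → Matrix (Fin d) (Fin d) ℝ) (L : Matrix (Fin d) (Fin d) ℝ)
    (lam : ℝ) (e : Fin d → ℝ) : Prop where
  det_ne_zero : ∀ n, (A n).det ≠ 0
  tendsto : Tendsto A atTop (𝓝 L)
  dominant : IsSimpleDominantEigenvalue L lam
  lam_ne_zero : lam ≠ 0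
  eigenvector : L *ᵥ e = lam • e
  pos : PosVec e

section Genericity

attribute [local instance] Matrix.linftyOpNormedAddCommGroup

/-- `v` and `w` are nonzero, `L v = lam v`, and the normalized products
`A (n-1) ... A 0 / ‖A (n-1) ... A 0‖` converge to `v wᵀ` for `lam > 0`. For `lam < 0` these
products alternate in sign in the limit, which the factor `(sign lam) ^ n` compensates. (Changing
the norm multiplies `w` by a positive number.) -/
def IsLimitPair {d : ℕ} (A : ℕ → Matrix (Fin d) (Fin d) ℝ) (L : Matrix (Fin d) (Fin d) ℝ)
    (lam : ℝ) (v w : Fin d → ℝ) : Prop :=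
  v ≠ 0 ∧ w ≠ 0 ∧ L *ᵥ v = lam • v ∧
    Tendsto (fun n => ((SignType.sign lam : ℝ) ^ n * ‖stepProd A 0 n‖⁻¹) • stepProd A 0 n)
      atTop (𝓝 (vecMulVec v w))

end Genericity

/-- Genericity of the vector of initial conditions: `wᵀ U₀ ≠ 0`. The vector `w` is
determined by `A` up to a nonzero factor, being read off the limit `v wᵀ`. -/
def Generic {d : ℕ} (A : ℕ → Matrix (Fin d) (Fin d) ℝ) (L : Matrix (Fin d) (Fin d) ℝ)
    (lam : ℝ) (U₀ : Fin d → ℝ) : Prop :=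
  ∃ v w : Fin d → ℝ, IsLimitPair A L lam v w ∧ w ⬝ᵥ U₀ ≠ 0

/-! ### Cones and certificates -/

/-- A rational invertible matrix, seen as a real invertible matrix. -/
def toReal {d : ℕ} (T : GL (Fin d) ℚ) : GL (Fin d) ℝ :=
  Matrix.GeneralLinearGroup.map (Rat.castHom ℝ) T

/-- The vector `T x`. -/
def tr {d : ℕ} (T : GL (Fin d) ℚ) (x : Fin d → ℝ) : Fin d → ℝ :=
  (toReal T).val *ᵥ x

/-- The conjugate `T M T⁻¹`. -/
def conj {d : ℕ} (T : GL (Fin d) ℚ) (M : Matrix (Fin d) (Fin d) ℝ) :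
    Matrix (Fin d) (Fin d) ℝ :=
  (toReal T).val * M * (toReal T⁻¹).val

/-- A radius: a rational number, or `r = ∞`, which is written `none`. -/
abbrev Radius := Option ℚ

/-- `r > 1` (where `r = ∞` is allowed). -/
def Radius.GtOne (r : Radius) : Prop := ∀ q ∈ r, 1 < q

/-- The cone `B_r(v)` of the positive vectors `x` with `x_i v_j ≤ r x_j v_i` for all `i`, `j`;
for `r = ∞` it is the cone of all positive vectors. -/
def coneB {d : ℕ} (r : Radius) (v : Fin d → ℝ) : Set (Fin d → ℝ) :=
  {x | PosVec x ∧ ∀ q ∈ r, ∀ i j, x i * v j ≤ (q : ℝ) * x j * v i}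

/-- The cone `C_r(v) = T⁻¹ B_r(v)`. -/
def coneC {d : ℕ} (T : GL (Fin d) ℚ) (r : Radius) (v : Fin d → ℝ) : Set (Fin d → ℝ) :=
  tr T⁻¹ '' coneB r v

/-- The data `(T, r, N, m)` of a positivity certificate. -/
structure Certificate (d : ℕ) where
  T : GL (Fin d) ℚ
  r : Radius
  N : ℕ
  m : ℕ

/-- The checks that verify a certificate, where `v = T e`. -/
structure Certificate.Valid {d : ℕ} (C : Certificate d) (A : ℕ → Matrix (Fin d) (Fin d) ℝ)
    (lam : ℝ) (e U₀ : Fin d → ℝ) : Prop where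
  one_lt_r : C.r.GtOne
  m_pos : 0 < C.m
  /- sanity checks -/
  lam_pos : 0 < lam
  v_pos : PosVec (tr C.T e)
  cone_pos : ∀ x ∈ coneC C.T C.r (tr C.T e), PosVec x
  /- initialization -/
  init_nonneg : ∀ n ≤ C.N, NonnegVec (orbit A U₀ n)
  init_cone : ∀ k < C.m, orbit A U₀ (C.N + k) ∈ coneC C.T C.r (tr C.T e)
  /- induction step -/
  step : ∀ n ≥ C.N, ∀ x ∈ coneC C.T C.r (tr C.T e),
    stepProd A n C.m *ᵥ x ∈ coneC C.T C.r (tr C.T e)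

/-! ### The algorithm `PositivityProof` -/

/-- What the algorithm may return: "Non-positive", or "Positive" with a certificate. -/
inductive Outcome (d : ℕ) where
  | nonPositive : Outcome d
  | positive (C : Certificate d) : Outcome d

/-- An outcome is correct if it is "Non-positive" and the solution is not positive,
or if it is a valid certificate. -/
def Outcome.Correct {d : ℕ} (A : ℕ → Matrix (Fin d) (Fin d) ℝ)
    (lam : ℝ) (e U₀ : Fin d → ℝ) : Outcome d → Prop
  | .nonPositive => ¬ IsPositiveSolution A U₀
  | .positive C => C.Valid A lam e U₀

/-- Second step: find `T` and `m > 0` such that `T L ^ m T⁻¹ > 0`. -/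
def FoundTm {d : ℕ} (L : Matrix (Fin d) (Fin d) ℝ) (T : GL (Fin d) ℚ) (m : ℕ) : Prop :=
  0 < m ∧ PosMat (conj T (L ^ m))

open Classical in
/-- Third step: replace `T` by `-T` if `T e < 0`. -/
def fixSign {d : ℕ} (e : Fin d → ℝ) (T : GL (Fin d) ℚ) : GL (Fin d) ℚ :=
  if PosVec (-tr T e) then -T else T

/-- Fourth step: find `r > 1` such that `T⁻¹ B_r(v) > 0`, where `v = T e`. -/
def FoundR {d : ℕ} (e : Fin d → ℝ) (T : GL (Fin d) ℚ) (r : Radius) : Prop :=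
  r.GtOne ∧ ∀ x ∈ coneB r (tr T e), PosVec (tr T⁻¹ x)

/-- Fifth step: find `K` such that `T A(n+m-1) ... A(n) T⁻¹` maps `B_r(v)` into itself
for all `n ≥ K`, where `v = T e`. -/
def FoundK {d : ℕ} (A : ℕ → Matrix (Fin d) (Fin d) ℝ) (e : Fin d → ℝ)
    (T : GL (Fin d) ℚ) (m : ℕ) (r : Radius) (K : ℕ) : Prop :=
  ∀ n ≥ K, ∀ x ∈ coneB r (tr T e), conj T (stepProd A n m) *ᵥ x ∈ coneB r (tr T e)

/-- The objects found in the steps two to five; `T` is the matrix found in step two, before the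
possible change of sign. -/
structure Choices (d : ℕ) where
  T : GL (Fin d) ℚ
  m : ℕ
  r : Radius
  K : ℕ

/-- The objects found satisfy the specification of the steps that find them. There is nothing to
satisfy if `lam < 0`: the algorithm stops before these steps. -/
def Choices.Legal {d : ℕ} (c : Choices d) (A : ℕ → Matrix (Fin d) (Fin d) ℝ)
    (L : Matrix (Fin d) (Fin d) ℝ) (lam : ℝ) (e : Fin d → ℝ) : Prop :=
  0 < lam → FoundTm L c.T c.m ∧ FoundR e (fixSign e c.T) c.r ∧
    FoundK A e (fixSign e c.T) c.m c.r c.K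

/-- The test in the last loop, with index `i`: the `m` vectors `T U_i, ..., T U_(i+m-1)` belong
to `B_r(v)`, where `v = T e`. -/
def Choices.Entered {d : ℕ} (c : Choices d) (A : ℕ → Matrix (Fin d) (Fin d) ℝ)
    (e U₀ : Fin d → ℝ) (i : ℕ) : Prop :=
  ∀ k < c.m, tr (fixSign e c.T) (orbit A U₀ (i + k)) ∈ coneB c.r (tr (fixSign e c.T) e)

/-- The last loop, which runs over `i = K, K+1, ...`, reaches the index `i`: the check of
`U_0, ..., U_K` succeeded, and no earlier pass through the loop returned. -/
def Choices.Reaches {d : ℕ} (c : Choices d) (A : ℕ → Matrix (Fin d) (Fin d) ℝ)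
    (e U₀ : Fin d → ℝ) (i : ℕ) : Prop :=
  c.K ≤ i ∧ (∀ j ≤ c.K, NonnegVec (orbit A U₀ j)) ∧
    ∀ j, c.K ≤ j → j < i → NonnegVec (orbit A U₀ j) ∧ ¬ c.Entered A e U₀ j

/-- The algorithm, started on `A` and `U₀` and finding the objects `c` in its steps two to
five, terminates and returns the given outcome. -/
inductive Returns {d : ℕ} (A : ℕ → Matrix (Fin d) (Fin d) ℝ) (lam : ℝ) (e U₀ : Fin d → ℝ)
    (c : Choices d) : Outcome d → Prop
  /-- first step -/
  | negativeEigenvalue (h : lam < 0) : Returns A lam e U₀ c .nonPositive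
  /-- the check of the terms up to index `K` fails -/
  | initialTerm (h : 0 < lam) (i : ℕ) (hi : i ≤ c.K) (hU : ¬ NonnegVec (orbit A U₀ i)) :
      Returns A lam e U₀ c .nonPositive
  /-- the last loop finds a term that is not nonnegative -/
  | laterTerm (h : 0 < lam) (i : ℕ) (hi : c.Reaches A e U₀ i)
      (hU : ¬ NonnegVec (orbit A U₀ i)) : Returns A lam e U₀ c .nonPositive
  /-- the last loop finds that the cone has been entered -/
  | certificate (h : 0 < lam) (i : ℕ) (hi : c.Reaches A e U₀ i)
      (hU : NonnegVec (orbit A U₀ i)) (hE : c.Entered A e U₀ i) :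
      Returns A lam e U₀ c (.positive ⟨fixSign e c.T, c.r, i, c.m⟩)

/-! ### Data structures for inputs and outputs

The field of coefficients is a real number field `ℚ(α)`, where `α` is given by a squarefree
polynomial and an isolating interval (`ℚ` itself is obtained with `α = 0`). Everything is coded
by tuples and lists of natural numbers, so that computability has its usual meaning. -/

/-- `(a, b, c)` codes the rational number `(a - b) / (c + 1)`. -/
abbrev RatCode := ℕ × ℕ × ℕ

/-- The rational number with a given code. -/
def ratVal (c : RatCode) : ℚ := ((c.1 : ℚ) - (c.2.1 : ℚ)) / ((c.2.2 : ℚ) + 1)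

/-- The polynomial whose list of coefficients (constant coefficient first) is given. -/
def ratPoly : List RatCode → ℚ[X]
  | [] => 0
  | c :: l => C (ratVal c) + X * ratPoly l

/-- An element `p(α)` of `ℚ(α)` is coded by a polynomial `p`. -/
abbrev EltCode := List RatCode

/-- The element of `ℚ(α)` with a given code. -/
def eltVal (α : ℝ) (c : EltCode) : ℝ := aeval α (ratPoly c)

/-- The polynomial whose list of coefficients in `ℚ(α)` is given. -/
def eltPoly (α : ℝ) : List EltCode → ℝ[X]
  | [] => 0
  | c :: l => C (eltVal α c) + X * eltPoly α l

/-- A rational function over `ℚ(α)` is coded by a numerator and a denominator. -/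
abbrev RatFunCode := List EltCode × List EltCode

/-- The real number `α`, coded by a polynomial and the endpoints of an interval. -/
abbrev FieldCode := List RatCode × RatCode × RatCode

/-- `α` is the number coded by `F`: the polynomial is squarefree, and `α` is its only
root in the interval. -/
def Isolates (F : FieldCode) (α : ℝ) : Prop :=
  Squarefree (ratPoly F.1) ∧
    ∀ β : ℝ, (aeval β (ratPoly F.1) = 0 ∧ (ratVal F.2.1 : ℝ) < β ∧ β < (ratVal F.2.2 : ℝ)) ↔ β = α

/-- An input of the algorithm: the dimension `d`, the field `ℚ(α)`, a `d × d` matrix of rational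
functions over `ℚ(α)` (a list of rows), and a vector of `d` elements of `ℚ(α)`. -/
abbrev Input := ℕ × FieldCode × List (List RatFunCode) × List EltCode

/-- The dimension `d` of an input. -/
def Input.dim (I : Input) : ℕ := I.1

/-- The entry with indices `i`, `j` of the matrix of rational functions. -/
def Input.entry (I : Input) (i j : ℕ) : RatFunCode := (I.2.2.1.getD i []).getD j ([], [])

/-- The matrices `A(n)` of an input. -/
def Input.mat (I : Input) (α : ℝ) (n : ℕ) : Matrix (Fin I.dim) (Fin I.dim) ℝ :=
  Matrix.of fun i j =>
    (eltPoly α (I.entry i j).1).eval (n : ℝ) / (eltPoly α (I.entry i j).2).eval (n : ℝ)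

/-- The vector `U₀` of an input. -/
def Input.vec (I : Input) (α : ℝ) : Fin I.dim → ℝ := fun i => eltVal α (I.2.2.2.getD i [])

/-- The input is well formed: `α` is the number it describes, and the denominators of the entries
of the matrix do not vanish at any natural number. -/
def Input.WellFormed (I : Input) (α : ℝ) : Prop :=
  Isolates I.2.1 α ∧
    ∀ (n : ℕ) (i j : Fin I.dim), (eltPoly α (I.entry i j).2).eval (n : ℝ) ≠ 0

/-- An output: `none` for "Non-positive", and codes of `T`, `r`, `N`, `m` for a certificate. -/
abbrev Output := Option (List (List RatCode) × Option RatCode × ℕ × ℕ)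

/-- The output codes the given outcome. -/
def Codes {d : ℕ} : Output → Outcome d → Prop
  | none, .nonPositive => True
  | some (T, r, N, m), .positive C =>
      (∀ i j : Fin d, C.T.val i j = ratVal ((T.getD i []).getD j (0, 0, 0))) ∧
        C.r = r.map ratVal ∧ C.N = N ∧ C.m = m
  | _, _ => False

end PosProof

end

open PosProof

/-!
# Positivity proofs for linear recurrences with a simple dominant eigenvalue

**Correctness and termination.** Everything rests on power iteration: `lam⁻ᵐ Lᵐ` tends to the
spectral projection `e fᵀ` (`exists_tendsto_normalized_pow`). On the kernel of the projection all
eigenvalues are smaller than `|lam|`, and Gelfand's formula for the spectral radius applies. Hence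
there is a rational simplicial cone around `e`, inside the positive orthant, in whose coordinates
high powers of `L` are positive up to the sign of `lamᵐ` (`Hypotheses.exists_narrow_cone`).
Conversely, whenever `T Lᵐ T⁻¹ > 0`, the same limit shows that `v = T e` is positive up to a sign
(`Hypotheses.constant_sign`). A positive matrix with positive eigenvector `v` maps each
cone `B_r(v)` into itself with room to spare, so matrices close to it do so too
(`eventually_mapsTo_coneB`), in particular the products `T A(n+m-1) ⋯ A(n) T⁻¹` for large `n`. For
small `r > 1` the vectors of `B_r(v)` are almost proportional to `v`, which gives the radius
(`exists_foundR`). The rescaled terms of a generic solution tend to a nonzero multiple of `e`; if the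
solution is positive, they end up in the cone (`eventually_entered`), and if `lam < 0` their signs
alternate (`not_isPositiveSolution_of_neg`).

**Effectivity.** Instead of carrying out the steps one by one, the machine searches for an output
together with a justification that a primitive recursive test can verify. The admissible choices
are narrowed down to `r = ∞`, `T⁻¹ > 0` and odd `m`; then the positivity of
`± T A(n+m-1) ⋯ A(n) T⁻¹` for all `n ≥ K` settles the searches for `T`, `m`, `r` and `K`, and its sign
is the sign of `lam` (`Hypotheses.sign_of_posMat`). This positivity has finite certificates
(`ProductTest`, `exists_productTest`): the entries of `A(n)` are within `ε` of a rational matrix `M`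
on the half-line `n ≥ K`, which Horner's rule at `K` can confirm (`BoundTest`), and `± T Mᵐ T⁻¹`
exceeds the effect of such a perturbation. Signs of elements of `ℚ(α)` are certified by
isolating intervals, and zeros by a common factor with the defining polynomial (`PosTest`,
`ZeroTest`); traces of computations certify terms of the solution (`OrbitTest`). All
these predicates are semidecidable, so an unbounded search finds a justified output if there is one
(`SemiDec.exists_partrec`). The search succeeds exactly when the run of the algorithm with suitable
choices terminates (`Justified.exists_returns`, `exists_legal_of_not_justified`): a run
with the certified `T`, `m` and `K` returns nothing but justified outputs.

**Reduction.** The algorithm terminates on generic data, so the machine may be started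
whenever `U₀` is generic.
-/

namespace PosProof

/-! ### Powers of a matrix with a simple dominant eigenvalue -/

section PowerLimit

variable {d : ℕ}

theorem tendsto_matrix_iff {ι R : Type*} [TopologicalSpace R] {m n : Type*} {l : Filter ι}
    {F : ι → Matrix m n R} {M : Matrix m n R} :
    Tendsto F l (𝓝 M) ↔ ∀ i j, Tendsto (fun k => F k i j) l (𝓝 (M i j)) :=
  tendsto_pi_nhds.trans (forall_congr' fun _ => tendsto_pi_nhds)

/-- The eigenspace of a simple root of the characteristic polynomial is a line. -/
theorem exists_smul_of_simple {L : Matrix (Fin d) (Fin d) ℝ} {lam : ℝ}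
    (h : L.charpoly.rootMultiplicity lam = 1) {e x : Fin d → ℝ} (he : e ≠ 0)
    (hLe : L *ᵥ e = lam • e) (hLx : L *ᵥ x = lam • x) : ∃ c : ℝ, x = c • e := by
  have hle : Module.finrank ℝ (Module.End.eigenspace (toLin' L) lam) ≤ 1 := by
    have := LinearMap.finrank_eigenspace_le (toLin' L) lam
    rwa [Matrix.charpoly_toLin', h] at this
  have mem : ∀ y : Fin d → ℝ, L *ᵥ y = lam • y → y ∈ Module.End.eigenspace (toLin' L) lam := fun y hy =>
    Module.End.mem_eigenspace_iff.2 (by simpa using hy)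
  obtain ⟨⟨v, hv⟩, hall⟩ := finrank_le_one_iff.1 hle
  obtain ⟨a, ha⟩ := hall ⟨e, mem e hLe⟩
  obtain ⟨b, hb⟩ := hall ⟨x, mem x hLx⟩
  have ha' : a • v = e := congrArg Subtype.val ha
  have hb' : b • v = x := congrArg Subtype.val hb
  have ha0 : a ≠ 0 := by
    rintro rfl
    exact he (by rw [← ha', zero_smul])
  exact ⟨b / a, by rw [← ha', ← hb', smul_smul, div_mul_cancel₀ _ ha0]⟩

theorem rootMultiplicity_of_dominant {L : Matrix (Fin d) (Fin d) ℝ} {lam : ℝ}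
    (h : IsSimpleDominantEigenvalue L lam) : L.charpoly.rootMultiplicity lam = 1 := by
  have h1 := h.1
  have h2 : (L.map Complex.ofReal).charpoly = L.charpoly.map Complex.ofRealHom :=
    Matrix.charpoly_map L Complex.ofRealHom
  rw [h2] at h1
  rw [← h1]
  exact eq_rootMultiplicity_map (f := Complex.ofRealHom) Complex.ofRealHom.injective lam

theorem polynomial_aeval_mulVec {L : Matrix (Fin d) (Fin d) ℝ} {lam : ℝ} {x : Fin d → ℝ}
    (hx : L *ᵥ x = lam • x) (p : ℝ[X]) : (aeval L p) *ᵥ x = p.eval lam • x := by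
  induction p using Polynomial.induction_on' with
  | add p q hp hq => simp [Matrix.add_mulVec, hp, hq, add_smul]
  | monomial n a =>
    have : ∀ n : ℕ, (L ^ n) *ᵥ x = lam ^ n • x := by
      intro n
      induction n with
      | zero => simp
      | succ n ih => rw [pow_succ, ← mulVec_mulVec, hx, mulVec_smul, ih, smul_smul, pow_succ,
          mul_comm]
    rw [aeval_monomial, eval_monomial, ← mulVec_mulVec, this, Algebra.algebraMap_eq_smul_one,
      smul_mulVec, one_mulVec, smul_smul]

/-- The spectral projection onto the eigenline, obtained by evaluating the cofactor of `X - lam` in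
the characteristic polynomial at the matrix. -/
theorem exists_spectral_projection {L : Matrix (Fin d) (Fin d) ℝ} {lam : ℝ} {e : Fin d → ℝ}
    (h : L.charpoly.rootMultiplicity lam = 1) (he : e ≠ 0) (hLe : L *ᵥ e = lam • e) :
    ∃ f : Fin d → ℝ, f ⬝ᵥ e = 1 ∧ L * vecMulVec e f = lam • vecMulVec e f ∧
      vecMulVec e f * L = lam • vecMulVec e f := by
  obtain ⟨q, hq, hnd⟩ := exists_eq_pow_rootMultiplicity_mul_and_not_dvd L.charpoly
    L.charpoly_monic.ne_zero lam
  rw [h, pow_one] at hq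
  have hq0 : q.eval lam ≠ 0 := fun h0 => hnd (dvd_iff_isRoot.2 h0)
  set P : Matrix (Fin d) (Fin d) ℝ := (q.eval lam)⁻¹ • aeval L q with hP
  have hz : (L - lam • 1) * aeval L q = 0 := by
    have := aeval_self_charpoly L
    rw [hq, aeval_mul] at this
    simpa [Algebra.algebraMap_eq_smul_one] using this
  have hcomm : Commute L (aeval L q) := by
    have : Commute (aeval L (X : ℝ[X])) (aeval L q) := by
      rw [Commute, SemiconjBy, ← map_mul, ← map_mul, mul_comm]
    simpa using this
  have hLP : L * P = lam • P := by
    have : L * aeval L q = lam • aeval L q := by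
      rw [sub_mul, smul_mul_assoc, one_mul] at hz
      exact sub_eq_zero.1 hz
    rw [hP, mul_smul_comm, this, smul_comm]
  have hPL : P * L = lam • P := by
    rw [← hLP, hP, mul_smul_comm, smul_mul_assoc, hcomm.eq]
  have hPe : P *ᵥ e = e := by
    rw [hP, smul_mulVec, polynomial_aeval_mulVec hLe, smul_smul, inv_mul_cancel₀ hq0, one_smul]
  have hcol : ∀ j, ∃ c : ℝ, P.col j = c • e := fun j => by
    apply exists_smul_of_simple h he hLe
    ext i
    have := congrFun (congrFun hLP i) j
    simpa [mulVec, dotProduct, Matrix.mul_apply] using this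
  choose f hf using hcol
  have hPf : P = vecMulVec e f := by
    ext i j
    have := congrFun (hf j) i
    simpa [vecMulVec_apply, mul_comm] using this
  refine ⟨f, ?_, hPf ▸ hLP, hPf ▸ hPL⟩
  obtain ⟨i, hi⟩ := Function.ne_iff.1 he
  have h1 := congrFun hPe i
  rw [hPf, vecMulVec_mulVec] at h1
  simp only [Pi.smul_apply, MulOpposite.smul_eq_mul_unop, MulOpposite.unop_op] at h1
  have : e i * (f ⬝ᵥ e - 1) = 0 := by rw [mul_sub, h1]; ring
  rcases mul_eq_zero.1 this with h2 | h2
  · exact absurd h2 hi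
  · linarith

section ComplexPowers

attribute [local instance] Matrix.linftyOpNormedAddCommGroup Matrix.linftyOpNormedRing
  Matrix.linftyOpNormedAlgebra

/-- If all complex eigenvalues have modulus less than one, then the powers tend to zero. -/
theorem tendsto_pow_zero_of_eigenvalues_lt_one [Nonempty (Fin d)] (B : Matrix (Fin d) (Fin d) ℂ)
    (h : ∀ (μ : ℂ) (x : Fin d → ℂ), x ≠ 0 → B *ᵥ x = μ • x → ‖μ‖ < 1) :
    Tendsto (fun n => B ^ n) atTop (𝓝 0) := by
  have hspec : spectralRadius ℂ B < ((1 : NNReal) : ENNReal) := by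
    apply spectrum.spectralRadius_lt_of_forall_lt
    intro z hz
    rw [spectrum.mem_iff, Matrix.isUnit_iff_isUnit_det, isUnit_iff_ne_zero, not_not,
      ← exists_mulVec_eq_zero_iff] at hz
    obtain ⟨x, hx, hx0⟩ := hz
    rw [Algebra.algebraMap_eq_smul_one, sub_mulVec, smul_mulVec, one_mulVec, sub_eq_zero] at hx0
    have := h z x hx hx0.symm
    exact_mod_cast this
  obtain ⟨r, hr1, hr2⟩ := ENNReal.lt_iff_exists_nnreal_btwn.1 hspec
  have hr2' : r < 1 := by exact_mod_cast hr2
  have ev := (spectrum.pow_nnnorm_pow_one_div_tendsto_nhds_spectralRadius B).eventually_lt_const hr1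
  refine tendsto_zero_iff_norm_tendsto_zero.2 ?_
  refine squeeze_zero' (Eventually.of_forall fun _ => norm_nonneg _) ?_
    (tendsto_pow_atTop_nhds_zero_of_lt_one r.2 hr2')
  filter_upwards [ev, eventually_gt_atTop 0] with n hn hn0
  have h1 : ((‖B ^ n‖₊ : ENNReal) ^ (1 / (n : ℝ))) ^ (n : ℝ) ≤ (r : ENNReal) ^ (n : ℝ) :=
    ENNReal.rpow_le_rpow hn.le (by positivity)
  rw [← ENNReal.rpow_mul, one_div, inv_mul_cancel₀ (by positivity), ENNReal.rpow_one,
    ENNReal.rpow_natCast] at h1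
  exact_mod_cast h1

end ComplexPowers

/-- Power iteration: the normalized powers of `L` tend to the spectral projection `e fᵀ`. -/
theorem exists_tendsto_normalized_pow {L : Matrix (Fin d) (Fin d) ℝ} {lam : ℝ} {e : Fin d → ℝ}
    (hdom : IsSimpleDominantEigenvalue L lam) (hlam : lam ≠ 0) (he : e ≠ 0)
    (hLe : L *ᵥ e = lam • e) :
    ∃ f : Fin d → ℝ, f ⬝ᵥ e = 1 ∧
      Tendsto (fun m : ℕ => (lam ^ m)⁻¹ • L ^ m) atTop (𝓝 (vecMulVec e f)) := by
  obtain ⟨i0, -⟩ := Function.ne_iff.1 he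
  have : Nonempty (Fin d) := ⟨i0⟩
  have hmult := rootMultiplicity_of_dominant hdom
  obtain ⟨f, hfe, hLP, hPL⟩ := exists_spectral_projection hmult he hLe
  refine ⟨f, hfe, ?_⟩
  set P := vecMulVec e f with hP
  have hPP : P * P = P := by
    rw [hP, vecMulVec_mul_vecMulVec, hfe]; simp
  set L1 := lam⁻¹ • L with hL1
  have hLP1 : L1 * P = P := by rw [hL1, smul_mul_assoc, hLP, smul_smul, inv_mul_cancel₀ hlam, one_smul]
  have hPL1 : P * L1 = P := by rw [hL1, mul_smul_comm, hPL, smul_smul, inv_mul_cancel₀ hlam, one_smul]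
  set B := L1 - P with hB
  have hBP : B * P = 0 := by rw [hB, sub_mul, hLP1, hPP, sub_self]
  have hPB : P * B = 0 := by rw [hB, mul_sub, hPL1, hPP, sub_self]
  have hpow : ∀ m : ℕ, L1 ^ (m + 1) = P + B ^ (m + 1) := by
    intro m
    induction m with
    | zero => simp [hB]
    | succ m ih =>
      rw [pow_succ, ih, add_mul, hPL1, pow_succ B (m + 1)]
      congr 1
      have : L1 = P + B := by rw [hB]; abel
      rw [this, mul_add, pow_succ B m, mul_assoc (B ^ m) B P, hBP, mul_zero, zero_add]
  -- the complex eigenvalues of `B` are those of `L1` with the dominant one replaced by zero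
  have hBc : Tendsto (fun n => (B.map Complex.ofReal) ^ n) atTop (𝓝 0) := by
    apply tendsto_pow_zero_of_eigenvalues_lt_one
    intro μ x hx hBx
    by_contra hge
    push Not at hge
    have hμ : μ ≠ 0 := by
      rintro rfl
      simp at hge
      linarith
    have hmap : ∀ M N : Matrix (Fin d) (Fin d) ℝ,
        (M * N).map Complex.ofReal = M.map Complex.ofReal * N.map Complex.ofReal :=
      fun M N => Matrix.map_mul (f := Complex.ofRealHom)
    have hPx : (P.map Complex.ofReal) *ᵥ x = 0 := by
      have h1 : (P.map Complex.ofReal) *ᵥ ((B.map Complex.ofReal) *ᵥ x) = 0 := by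
        rw [mulVec_mulVec, ← hmap, hPB]
        simp [Matrix.map_zero]
      rw [hBx, mulVec_smul] at h1
      exact (smul_eq_zero.1 h1).resolve_left hμ
    have hLx : (L.map Complex.ofReal) *ᵥ x = ((lam : ℂ) * μ) • x := by
      have h2 : L = lam • (B + P) := by
        rw [hB, hL1]; simp [smul_smul, mul_inv_cancel₀ hlam]
      have h3 : L.map Complex.ofReal =
          (lam : ℂ) • (B.map Complex.ofReal + P.map Complex.ofReal) := by
        rw [h2]; ext i j; simp [mul_add]
      rw [h3, smul_mulVec, add_mulVec, hPx, add_zero, hBx, smul_smul]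
    have hroot : (L.map Complex.ofReal).charpoly.IsRoot ((lam : ℂ) * μ) := by
      rw [IsRoot, eval_charpoly, ← exists_mulVec_eq_zero_iff]
      refine ⟨x, hx, ?_⟩
      rw [sub_mulVec, hLx]
      simp [Matrix.scalar_apply, ← smul_one_eq_diagonal, smul_mulVec]
    by_cases hμ1 : μ = 1
    · -- the eigenvector would be fixed by the projection, which kills it
      subst hμ1
      rw [mul_one] at hLx
      have hre : L *ᵥ (fun i => (x i).re) = lam • fun i => (x i).re := by
        ext i
        have := congrArg Complex.re (congrFun hLx i)
        simpa [mulVec, dotProduct] using this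
      have him : L *ᵥ (fun i => (x i).im) = lam • fun i => (x i).im := by
        ext i
        have := congrArg Complex.im (congrFun hLx i)
        simpa [mulVec, dotProduct] using this
      have key : ∀ y : Fin d → ℝ, L *ᵥ y = lam • y → P *ᵥ y = y := by
        intro y hy
        obtain ⟨c, rfl⟩ := exists_smul_of_simple hmult he hLe hy
        rw [mulVec_smul, hP, vecMulVec_mulVec, hfe]; simp
      apply hx
      ext i
      apply Complex.ext
      · have h1 := congrFun (key _ hre) i
        have h2 := congrArg Complex.re (congrFun hPx i)
        simp only [mulVec, dotProduct, map_apply, Complex.re_sum, Complex.re_ofReal_mul,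
          Pi.zero_apply, Complex.zero_re] at h1 h2 ⊢
        rw [← h1, h2]
      · have h1 := congrFun (key _ him) i
        have h2 := congrArg Complex.im (congrFun hPx i)
        simp only [mulVec, dotProduct, map_apply, Complex.im_sum, Complex.im_ofReal_mul,
          Pi.zero_apply, Complex.zero_im] at h1 h2 ⊢
        rw [← h1, h2]
    · have := hdom.2 _ hroot (by
        intro h0
        apply hμ1
        have hl : (lam : ℂ) ≠ 0 := by exact_mod_cast hlam
        exact mul_left_cancel₀ hl (by rw [h0, mul_one]))
      rw [norm_mul, Complex.norm_real, Real.norm_eq_abs] at this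
      have habs : 0 < |lam| := abs_pos.2 hlam
      nlinarith
  have hB0 : Tendsto (fun n => B ^ n) atTop (𝓝 0) := by
    refine tendsto_matrix_iff.2 fun i j => ?_
    have h1 := tendsto_matrix_iff.1 hBc i j
    have h2 := (Complex.continuous_re.tendsto _).comp h1
    have h3 : ∀ n : ℕ, (B.map Complex.ofReal) ^ n = (B ^ n).map Complex.ofReal := fun n =>
      (Matrix.map_pow (f := Complex.ofRealHom) B n).symm
    simpa [Function.comp_def, h3] using h2
  have hlim : Tendsto (fun m => L1 ^ (m + 1)) atTop (𝓝 P) := by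
    simp_rw [hpow]
    simpa using (tendsto_const_nhds (x := P)).add (hB0.comp (tendsto_add_atTop_nat 1))
  have := (tendsto_add_atTop_iff_nat 1).1 hlim
  refine this.congr fun m => ?_
  rw [hL1, _root_.smul_pow, inv_pow]

end PowerLimit

/-! ### Changes of coordinates and positive matrices -/

section Basics

variable {d : ℕ}

theorem toReal_apply (T : GL (Fin d) ℚ) (i j : Fin d) :
    (toReal T).val i j = ((T.val i j : ℚ) : ℝ) := rfl

theorem toReal_mul_inv (T : GL (Fin d) ℚ) : (toReal T).val * (toReal T⁻¹).val = 1 := by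
  rw [← Units.val_mul, toReal, toReal, ← map_mul, mul_inv_cancel, map_one, Units.val_one]

theorem toReal_inv_mul (T : GL (Fin d) ℚ) : (toReal T⁻¹).val * (toReal T).val = 1 := by
  simpa using toReal_mul_inv T⁻¹

theorem tr_tr_inv (T : GL (Fin d) ℚ) (x : Fin d → ℝ) : tr T (tr T⁻¹ x) = x := by
  rw [tr, tr, mulVec_mulVec, toReal_mul_inv, one_mulVec]

theorem tr_inv_tr (T : GL (Fin d) ℚ) (x : Fin d → ℝ) : tr T⁻¹ (tr T x) = x := by
  rw [tr, tr, mulVec_mulVec, toReal_inv_mul, one_mulVec]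

theorem tr_smul (T : GL (Fin d) ℚ) (c : ℝ) (x : Fin d → ℝ) : tr T (c • x) = c • tr T x := by
  rw [tr, tr, mulVec_smul]

theorem tr_mulVec (T : GL (Fin d) ℚ) (M : Matrix (Fin d) (Fin d) ℝ) (x : Fin d → ℝ) :
    tr T (M *ᵥ x) = conj T M *ᵥ tr T x := by
  rw [tr, tr, conj, mulVec_mulVec, mulVec_mulVec, mul_assoc, mul_assoc, toReal_inv_mul, mul_one]

theorem conj_mul (T : GL (Fin d) ℚ) (M N : Matrix (Fin d) (Fin d) ℝ) :
    conj T (M * N) = conj T M * conj T N := by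
  simp only [conj, mul_assoc]
  rw [← mul_assoc (toReal T⁻¹).val (toReal T).val, toReal_inv_mul, one_mul]

theorem conj_pow (T : GL (Fin d) ℚ) (M : Matrix (Fin d) (Fin d) ℝ) (k : ℕ) :
    conj T (M ^ k) = conj T M ^ k := by
  induction k with
  | zero => simp [conj, toReal_mul_inv]
  | succ k ih => rw [pow_succ, conj_mul, ih, pow_succ]

theorem conj_smul (T : GL (Fin d) ℚ) (c : ℝ) (M : Matrix (Fin d) (Fin d) ℝ) :
    conj T (c • M) = c • conj T M := by
  simp [conj]

theorem toReal_neg (T : GL (Fin d) ℚ) : (toReal (-T)).val = -(toReal T).val := by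
  ext i j
  simp [toReal_apply]

theorem conj_neg (T : GL (Fin d) ℚ) (M : Matrix (Fin d) (Fin d) ℝ) : conj (-T) M = conj T M := by
  simp [conj, toReal_neg]

theorem tr_neg (T : GL (Fin d) ℚ) (x : Fin d → ℝ) : tr (-T) x = -tr T x := by
  rw [tr, tr, toReal_neg, neg_mulVec]

theorem conj_fixSign (e : Fin d → ℝ) (T : GL (Fin d) ℚ) (M : Matrix (Fin d) (Fin d) ℝ) :
    conj (fixSign e T) M = conj T M := by
  unfold fixSign
  split_ifs
  · exact conj_neg T M
  · rfl

theorem continuous_conj (T : GL (Fin d) ℚ) : Continuous (conj T) := by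
  unfold conj
  fun_prop

theorem continuous_tr (T : GL (Fin d) ℚ) : Continuous (tr T) := by
  unfold tr
  fun_prop

theorem mem_coneC {T : GL (Fin d) ℚ} {r : Radius} {v x : Fin d → ℝ} :
    x ∈ coneC T r v ↔ tr T x ∈ coneB r v := by
  constructor
  · rintro ⟨y, hy, rfl⟩
    rwa [tr_tr_inv]
  · exact fun h => ⟨_, h, tr_inv_tr T x⟩

theorem mulVec_apply_eq_sum (M : Matrix (Fin d) (Fin d) ℝ) (x : Fin d → ℝ) (i : Fin d) :
    (M *ᵥ x) i = ∑ k, M i k * x k := rfl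

theorem PosMat.mulVec {M : Matrix (Fin d) (Fin d) ℝ} (hM : PosMat M) {x : Fin d → ℝ}
    (hx : PosVec x) : PosVec (M *ᵥ x) := fun i =>
  Finset.sum_pos (fun j _ => mul_pos (hM i j) (hx j)) ⟨i, Finset.mem_univ i⟩

theorem PosMat.mulVec_of_nonneg {M : Matrix (Fin d) (Fin d) ℝ} (hM : PosMat M) {x : Fin d → ℝ}
    (hx : NonnegVec x) (hx0 : x ≠ 0) : PosVec (M *ᵥ x) := by
  obtain ⟨k, hk⟩ := Function.ne_iff.1 hx0
  exact fun i => Finset.sum_pos' (fun j _ => mul_nonneg (hM i j).le (hx j))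
    ⟨k, Finset.mem_univ k, mul_pos (hM i k) (lt_of_le_of_ne (hx k) (Ne.symm hk))⟩

theorem PosMat.mul {M N : Matrix (Fin d) (Fin d) ℝ} (hM : PosMat M) (hN : PosMat N) :
    PosMat (M * N) := fun i j =>
  Finset.sum_pos (fun k _ => mul_pos (hM i k) (hN k j)) ⟨i, Finset.mem_univ i⟩

theorem PosMat.pow {M : Matrix (Fin d) (Fin d) ℝ} (hM : PosMat M) (k : ℕ) :
    PosMat (M ^ (k + 1)) := by
  induction k with
  | zero => simpa using hM
  | succ k ih => rw [pow_succ]; exact ih.mul hM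

theorem pow_mulVec_of_eigenvector {L : Matrix (Fin d) (Fin d) ℝ} {lam : ℝ} {e : Fin d → ℝ}
    (h : L *ᵥ e = lam • e) (k : ℕ) : (L ^ k) *ᵥ e = lam ^ k • e := by
  simpa using polynomial_aeval_mulVec h (X ^ k)

theorem conj_pow_mulVec_of_eigenvector {L : Matrix (Fin d) (Fin d) ℝ} {lam : ℝ} {e : Fin d → ℝ}
    (h : L *ᵥ e = lam • e) (T : GL (Fin d) ℚ) (k : ℕ) :
    conj T (L ^ k) *ᵥ tr T e = lam ^ k • tr T e := by
  rw [← tr_mulVec, pow_mulVec_of_eigenvector h, tr_smul]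

end Basics

section Perron

variable {d : ℕ} {A : ℕ → Matrix (Fin d) (Fin d) ℝ} {L : Matrix (Fin d) (Fin d) ℝ} {lam : ℝ}
  {e U₀ : Fin d → ℝ}

theorem Hypotheses.nonempty (h : Hypotheses A L lam e) : Nonempty (Fin d) := by
  by_contra hd
  rw [not_nonempty_iff] at hd
  have h1 := rootMultiplicity_of_dominant h.dominant
  have : L.charpoly = 1 := by simp [charpoly]
  rw [this, ← C_1, rootMultiplicity_C] at h1
  exact zero_ne_one h1

theorem Hypotheses.ne_zero (h : Hypotheses A L lam e) : e ≠ 0 := by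
  obtain ⟨i⟩ := h.nonempty
  exact fun h0 => (h.pos i).ne' (congrFun h0 i)

/-- Perron–Frobenius: if a conjugate of a power of `L` is positive, then the dominant eigenvector
has coordinates of constant sign. The normalized powers of the conjugate tend to a nonzero
nonnegative matrix `v gᵀ`, so `v` is up to sign a nonnegative eigenvector of a positive matrix. -/
theorem Hypotheses.constant_sign (h : Hypotheses A L lam e) {T : GL (Fin d) ℚ} {k : ℕ}
    (hk : 0 < k) (hlam : 0 < lam ^ k) (hM : PosMat (conj T (L ^ k))) :
    PosVec (tr T e) ∨ PosVec (-tr T e) := by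
  obtain ⟨f, hfe, hlim⟩ := exists_tendsto_normalized_pow h.dominant h.lam_ne_zero h.ne_zero
    h.eigenvector
  set v := tr T e with hv
  set g := f ᵥ* (toReal T⁻¹).val with hg
  have hsub : Tendsto (fun n => ((lam ^ k) ^ (n + 1))⁻¹ • conj T (L ^ k) ^ (n + 1)) atTop
      (𝓝 (vecMulVec v g)) := by
    have h1 := ((continuous_conj T).tendsto _).comp hlim
    have h2 : Tendsto (fun n : ℕ => k * (n + 1)) atTop atTop :=
      (tendsto_add_atTop_nat 1).const_mul_atTop' hk
    have h3 : conj T (vecMulVec e f) = vecMulVec v g := by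
      rw [conj, mul_vecMulVec, vecMulVec_mul]; rfl
    rw [h3] at h1
    refine (h1.comp h2).congr fun n => ?_
    simp only [Function.comp_apply]
    rw [conj_smul, pow_mul, pow_mul, conj_pow T (L ^ k)]
  have hnn : ∀ i j, 0 ≤ v i * g j := by
    intro i j
    refine ge_of_tendsto' (tendsto_matrix_iff.1 hsub i j) fun n => ?_
    exact mul_nonneg (inv_nonneg.2 (by positivity)) (hM.pow n i j).le
  have hgv : g ⬝ᵥ v = 1 := by
    rw [hg, hv, tr, ← dotProduct_mulVec, mulVec_mulVec, toReal_inv_mul, one_mulVec, hfe]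
  obtain ⟨j, hj⟩ : ∃ j, g j ≠ 0 := by
    by_contra hall
    push Not at hall
    rw [show g = 0 from funext hall, zero_dotProduct] at hgv
    exact zero_ne_one hgv
  have heig : conj T (L ^ k) *ᵥ v = lam ^ k • v :=
    conj_pow_mulVec_of_eigenvector h.eigenvector T k
  have hv0 : v ≠ 0 := fun h0 => by rw [h0, dotProduct_zero] at hgv; exact zero_ne_one hgv
  have key : PosVec (conj T (L ^ k) *ᵥ (g j • v)) :=
    hM.mulVec_of_nonneg (fun i => by simpa [mul_comm] using hnn i j) (smul_ne_zero hj hv0)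
  rw [mulVec_smul, heig] at key
  rcases lt_or_gt_of_ne hj with hneg | hpos
  · right
    intro i
    have h1 : 0 < g j * (lam ^ k * v i) := key i
    have h2 : lam ^ k * v i < 0 := by
      by_contra hc
      exact absurd h1 (not_lt.2 (mul_nonpos_of_nonpos_of_nonneg hneg.le (not_lt.1 hc)))
    have h3 : v i < 0 := by
      by_contra hc
      exact absurd h2 (not_lt.2 (mul_nonneg hlam.le (not_lt.1 hc)))
    simpa using h3
  · left
    intro i
    have h1 : 0 < g j * (lam ^ k * v i) := key i
    exact pos_of_mul_pos_right (pos_of_mul_pos_right h1 hpos.le) hlam.le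

/-- A simplicial cone with rational edges so close to the direction of `e` that it is contained in
the positive orthant; in the corresponding coordinates the normalized powers of `L` are eventually
positive. The edges are the columns of a rational approximation of `(1 - ε) e gᵀ + ε`, where
`g > 0` and `gᵀ e = 1`. -/
theorem Hypotheses.exists_narrow_cone (h : Hypotheses A L lam e) :
    ∃ T : GL (Fin d) ℚ, PosMat (toReal T⁻¹).val ∧
      ∀ᶠ m in atTop, PosMat ((lam ^ m)⁻¹ • conj T (L ^ m)) := by
  have hne := h.nonempty
  obtain ⟨f, hfe, hlim⟩ := exists_tendsto_normalized_pow h.dominant h.lam_ne_zero h.ne_zero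
    h.eigenvector
  have hd : (0 : ℝ) < d := by
    obtain ⟨i⟩ := hne
    exact_mod_cast i.pos
  set g : Fin d → ℝ := fun i => ((d : ℝ) * e i)⁻¹ with hgdef
  have hgpos : ∀ i, 0 < g i := fun i => inv_pos.2 (mul_pos hd (h.pos i))
  have hge : g ⬝ᵥ e = 1 := by
    have : ∀ i, g i * e i = (d : ℝ)⁻¹ := fun i => by
      rw [hgdef]; have := (h.pos i).ne'; field_simp
    simp [dotProduct, this, hd.ne']
  obtain ⟨ε, hε0, hε1, hεf⟩ : ∃ ε : ℝ, 0 < ε ∧ ε < 1 ∧ ∀ j, 0 < (1 - ε) * g j + ε * f j := by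
    have h1 : ∀ᶠ ε in 𝓝 (0 : ℝ), ∀ j, 0 < (1 - ε) * g j + ε * f j := by
      rw [eventually_all]
      intro j
      have hc : ContinuousAt (fun ε : ℝ => (1 - ε) * g j + ε * f j) 0 := by fun_prop
      exact hc.eventually (lt_mem_nhds (by simpa using hgpos j))
    have h2 : ∀ᶠ ε in 𝓝[>] (0 : ℝ), 0 < ε ∧ ε < 1 :=
      Filter.Eventually.and self_mem_nhdsWithin
        (nhdsWithin_le_nhds (gt_mem_nhds one_pos))
    obtain ⟨ε, ⟨h3, h4⟩, h5⟩ := (h2.and (nhdsWithin_le_nhds h1)).exists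
    exact ⟨ε, h3, h4, h5⟩
  set S₀ : Matrix (Fin d) (Fin d) ℝ := (1 - ε) • vecMulVec e g + ε • 1 with hS₀
  have hS₀e : S₀ *ᵥ e = e := by
    rw [hS₀, add_mulVec, smul_mulVec, smul_mulVec, vecMulVec_mulVec, hge, one_mulVec]
    ext i; simp
    ring
  have hinv : S₀ * ((1 - ε⁻¹) • vecMulVec e g + ε⁻¹ • 1) = 1 := by
    have hPP : vecMulVec e g * vecMulVec e g = vecMulVec e g := by
      rw [vecMulVec_mul_vecMulVec, hge]; simp
    rw [hS₀, add_mul, mul_add, mul_add, smul_mul_smul_comm, hPP, smul_mul_smul_comm,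
      smul_mul_smul_comm, smul_mul_smul_comm, mul_one, one_mul, one_mul, add_assoc,
      ← add_assoc (((1 - ε) * ε⁻¹) • vecMulVec e g), ← add_smul, ← add_assoc, ← add_smul]
    rw [mul_inv_cancel₀ hε0.ne', one_smul]
    have : (1 - ε) * (1 - ε⁻¹) + ((1 - ε) * ε⁻¹ + ε * (1 - ε⁻¹)) = 0 := by
      field_simp; ring
    rw [this, zero_smul, zero_add]
  have hdet₀ : S₀.det ≠ 0 := fun h0 => by
    have := congrArg det hinv
    rw [det_mul, h0, zero_mul, det_one] at this
    exact zero_ne_one this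
  -- all requirements are open conditions on the matrix of edges
  have hopen : ∀ᶠ S in 𝓝 S₀, (∀ i j, 0 < S i j) ∧ (∀ j, 0 < (f ᵥ* S) j) ∧
      ∀ i, 0 < S.det * (S.adjugate *ᵥ e) i := by
    refine (eventually_all.2 fun i => eventually_all.2 fun j => ?_).and
      ((eventually_all.2 fun j => ?_).and (eventually_all.2 fun i => ?_))
    · have hc : Continuous fun S : Matrix (Fin d) (Fin d) ℝ => S i j := by fun_prop
      refine hc.continuousAt.eventually (lt_mem_nhds ?_)
      have h1 : 0 < (1 - ε) * (e i * g j) :=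
        mul_pos (by linarith) (mul_pos (h.pos i) (hgpos j))
      have h2 : 0 ≤ ε * (1 : Matrix (Fin d) (Fin d) ℝ) i j := by
        rw [one_apply]; split_ifs <;> simp [hε0.le]
      simp only [hS₀, Matrix.add_apply, Matrix.smul_apply, smul_eq_mul, vecMulVec_apply]
      linarith
    · have hc : Continuous fun S : Matrix (Fin d) (Fin d) ℝ => (f ᵥ* S) j := by fun_prop
      refine hc.continuousAt.eventually (lt_mem_nhds ?_)
      have : f ᵥ* S₀ = (1 - ε) • g + ε • f := by
        rw [hS₀, vecMul_add, vecMul_smul, vecMul_smul, vecMul_vecMulVec, hfe, vecMul_one, one_smul]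
      show 0 < (f ᵥ* S₀) j
      rw [this]
      simpa using hεf j
    · have hc : Continuous fun S : Matrix (Fin d) (Fin d) ℝ =>
          S.det * (S.adjugate *ᵥ e) i := by
        refine (continuous_id.matrix_det).mul ?_
        exact (continuous_apply i).comp ((continuous_id.matrix_adjugate).matrix_mulVec
          continuous_const)
      refine hc.continuousAt.eventually (lt_mem_nhds ?_)
      have : S₀.adjugate *ᵥ e = S₀.det • e := by
        conv_lhs => rw [← hS₀e]
        rw [mulVec_mulVec, adjugate_mul, smul_mulVec, one_mulVec]
      show 0 < S₀.det * (S₀.adjugate *ᵥ e) i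
      rw [this]
      have h2 : 0 < S₀.det * S₀.det := mul_self_pos.2 hdet₀
      simpa [← mul_assoc] using mul_pos h2 (h.pos i)
  have hdense : DenseRange fun M : Matrix (Fin d) (Fin d) ℚ => M.map (Rat.cast : ℚ → ℝ) := by
    have h1 : DenseRange (Pi.map fun _ : Fin d => Pi.map fun _ : Fin d => (Rat.cast : ℚ → ℝ)) :=
      DenseRange.piMap fun _ => DenseRange.piMap fun _ => Rat.denseRange_cast
    exact h1
  obtain ⟨U, hU, hUo, hUS⟩ := eventually_nhds_iff.1 hopen
  obtain ⟨Sq, hSq⟩ := hdense.exists_mem_open hUo ⟨S₀, hUS⟩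
  obtain ⟨hSpos, hSf, hSe⟩ := hU _ hSq
  have hdet : (Sq.map (Rat.cast : ℚ → ℝ)).det ≠ 0 := fun h0 => by
    obtain ⟨i⟩ := hne
    have := hSe i
    rw [h0, zero_mul] at this
    exact lt_irrefl _ this
  have hdetq : Sq.det ≠ 0 := fun h0 => hdet (by
    have := (RingHom.map_det (Rat.castHom ℝ) Sq).symm
    rw [h0, map_zero] at this
    exact this)
  set G := Matrix.GeneralLinearGroup.mkOfDetNeZero Sq hdetq with hG
  have hGval : (toReal G).val = Sq.map (Rat.cast : ℚ → ℝ) := rfl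
  refine ⟨G⁻¹, by rw [inv_inv, hGval]; exact hSpos, ?_⟩
  have hTe : PosVec (tr G⁻¹ e) := by
    have h1 : (Sq.map (Rat.cast : ℚ → ℝ)).det • tr G⁻¹ e
        = (Sq.map (Rat.cast : ℚ → ℝ)).adjugate *ᵥ e := by
      have h2 : e = tr G (tr G⁻¹ e) := (tr_tr_inv G e).symm
      conv_rhs => rw [h2]
      rw [tr.eq_1 G, hGval, mulVec_mulVec, adjugate_mul, smul_mulVec, one_mulVec]
    intro i
    have h3 := hSe i
    rw [← h1] at h3
    simp only [Pi.smul_apply, smul_eq_mul, ← mul_assoc] at h3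
    exact pos_of_mul_pos_right h3 (mul_self_nonneg _)
  have hl := ((continuous_conj G⁻¹).tendsto _).comp hlim
  have h3 : conj G⁻¹ (vecMulVec e f) = vecMulVec (tr G⁻¹ e) (f ᵥ* (toReal G).val) := by
    rw [conj, mul_vecMulVec, vecMulVec_mul, inv_inv]; rfl
  rw [h3] at hl
  refine eventually_all.2 fun i => eventually_all.2 fun j => ?_
  have h4 := (tendsto_matrix_iff.1 hl i j).eventually
    (lt_mem_nhds (a := 0) (mul_pos (hTe i) (hSf j)))
  filter_upwards [h4] with m hm
  simpa [Function.comp_def, conj_smul] using hm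

theorem posVec_fixSign (h : Hypotheses A L lam e) (hlam : 0 < lam) {T : GL (Fin d) ℚ} {m : ℕ}
    (hT : FoundTm L T m) : PosVec (tr (fixSign e T) e) := by
  unfold fixSign
  split_ifs with hneg
  · rw [tr_neg]
    exact hneg
  · exact (h.constant_sign hT.1 (pow_pos hlam m) hT.2).resolve_right hneg

/-- The vectors of `B_q(v)` differ little from multiples of `v` when `q` is close to one. -/
theorem exists_foundR (h : Hypotheses A L lam e) {T : GL (Fin d) ℚ} (hv : PosVec (tr T e)) :
    ∃ r, FoundR e T r := by
  obtain ⟨i0⟩ := h.nonempty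
  set v := tr T e with hvdef
  set S := (toReal T⁻¹).val with hS
  have hSv : S *ᵥ v = e := tr_inv_tr T e
  set c : Fin d → ℝ := fun k => ∑ i, |S k i| * v i with hc
  obtain ⟨q, hq1, hq⟩ : ∃ q : ℚ, 1 < q ∧ ∀ k, ((q : ℝ) - 1) * c k < e k := by
    have h1 : ∀ᶠ q in 𝓝 (1 : ℝ), ∀ k, (q - 1) * c k < e k := by
      rw [eventually_all]
      intro k
      have hcont : ContinuousAt (fun q : ℝ => (q - 1) * c k) 1 := by fun_prop
      exact hcont.eventually (gt_mem_nhds (by simpa using h.pos k))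
    obtain ⟨b, hb, hsub⟩ := exists_Ico_subset_of_mem_nhds h1 ⟨2, one_lt_two⟩
    obtain ⟨q, hq, hqb⟩ := exists_rat_btwn hb
    exact ⟨q, by exact_mod_cast hq, hsub ⟨hq.le, hqb⟩⟩
  refine ⟨some q, fun q' hq' => by cases hq'; exact hq1, fun x ⟨hx, hxq⟩ k => ?_⟩
  have hq1' : (1 : ℝ) < q := by exact_mod_cast hq1
  set t := x i0 / v i0 with ht
  have htpos : 0 < t := div_pos (hx i0) (hv i0)
  have hxt : ∀ i, |x i - t * v i| ≤ ((q : ℝ) - 1) * (t * v i) := by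
    intro i
    have h1 := hxq q rfl i i0
    have h2 := hxq q rfl i0 i
    have h3 : x i0 = t * v i0 := (div_mul_cancel₀ _ (hv i0).ne').symm
    rw [h3] at h1 h2
    have h4 : x i ≤ q * (t * v i) := le_of_mul_le_mul_right (by linarith) (hv i0)
    have h5 : t * v i ≤ q * x i := le_of_mul_le_mul_right (by linarith) (hv i0)
    have h6 : 0 < t * v i := mul_pos htpos (hv i)
    rw [abs_le]
    constructor
    · nlinarith
    · linarith
  have h7 : tr T⁻¹ x k = t * e k + ∑ i, S k i * (x i - t * v i) := by
    rw [← hSv, tr, mulVec_apply_eq_sum, mulVec_apply_eq_sum, Finset.mul_sum,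
      ← Finset.sum_add_distrib]
    exact Finset.sum_congr rfl fun i _ => by ring
  have h8 : |∑ i, S k i * (x i - t * v i)| ≤ t * (((q : ℝ) - 1) * c k) := by
    refine (Finset.abs_sum_le_sum_abs _ _).trans ?_
    rw [hc, Finset.mul_sum, Finset.mul_sum]
    refine Finset.sum_le_sum fun i _ => ?_
    rw [abs_mul]
    calc |S k i| * |x i - t * v i| ≤ |S k i| * (((q : ℝ) - 1) * (t * v i)) :=
          mul_le_mul_of_nonneg_left (hxt i) (abs_nonneg _)
      _ = t * (((q : ℝ) - 1) * (|S k i| * v i)) := by ring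
  have h9 := mul_lt_mul_of_pos_left (hq k) htpos
  rw [h7]
  linarith [(abs_le.1 h8).1]

theorem tendsto_stepProd (h : Tendsto A atTop (𝓝 L)) (m : ℕ) :
    Tendsto (fun n => stepProd A n m) atTop (𝓝 (L ^ m)) := by
  induction m with
  | zero => simp [stepProd]
  | succ m ih =>
    rw [pow_succ']
    have hc : Continuous fun p : Matrix (Fin d) (Fin d) ℝ × Matrix (Fin d) (Fin d) ℝ =>
        p.1 * p.2 := continuous_fst.matrix_mul continuous_snd
    exact (hc.tendsto (L, L ^ m)).comp
      ((h.comp (tendsto_add_atTop_nat m)).prodMk_nhds ih)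

/-- A positive matrix with positive eigenvector `v` contracts the cone `B_r(v)`, and so do the
matrices close to it. For finite `r = q` the reason is the identity
`ρ (q (M x)_j v_i - (M x)_i v_j) = ∑_{k,l} M_jk M_il (q x_k v_l - x_l v_k)`. -/
theorem eventually_mapsTo_coneB {M : Matrix (Fin d) (Fin d) ℝ} {F : ℕ → Matrix (Fin d) (Fin d) ℝ}
    (hF : Tendsto F atTop (𝓝 M)) (hM : PosMat M) {v : Fin d → ℝ} (hv : PosVec v) {ρ : ℝ}
    (hρ : 0 < ρ) (hMv : M *ᵥ v = ρ • v) {r : Radius} (hr : r.GtOne) :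
    ∀ᶠ n in atTop, ∀ x ∈ coneB r v, F n *ᵥ x ∈ coneB r v := by
  have hpos : ∀ᶠ n in atTop, PosMat (F n) :=
    eventually_all.2 fun i => eventually_all.2 fun j =>
      (tendsto_matrix_iff.1 hF i j).eventually (lt_mem_nhds (hM i j))
  cases r with
  | none =>
    filter_upwards [hpos] with n hn x hx
    exact ⟨hn.mulVec hx.1, fun q hq => by cases hq⟩
  | some q =>
    have hq1 : (1 : ℝ) < q := by exact_mod_cast hr q rfl
    set a : Matrix (Fin d) (Fin d) ℝ → Fin d → Fin d → Fin d → ℝ :=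
      fun N i j k => q * N j k * v i - N i k * v j with ha
    set c : Fin d → Fin d → Fin d → ℝ := fun i j k => ρ⁻¹ * ((q - 1) * (M j k * M i k * v k)) with hc
    have hcpos : ∀ i j k, 0 < c i j k := fun i j k =>
      mul_pos (inv_pos.2 hρ) (mul_pos (by linarith) (mul_pos (mul_pos (hM j k) (hM i k)) (hv k)))
    have hev : ∀ᶠ n in atTop, ∀ i j k, a M i j k - c i j k < a (F n) i j k := by
      refine eventually_all.2 fun i => eventually_all.2 fun j => eventually_all.2 fun k => ?_
      have h1 : Tendsto (fun n => a (F n) i j k) atTop (𝓝 (a M i j k)) :=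
        (((tendsto_matrix_iff.1 hF j k).const_mul _).mul_const _).sub
          ((tendsto_matrix_iff.1 hF i k).mul_const _)
      exact h1.eventually (lt_mem_nhds (by linarith [hcpos i j k]))
    filter_upwards [hpos, hev] with n hn hn' x hx
    refine ⟨hn.mulVec hx.1, fun q' hq' i j => ?_⟩
    cases hq'
    have hexp : ∀ N : Matrix (Fin d) (Fin d) ℝ,
        q * (N *ᵥ x) j * v i - (N *ᵥ x) i * v j = ∑ k, a N i j k * x k := by
      intro N
      rw [mulVec_apply_eq_sum, mulVec_apply_eq_sum, Finset.mul_sum, Finset.sum_mul, Finset.sum_mul,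
        ← Finset.sum_sub_distrib]
      exact Finset.sum_congr rfl fun k _ => by rw [ha]; ring
    have hid : ρ * ∑ k, a M i j k * x k =
        ∑ k, ∑ l, M j k * M i l * (q * x k * v l - x l * v k) := by
      have hi : ρ * v i = ∑ l, M i l * v l := by
        rw [← mulVec_apply_eq_sum, hMv]; rfl
      have hj : ρ * v j = ∑ l, M j l * v l := by
        rw [← mulVec_apply_eq_sum, hMv]; rfl
      have e1 : ∑ k, ∑ l, M j k * M i l * (q * x k * v l) =
          q * (M *ᵥ x) j * (ρ * v i) := by
        rw [hi, mulVec_apply_eq_sum, mul_assoc, Finset.sum_mul_sum, Finset.mul_sum]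
        refine Finset.sum_congr rfl fun k _ => ?_
        rw [Finset.mul_sum]
        exact Finset.sum_congr rfl fun l _ => by ring
      have e2 : ∑ k, ∑ l, M j k * M i l * (x l * v k) = (M *ᵥ x) i * (ρ * v j) := by
        rw [hj, mulVec_apply_eq_sum, mul_comm, Finset.sum_mul_sum]
        refine Finset.sum_congr rfl fun k _ => ?_
        exact Finset.sum_congr rfl fun l _ => by ring
      simp_rw [mul_sub, Finset.sum_sub_distrib]
      rw [e1, e2, ← hexp M]
      ring
    have hlow : ρ * ∑ k, c i j k * x k ≤ ρ * ∑ k, a M i j k * x k := by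
      rw [hid, Finset.mul_sum]
      refine Finset.sum_le_sum fun k _ => ?_
      have hnn : ∀ l, 0 ≤ M j k * M i l * (q * x k * v l - x l * v k) := fun l =>
        mul_nonneg (mul_pos (hM j k) (hM i l)).le (sub_nonneg.2 (hx.2 q rfl l k))
      refine le_trans (le_of_eq ?_) (Finset.single_le_sum (fun l _ => hnn l) (Finset.mem_univ k))
      rw [hc]
      field_simp
    have hle := le_of_mul_le_mul_left hlow hρ
    have hn2 : ∑ k, (a M i j k - c i j k) * x k ≤ ∑ k, a (F n) i j k * x k :=
      Finset.sum_le_sum fun k _ => mul_le_mul_of_nonneg_right (hn' i j k).le (hx.1 k).le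
    simp_rw [sub_mul, Finset.sum_sub_distrib] at hn2
    have := hexp (F n)
    linarith

/-- As `T A(n+m-1) ⋯ A(n) T⁻¹` tends to `T L ^ m T⁻¹ > 0`, it eventually contracts the cone. -/
theorem exists_foundK (h : Hypotheses A L lam e) (hlam : 0 < lam) {T : GL (Fin d) ℚ} {m : ℕ}
    (hT : FoundTm L T m) {r : Radius} (hr : r.GtOne) :
    ∃ K, FoundK A e (fixSign e T) m r K := by
  have hlim : Tendsto (fun n => conj (fixSign e T) (stepProd A n m)) atTop
      (𝓝 (conj (fixSign e T) (L ^ m))) :=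
    ((continuous_conj _).tendsto _).comp (tendsto_stepProd h.tendsto m)
  have hM : PosMat (conj (fixSign e T) (L ^ m)) := by
    rw [conj_fixSign]; exact hT.2
  exact eventually_atTop.1 (eventually_mapsTo_coneB hlim hM (posVec_fixSign h hlam hT)
    (pow_pos hlam m) (conj_pow_mulVec_of_eigenvector h.eigenvector _ m) hr)

theorem exists_foundTm (h : Hypotheses A L lam e) (hlam : 0 < lam) : ∃ T m, FoundTm L T m := by
  obtain ⟨T, -, hT⟩ := h.exists_narrow_cone
  obtain ⟨m, hm, hm0⟩ := (hT.and (eventually_gt_atTop 0)).exists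
  refine ⟨T, m, hm0, fun i j => ?_⟩
  exact pos_of_mul_pos_right (hm i j) (inv_nonneg.2 (pow_pos hlam m).le)

end Perron

/-! ### Correctness and termination -/

section Algorithm

variable {d : ℕ} {A : ℕ → Matrix (Fin d) (Fin d) ℝ} {L : Matrix (Fin d) (Fin d) ℝ} {lam : ℝ}
  {e U₀ : Fin d → ℝ}

theorem orbit_add (n m : ℕ) : orbit A U₀ (n + m) = stepProd A n m *ᵥ orbit A U₀ n := by
  induction m with
  | zero => simp [stepProd]
  | succ m ih => rw [← add_assoc, orbit, ih, stepProd, mulVec_mulVec]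

theorem orbit_eq_stepProd (n : ℕ) : orbit A U₀ n = stepProd A 0 n *ᵥ U₀ := by
  simpa [orbit] using orbit_add (A := A) (U₀ := U₀) 0 n

/-- The `m` initial vectors start an induction with steps of length `m`. -/
theorem Certificate.Valid.mem_coneC {C : Certificate d} (hC : C.Valid A lam e U₀) (k : ℕ) :
    orbit A U₀ (C.N + k) ∈ coneC C.T C.r (tr C.T e) := by
  induction k using Nat.strong_induction_on with
  | _ k ih =>
    rcases lt_or_ge k C.m with hk | hk
    · exact hC.init_cone k hk
    · have h1 := hC.step (C.N + (k - C.m)) (Nat.le_add_right _ _) _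
        (ih (k - C.m) (Nat.sub_lt (lt_of_lt_of_le hC.m_pos hk) hC.m_pos))
      rwa [← orbit_add, add_assoc, Nat.sub_add_cancel hk] at h1

theorem Certificate.Valid.isPositiveSolution {C : Certificate d} (hC : C.Valid A lam e U₀) :
    IsPositiveSolution A U₀ := fun n => by
  rcases le_total n C.N with h | h
  · exact hC.init_nonneg n h
  · obtain ⟨k, rfl⟩ := Nat.exists_eq_add_of_le h
    exact fun i => (hC.cone_pos _ (hC.mem_coneC k) i).le

theorem Choices.Reaches.nonneg {c : Choices d} {i : ℕ} (h : c.Reaches A e U₀ i)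
    (hi : NonnegVec (orbit A U₀ i)) : ∀ j ≤ i, NonnegVec (orbit A U₀ j) := fun j hj => by
  rcases le_or_gt j c.K with h1 | h1
  · exact h.2.1 j h1
  · rcases eq_or_lt_of_le hj with rfl | h2
    · exact hi
    · exact (h.2.2 j h1.le h2).1

theorem FoundK.mono {T : GL (Fin d) ℚ} {m : ℕ} {r : Radius} {K K' : ℕ}
    (h : FoundK A e T m r K) (hK : K ≤ K') : FoundK A e T m r K' :=
  fun n hn => h n (hK.trans hn)

theorem valid_of_found {T : GL (Fin d) ℚ} {m : ℕ} {r : Radius} {N : ℕ} (hlam : 0 < lam)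
    (hm : 0 < m) (hv : PosVec (tr T e)) (hr : FoundR e T r) (hK : FoundK A e T m r N)
    (hnn : ∀ n ≤ N, NonnegVec (orbit A U₀ n))
    (hE : ∀ k < m, tr T (orbit A U₀ (N + k)) ∈ coneB r (tr T e)) :
    (⟨T, r, N, m⟩ : Certificate d).Valid A lam e U₀ where
  one_lt_r := hr.1
  m_pos := hm
  lam_pos := hlam
  v_pos := hv
  cone_pos := fun x hx => by
    have := hr.2 _ (PosProof.mem_coneC.1 hx)
    rwa [tr_inv_tr] at this
  init_nonneg := hnn
  init_cone := fun k hk => PosProof.mem_coneC.2 (hE k hk)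
  step := fun n hn x hx => by
    rw [PosProof.mem_coneC] at hx ⊢
    rw [tr_mulVec]
    exact hK n hn _ hx

/-- For positive `lam` the outcomes are correct without any assumption of genericity. -/
theorem correct_of_returns_of_pos (h : Hypotheses A L lam e) (hlam : 0 < lam) {c : Choices d}
    (hc : c.Legal A L lam e) {o : Outcome d} (ho : Returns A lam e U₀ c o) :
    o.Correct A lam e U₀ := by
  cases ho with
  | negativeEigenvalue h' => exact absurd hlam (not_lt.2 h'.le)
  | initialTerm _ i _ hU => exact fun hp => hU (hp i)
  | laterTerm _ i _ hU => exact fun hp => hU (hp i)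
  | certificate _ i hi hU hE =>
    obtain ⟨h1, h2, h3⟩ := hc hlam
    exact valid_of_found hlam h1.1 (posVec_fixSign h hlam h1) h2 (h3.mono hi.1) (hi.nonneg hU) hE

section Norm

attribute [local instance] Matrix.linftyOpNormedAddCommGroup

/-- The rescaled terms of a generic solution tend to a nonzero multiple of `e`. -/
theorem Generic.exists_tendsto (h : Hypotheses A L lam e) (hg : Generic A L lam U₀) :
    ∃ (κ : ℝ) (s : ℕ → ℝ), κ ≠ 0 ∧ (∀ n, 0 ≤ s n) ∧
      Tendsto (fun n => ((SignType.sign lam : ℝ) ^ n * s n) • orbit A U₀ n) atTop (𝓝 (κ • e)) := by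
  obtain ⟨v, w, ⟨hv, hw, hLv, hlim⟩, hwU⟩ := hg
  obtain ⟨a, rfl⟩ := exists_smul_of_simple (rootMultiplicity_of_dominant h.dominant) h.ne_zero
    h.eigenvector hLv
  have ha : a ≠ 0 := fun h0 => hv (by rw [h0, zero_smul])
  refine ⟨(w ⬝ᵥ U₀) * a, fun n => ‖stepProd A 0 n‖⁻¹, mul_ne_zero hwU ha, fun n => inv_nonneg.2 (norm_nonneg _), ?_⟩
  have hc : Continuous fun M : Matrix (Fin d) (Fin d) ℝ => M *ᵥ U₀ := by fun_prop
  have h1 := (hc.tendsto _).comp hlim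
  have h2 : vecMulVec (a • e) w *ᵥ U₀ = ((w ⬝ᵥ U₀) * a) • e := by
    rw [vecMulVec_mulVec]
    ext i
    simp
    ring
  rw [h2] at h1
  refine h1.congr fun n => ?_
  simp only [Function.comp_apply]
  rw [smul_mulVec, ← orbit_eq_stepProd]

end Norm

/-- For negative `lam` the generic solutions alternate in sign. -/
theorem not_isPositiveSolution_of_neg (h : Hypotheses A L lam e) (hlam : lam < 0)
    (hg : Generic A L lam U₀) : ¬ IsPositiveSolution A U₀ := fun hp => by
  obtain ⟨κ, s, hκ, hs, hlim⟩ := hg.exists_tendsto h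
  obtain ⟨i⟩ := h.nonempty
  have hi := tendsto_pi_nhds.1 hlim i
  rw [sign_neg hlam] at hi
  have h2 : Tendsto (fun n : ℕ => 2 * n) atTop atTop :=
    tendsto_id.const_mul_atTop' two_pos
  have he := ge_of_tendsto' (hi.comp h2) (b := 0) fun n => by
    have : 0 ≤ s (2 * n) * orbit A U₀ (2 * n) i := mul_nonneg (hs _) (hp _ i)
    simpa [pow_mul] using this
  have ho := le_of_tendsto' (hi.comp ((tendsto_add_atTop_nat 1).comp h2)) (b := 0) fun n => by
    have : 0 ≤ s (2 * n + 1) * orbit A U₀ (2 * n + 1) i := mul_nonneg (hs _) (hp _ i)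
    simpa [pow_succ, pow_mul] using this
  have : κ * e i = 0 := le_antisymm ho he
  exact mul_ne_zero hκ (h.pos i).ne' this

/-- A generic positive solution converges in direction to `e`, hence enters the cone. -/
theorem eventually_entered (h : Hypotheses A L lam e) (hlam : 0 < lam) {T : GL (Fin d) ℚ}
    {r : Radius} (hr : r.GtOne) (hv : PosVec (tr T e)) (hg : Generic A L lam U₀)
    (hp : IsPositiveSolution A U₀) : ∀ᶠ n in atTop, tr T (orbit A U₀ n) ∈ coneB r (tr T e) := by
  obtain ⟨κ, s, hκ, hs, hlim⟩ := hg.exists_tendsto h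
  simp only [sign_pos hlam, SignType.coe_one, one_pow, one_mul] at hlim
  have hκpos : 0 < κ := by
    obtain ⟨i⟩ := h.nonempty
    have : 0 ≤ κ * e i := ge_of_tendsto' (tendsto_pi_nhds.1 hlim i) fun n =>
      mul_nonneg (hs n) (hp n i)
    exact lt_of_le_of_ne (nonneg_of_mul_nonneg_left this (h.pos i)) (Ne.symm hκ)
  set v := tr T e
  have hT := ((continuous_tr T).tendsto _).comp hlim
  rw [tr_smul] at hT
  have hcoord : ∀ i, Tendsto (fun n => s n * tr T (orbit A U₀ n) i) atTop (𝓝 (κ * v i)) :=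
    fun i => (tendsto_pi_nhds.1 hT i).congr fun n => by
      simp only [Function.comp_apply]
      rw [tr_smul]; rfl
  have hpos : ∀ᶠ n in atTop, ∀ i, 0 < s n * tr T (orbit A U₀ n) i :=
    eventually_all.2 fun i => (hcoord i).eventually (lt_mem_nhds (mul_pos hκpos (hv i)))
  have hratio : ∀ᶠ n in atTop, ∀ q ∈ r, ∀ i j, s n * tr T (orbit A U₀ n) i * v j <
      (q : ℝ) * (s n * tr T (orbit A U₀ n) j) * v i := by
    cases r with
    | none => simp
    | some q =>
      have hq1 : (1 : ℝ) < q := by exact_mod_cast hr q rfl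
      have : ∀ᶠ n in atTop, ∀ i j, s n * tr T (orbit A U₀ n) i * v j <
          (q : ℝ) * (s n * tr T (orbit A U₀ n) j) * v i := by
        refine eventually_all.2 fun i => eventually_all.2 fun j => ?_
        refine Tendsto.eventually_lt ((hcoord i).mul_const _)
          (((hcoord j).const_mul _).mul_const _) ?_
        have : 0 < κ * v i * v j := mul_pos (mul_pos hκpos (hv i)) (hv j)
        nlinarith
      filter_upwards [this] with n hn q' hq'
      cases hq'
      exact hn
  obtain ⟨i0⟩ := h.nonempty
  filter_upwards [hpos, hratio] with n hn1 hn2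
  have hsn : 0 < s n := lt_of_le_of_ne (hs n) fun h0 => by
    have := hn1 i0
    rw [← h0, zero_mul] at this
    exact lt_irrefl _ this
  refine ⟨fun i => pos_of_mul_pos_right (hn1 i) hsn.le, fun q hq i j => ?_⟩
  refine le_of_mul_le_mul_left ?_ hsn
  have := (hn2 q hq i j).le
  linarith

/-- The last loop stops at a negative term or, for a generic positive solution, inside the cone. -/
theorem exists_returns (h : Hypotheses A L lam e) {c : Choices d} (hc : c.Legal A L lam e)
    (hU : Generic A L lam U₀ ∨ ¬ IsPositiveSolution A U₀) : ∃ o, Returns A lam e U₀ c o := by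
  rcases lt_or_gt_of_ne h.lam_ne_zero with hneg | hlam
  · exact ⟨_, .negativeEigenvalue hneg⟩
  by_cases hinit : ∃ i ≤ c.K, ¬ NonnegVec (orbit A U₀ i)
  · obtain ⟨i, hi, hi'⟩ := hinit
    exact ⟨_, .initialTerm hlam i hi hi'⟩
  push Not at hinit
  obtain ⟨hTm, hR, hK⟩ := hc hlam
  have hex : ∃ i, c.K ≤ i ∧ (NonnegVec (orbit A U₀ i) → c.Entered A e U₀ i) := by
    by_cases hp : IsPositiveSolution A U₀
    · have hg := hU.resolve_right (not_not.2 hp)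
      obtain ⟨N, hN⟩ := eventually_atTop.1
        (eventually_entered h hlam hR.1 (posVec_fixSign h hlam hTm) hg hp)
      exact ⟨max c.K N, le_max_left _ _, fun _ k _ =>
        hN _ ((le_max_right _ _).trans (Nat.le_add_right _ _))⟩
    · obtain ⟨n, hn⟩ := not_forall.1 hp
      refine ⟨n, ?_, fun h' => absurd h' hn⟩
      by_contra hlt
      exact hn (hinit n (not_le.1 hlt).le)
  classical
  obtain ⟨hi1, hi2⟩ := Nat.find_spec hex
  have hreach : c.Reaches A e U₀ (Nat.find hex) := ⟨hi1, hinit, fun j hj hlt => by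
    have := Nat.find_min hex hlt
    push Not at this
    exact this hj⟩
  by_cases hnn : NonnegVec (orbit A U₀ (Nat.find hex))
  · exact ⟨_, .certificate hlam _ hreach hnn (hi2 hnn)⟩
  · exact ⟨_, .laterTerm hlam _ hreach hnn⟩

end Algorithm

/-! ### Primitive recursive functions, in a form suited to `fun_prop` -/

attribute [fun_prop] Primrec

namespace Prim

variable {α β γ σ : Type*} [Primcodable α] [Primcodable β] [Primcodable γ] [Primcodable σ]

@[fun_prop] theorem id : Primrec (fun a : α => a) := Primrec.id

@[fun_prop] theorem const (x : σ) : Primrec (fun _ : α => x) := Primrec.const x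

@[fun_prop] theorem comp {f : β → σ} {g : α → β} (hf : Primrec f) (hg : Primrec g) :
    Primrec fun a => f (g a) := hf.comp hg

@[fun_prop] theorem fst {f : α → β × γ} (hf : Primrec f) : Primrec fun a => (f a).1 :=
  Primrec.fst.comp hf

@[fun_prop] theorem snd {f : α → β × γ} (hf : Primrec f) : Primrec fun a => (f a).2 :=
  Primrec.snd.comp hf

@[fun_prop] theorem pair {f : α → β} {g : α → γ} (hf : Primrec f) (hg : Primrec g) :
    Primrec fun a => (f a, g a) := hf.pair hg

@[fun_prop] theorem nat_add {f g : α → ℕ} (hf : Primrec f) (hg : Primrec g) :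
    Primrec fun a => f a + g a := Primrec.nat_add.comp hf hg

@[fun_prop] theorem nat_sub {f g : α → ℕ} (hf : Primrec f) (hg : Primrec g) :
    Primrec fun a => f a - g a := Primrec.nat_sub.comp hf hg

@[fun_prop] theorem nat_mul {f g : α → ℕ} (hf : Primrec f) (hg : Primrec g) :
    Primrec fun a => f a * g a := Primrec.nat_mul.comp hf hg

@[fun_prop] theorem nat_mod {f g : α → ℕ} (hf : Primrec f) (hg : Primrec g) :
    Primrec fun a => f a % g a := Primrec.nat_mod.comp hf hg

@[fun_prop] theorem nat_max {f g : α → ℕ} (hf : Primrec f) (hg : Primrec g) :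
    Primrec fun a => max (f a) (g a) := Primrec.nat_max.comp hf hg

@[fun_prop] theorem unpair {f : α → ℕ} (hf : Primrec f) : Primrec fun a => (f a).unpair :=
  Primrec.unpair.comp hf

@[fun_prop] theorem cons {f : α → β} {g : α → List β} (hf : Primrec f) (hg : Primrec g) :
    Primrec fun a => f a :: g a := Primrec.list_cons.comp hf hg

@[fun_prop] theorem getD {f : α → ℕ} {g : α → List β} (hg : Primrec g) (hf : Primrec f) (d : β) :
    Primrec fun a => (g a).getD (f a) d := (Primrec.list_getD d).comp hg hf

@[fun_prop] theorem drop {f : α → ℕ} {g : α → List β} (hf : Primrec f) (hg : Primrec g) :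
    Primrec fun a => (g a).drop (f a) := Primrec.list_drop.comp hf hg

@[fun_prop] theorem length {f : α → List β} (hf : Primrec f) : Primrec fun a => (f a).length :=
  Primrec.list_length.comp hf

@[fun_prop] theorem range {f : α → ℕ} (hf : Primrec f) : Primrec fun a => List.range (f a) :=
  Primrec.list_range.comp hf

@[fun_prop] theorem map {f : α → List β} {g : α → β → σ} (hf : Primrec f)
    (hg : Primrec fun p : α × β => g p.1 p.2) : Primrec fun a => (f a).map (g a) :=
  Primrec.list_map hf hg

@[fun_prop] theorem foldr {f : α → List β} {g : α → σ} {h : α → β → σ → σ} (hf : Primrec f)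
    (hg : Primrec g) (hh : Primrec fun p : α × β × σ => h p.1 p.2.1 p.2.2) :
    Primrec fun a => (f a).foldr (h a) (g a) :=
  Primrec.list_foldr (h := fun a p => h a p.1 p.2) hf hg hh

@[fun_prop] theorem iterate {f : α → ℕ} {g : α → σ} {h : α → σ → σ} (hf : Primrec f)
    (hg : Primrec g) (hh : Primrec fun p : α × σ => h p.1 p.2) :
    Primrec fun a => (h a)^[f a] (g a) :=
  Primrec.nat_iterate hf hg hh

end Prim

/-! ### Semidecidable predicates -/

/-- A predicate is semidecidable if it can be verified by a primitive recursive test with the help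
of a natural number, the witness. -/
def SemiDec {α : Type} [Primcodable α] (p : α → Prop) : Prop :=
  ∃ f : α × ℕ → Bool, Primrec f ∧ ∀ a, p a ↔ ∃ k, f (a, k) = true

namespace SemiDec

variable {α β : Type} [Primcodable α] [Primcodable β]

theorem of_primrecPred {p : α → Prop} (hp : PrimrecPred p) : SemiDec p := by
  obtain ⟨_, hp⟩ := hp
  exact ⟨fun x => decide (p x.1), hp.comp Primrec.fst, fun a => by simp⟩

theorem of_eq {p q : α → Prop} (hq : SemiDec q) (h : ∀ a, p a ↔ q a) : SemiDec p := by
  rwa [show p = q from funext fun a => propext (h a)]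

theorem nat_lt {f g : α → ℕ} (hf : Primrec f) (hg : Primrec g) : SemiDec fun a => f a < g a :=
  of_primrecPred (Primrec.nat_lt.comp hf hg)

theorem nat_le {f g : α → ℕ} (hf : Primrec f) (hg : Primrec g) : SemiDec fun a => f a ≤ g a :=
  of_primrecPred (Primrec.nat_le.comp hf hg)

theorem eq {f g : α → β} (hf : Primrec f) (hg : Primrec g) : SemiDec fun a => f a = g a :=
  of_primrecPred (Primrec.eq.comp hf hg)

theorem and {p q : α → Prop} (hp : SemiDec p) (hq : SemiDec q) : SemiDec fun a => p a ∧ q a := by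
  obtain ⟨f, hf, h⟩ := hp
  obtain ⟨g, hg, h'⟩ := hq
  refine ⟨fun x => f (x.1, x.2.unpair.1) && g (x.1, x.2.unpair.2),
    Primrec.and.comp (by fun_prop) (by fun_prop), fun a => ?_⟩
  simp only [h, h', Bool.and_eq_true]
  constructor
  · rintro ⟨⟨k, hk⟩, l, hl⟩
    exact ⟨Nat.pair k l, by simp [hk, hl]⟩
  · rintro ⟨k, h1, h2⟩
    exact ⟨⟨_, h1⟩, _, h2⟩

theorem or {p q : α → Prop} (hp : SemiDec p) (hq : SemiDec q) : SemiDec fun a => p a ∨ q a := by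
  obtain ⟨f, hf, h⟩ := hp
  obtain ⟨g, hg, h'⟩ := hq
  refine ⟨fun x => f x || g x, Primrec.or.comp hf hg, fun a => ?_⟩
  simp only [h, h', Bool.or_eq_true, exists_or]

theorem exists_right {p : α → β → Prop} (hp : SemiDec fun x : α × β => p x.1 x.2) :
    SemiDec fun a => ∃ b, p a b := by
  obtain ⟨f, hf, h⟩ := hp
  refine ⟨fun x => ((Encodable.decode (α := β) x.2.unpair.1).map
    fun b => f ((x.1, b), x.2.unpair.2)).getD false, ?_, fun a => ?_⟩
  · refine Primrec.option_getD.comp (Primrec.option_map (g := fun (x : α × ℕ) (b : β) =>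
      f ((x.1, b), x.2.unpair.2)) (Primrec.decode.comp (by fun_prop)) ?_) (Primrec.const false)
    show Primrec fun y : (α × ℕ) × β => f ((y.1.1, y.2), y.1.2.unpair.2)
    fun_prop
  · constructor
    · rintro ⟨b, hb⟩
      obtain ⟨k, hk⟩ := (h (a, b)).1 hb
      exact ⟨Nat.pair (Encodable.encode b) k, by simp [hk]⟩
    · rintro ⟨k, hk⟩
      cases hd : Encodable.decode (α := β) k.unpair.1 with
      | none => simp [hd] at hk
      | some b => exact ⟨b, (h (a, b)).2 ⟨_, by simpa [hd] using hk⟩⟩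

theorem forall_lt {n : α → ℕ} (hn : Primrec n) {p : α → ℕ → Prop}
    (hp : SemiDec fun x : α × ℕ => p x.1 x.2) : SemiDec fun a => ∀ i < n a, p a i := by
  obtain ⟨f, hf, h⟩ := hp
  -- the witness is a list of witnesses, one for each `i`
  have hR : PrimrecRel fun (i : ℕ) (y : α × List ℕ) => f ((y.1, i), y.2.getD i 0) = true := by
    refine Primrec.eq.comp (g := fun _ => true) ?_ (Primrec.const true)
    show Primrec fun z : ℕ × α × List ℕ => f ((z.2.1, z.1), z.2.2.getD z.1 0)
    fun_prop
  have h1 : PrimrecPred fun x : α × List ℕ =>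
      ∀ i < n x.1, f ((x.1, i), x.2.getD i 0) = true := by
    have h2 : PrimrecPred fun x : α × List ℕ =>
        ∀ i ∈ List.range (n x.1), f ((x.1, i), x.2.getD i 0) = true :=
      (PrimrecRel.forall_mem_list hR).comp (f := fun x : α × List ℕ => List.range (n x.1))
        (g := fun x => x) (by fun_prop) (by fun_prop)
    exact h2.of_eq fun x => by simp
  refine (exists_right (p := fun a (l : List ℕ) =>
    ∀ i < n a, f ((a, i), l.getD i 0) = true) (of_primrecPred h1)).of_eq fun a => ?_
  constructor
  · intro H
    choose! k hk using fun i (hi : i < n a) => (h (a, i)).1 (H i hi)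
    refine ⟨(List.range (n a)).map k, fun i hi => ?_⟩
    rw [List.getD_eq_getElem _ _ (by simpa using hi)]
    simpa using hk i hi
  · rintro ⟨l, hl⟩ i hi
    exact (h (a, i)).2 ⟨_, hl i hi⟩

/-- A semidecidable relation contains a partial recursive function with the same domain: search
for a pair of a value and a witness. -/
theorem exists_partrec {R : α → β → Prop} (hR : SemiDec fun x : α × β => R x.1 x.2) :
    ∃ P : α →. β, Partrec P ∧ (∀ a, (P a).Dom ↔ ∃ b, R a b) ∧ ∀ a, ∀ b ∈ P a, R a b := by
  obtain ⟨f, hf, h⟩ := hR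
  let g : α → ℕ → Option β := fun a k =>
    (Encodable.decode (α := β) k.unpair.1).bind fun b =>
      bif f ((a, b), k.unpair.2) then some b else none
  have hg : Primrec₂ g := by
    refine Primrec.option_bind (f := fun x : α × ℕ => Encodable.decode (α := β) x.2.unpair.1)
      (g := fun (x : α × ℕ) (b : β) => bif f ((x.1, b), x.2.unpair.2) then some b else none)
      (Primrec.decode.comp (by fun_prop)) ?_
    show Primrec fun y : (α × ℕ) × β =>
      bif f ((y.1.1, y.2), y.1.2.unpair.2) then some y.2 else none
    exact Primrec.cond (by fun_prop) (Primrec.option_some.comp (by fun_prop)) (Primrec.const none)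
  have hgs : ∀ a k b, g a k = some b → R a b := by
    intro a k b hk
    simp only [g, Option.bind_eq_some_iff] at hk
    obtain ⟨b', -, hb'⟩ := hk
    cases hfb : f ((a, b'), k.unpair.2) with
    | false => simp [hfb] at hb'
    | true =>
      simp only [hfb, cond_true, Option.some.injEq] at hb'
      subst hb'
      exact (h (a, b')).2 ⟨_, hfb⟩
  refine ⟨fun a => Nat.rfindOpt (g a), Partrec.rfindOpt hg.to_comp, fun a => ?_, fun a b hb => ?_⟩
  · rw [Nat.rfindOpt_dom]
    constructor
    · rintro ⟨k, b, hk⟩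
      exact ⟨b, hgs a k b hk⟩
    · rintro ⟨b, hb⟩
      obtain ⟨k, hk⟩ := (h (a, b)).1 hb
      refine ⟨Nat.pair (Encodable.encode b) k, b, ?_⟩
      simp [g, hk]
  · obtain ⟨k, hk⟩ := Nat.rfindOpt_spec hb
    exact hgs a k b hk

end SemiDec

/-! ### Arithmetic of codes -/

section RatCodes

/-- The code of a natural number. -/
def ratNat (n : ℕ) : RatCode := (n, 0, 0)

/-- Addition of codes of rational numbers. -/
def ratAdd (x y : RatCode) : RatCode :=
  (x.1 * (y.2.2 + 1) + y.1 * (x.2.2 + 1), x.2.1 * (y.2.2 + 1) + y.2.1 * (x.2.2 + 1),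
    x.2.2 * y.2.2 + x.2.2 + y.2.2)

/-- Multiplication of codes of rational numbers. -/
def ratMul (x y : RatCode) : RatCode :=
  (x.1 * y.1 + x.2.1 * y.2.1, x.1 * y.2.1 + x.2.1 * y.1, x.2.2 * y.2.2 + x.2.2 + y.2.2)

/-- Negation of codes of rational numbers. -/
def ratNeg (x : RatCode) : RatCode := (x.2.1, x.1, x.2.2)

/-- The absolute value on codes of rational numbers. -/
def ratAbs (x : RatCode) : RatCode := ((x.1 - x.2.1) + (x.2.1 - x.1), 0, x.2.2)

variable {α : Type*} [Primcodable α]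

@[fun_prop] theorem primrec_ratNat {f : α → ℕ} (hf : Primrec f) :
    Primrec fun a => ratNat (f a) := by unfold ratNat; fun_prop

@[fun_prop] theorem primrec_ratAdd {f g : α → RatCode} (hf : Primrec f) (hg : Primrec g) :
    Primrec fun a => ratAdd (f a) (g a) := by unfold ratAdd; fun_prop

@[fun_prop] theorem primrec_ratMul {f g : α → RatCode} (hf : Primrec f) (hg : Primrec g) :
    Primrec fun a => ratMul (f a) (g a) := by unfold ratMul; fun_prop

@[fun_prop] theorem primrec_ratNeg {f : α → RatCode} (hf : Primrec f) :
    Primrec fun a => ratNeg (f a) := by unfold ratNeg; fun_prop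

@[fun_prop] theorem primrec_ratAbs {f : α → RatCode} (hf : Primrec f) :
    Primrec fun a => ratAbs (f a) := by unfold ratAbs; fun_prop

theorem ratVal_ratNat (n : ℕ) : ratVal (ratNat n) = n := by simp [ratVal, ratNat]

theorem ratVal_zero : ratVal (0, 0, 0) = 0 := by simp [ratVal]

theorem ratVal_ratAdd (x y : RatCode) : ratVal (ratAdd x y) = ratVal x + ratVal y := by
  have h1 : (x.2.2 : ℚ) + 1 ≠ 0 := by positivity
  have h2 : (y.2.2 : ℚ) + 1 ≠ 0 := by positivity
  have h3 : (x.2.2 : ℚ) * y.2.2 + x.2.2 + y.2.2 + 1 ≠ 0 := by positivity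
  simp only [ratVal, ratAdd]
  push_cast
  field_simp
  ring

theorem ratVal_ratMul (x y : RatCode) : ratVal (ratMul x y) = ratVal x * ratVal y := by
  have h1 : (x.2.2 : ℚ) + 1 ≠ 0 := by positivity
  have h2 : (y.2.2 : ℚ) + 1 ≠ 0 := by positivity
  have h3 : (x.2.2 : ℚ) * y.2.2 + x.2.2 + y.2.2 + 1 ≠ 0 := by positivity
  simp only [ratVal, ratMul]
  push_cast
  field_simp
  ring

theorem ratVal_ratNeg (x : RatCode) : ratVal (ratNeg x) = -ratVal x := by
  simp only [ratVal, ratNeg, ← neg_div, neg_sub]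

theorem ratVal_pos_iff (x : RatCode) : 0 < ratVal x ↔ x.2.1 < x.1 := by
  rw [ratVal, div_pos_iff_of_pos_right (by positivity), sub_pos, Nat.cast_lt]

theorem ratVal_nonneg_iff (x : RatCode) : 0 ≤ ratVal x ↔ x.2.1 ≤ x.1 := by
  rw [ratVal, le_div_iff₀ (by positivity), zero_mul, sub_nonneg, Nat.cast_le]

theorem ratVal_ratAbs (x : RatCode) : ratVal (ratAbs x) = |ratVal x| := by
  rcases le_total x.2.1 x.1 with h | h
  · rw [abs_of_nonneg ((ratVal_nonneg_iff x).2 h)]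
    simp only [ratVal, ratAbs, Nat.sub_eq_zero_of_le h]
    push_cast [h]
    ring
  · have h0 : ratVal x ≤ 0 := by
      rw [← neg_nonneg, ← ratVal_ratNeg, ratVal_nonneg_iff]
      exact h
    rw [abs_of_nonpos h0]
    simp only [ratVal, ratAbs, Nat.sub_eq_zero_of_le h]
    push_cast [h]
    ring

theorem exists_ratVal (q : ℚ) : ∃ x, ratVal x = q := by
  refine ⟨(q.num.toNat, (-q.num).toNat, q.den - 1), ?_⟩
  have h1 : ((q.num.toNat : ℤ) : ℚ) - (((-q.num).toNat : ℤ) : ℚ) = q.num := by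
    rw [← Int.cast_sub]
    congr 1
    omega
  have h2 : ((q.den - 1 : ℕ) : ℚ) + 1 = q.den := by
    rw [← Nat.cast_add_one, Nat.sub_add_cancel q.den_pos]
  simp only [ratVal]
  rw [h2, ← Int.cast_natCast, ← Int.cast_natCast (R := ℚ) (-q.num).toNat, h1, Rat.num_div_den]

theorem semiDec_ratVal_pos {α : Type} [Primcodable α] {f : α → RatCode} (hf : Primrec f) :
    SemiDec fun a => 0 < ratVal (f a) := by
  simp only [ratVal_pos_iff]
  exact SemiDec.nat_lt (by fun_prop) (by fun_prop)

theorem semiDec_ratVal_nonneg {α : Type} [Primcodable α] {f : α → RatCode} (hf : Primrec f) :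
    SemiDec fun a => 0 ≤ ratVal (f a) := by
  simp only [ratVal_nonneg_iff]
  exact SemiDec.nat_le (by fun_prop) (by fun_prop)

theorem semiDec_ratVal_lt {α : Type} [Primcodable α] {f g : α → RatCode} (hf : Primrec f)
    (hg : Primrec g) : SemiDec fun a => ratVal (f a) < ratVal (g a) :=
  (semiDec_ratVal_pos (f := fun a => ratAdd (g a) (ratNeg (f a))) (by fun_prop)).of_eq fun a => by
    rw [ratVal_ratAdd, ratVal_ratNeg, ← sub_eq_add_neg, sub_pos]

theorem semiDec_ratVal_le {α : Type} [Primcodable α] {f g : α → RatCode} (hf : Primrec f)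
    (hg : Primrec g) : SemiDec fun a => ratVal (f a) ≤ ratVal (g a) :=
  (semiDec_ratVal_nonneg (f := fun a => ratAdd (g a) (ratNeg (f a))) (by fun_prop)).of_eq
    fun a => by rw [ratVal_ratAdd, ratVal_ratNeg, ← sub_eq_add_neg, sub_nonneg]

theorem semiDec_ratVal_eq {α : Type} [Primcodable α] {f g : α → RatCode} (hf : Primrec f)
    (hg : Primrec g) : SemiDec fun a => ratVal (f a) = ratVal (g a) :=
  ((semiDec_ratVal_le hf hg).and (semiDec_ratVal_le hg hf)).of_eq fun _ => le_antisymm_iff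

theorem semiDec_ratVal_ne {α : Type} [Primcodable α] {f g : α → RatCode} (hf : Primrec f)
    (hg : Primrec g) : SemiDec fun a => ratVal (f a) ≠ ratVal (g a) :=
  ((semiDec_ratVal_lt hf hg).or (semiDec_ratVal_lt hg hf)).of_eq fun _ => ne_iff_lt_or_gt

end RatCodes

section PolynomialCodes

/-- Addition of coefficient lists. -/
def polyAdd (p q : EltCode) : EltCode :=
  (List.range (max p.length q.length)).map fun i =>
    ratAdd (p.getD i (0, 0, 0)) (q.getD i (0, 0, 0))

/-- Negation of coefficient lists. -/
def polyNeg (p : EltCode) : EltCode := p.map ratNeg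

/-- Multiplication of coefficient lists. -/
def polyMul (p q : EltCode) : EltCode :=
  p.foldr (fun c acc => polyAdd (q.map (ratMul c)) ((0, 0, 0) :: acc)) []

/-- The value of a polynomial at a rational number. -/
def polyEval (x : RatCode) (p : EltCode) : RatCode :=
  p.foldr (fun c acc => ratAdd c (ratMul x acc)) (0, 0, 0)

variable {α : Type*} [Primcodable α]

@[fun_prop] theorem primrec_polyAdd {f g : α → EltCode} (hf : Primrec f) (hg : Primrec g) :
    Primrec fun a => polyAdd (f a) (g a) := by unfold polyAdd; fun_prop

@[fun_prop] theorem primrec_polyNeg {f : α → EltCode} (hf : Primrec f) :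
    Primrec fun a => polyNeg (f a) := by unfold polyNeg; fun_prop

@[fun_prop] theorem primrec_polyMul {f g : α → EltCode} (hf : Primrec f) (hg : Primrec g) :
    Primrec fun a => polyMul (f a) (g a) := by unfold polyMul; fun_prop

@[fun_prop] theorem primrec_polyEval {f : α → RatCode} {g : α → EltCode} (hf : Primrec f)
    (hg : Primrec g) : Primrec fun a => polyEval (f a) (g a) := by unfold polyEval; fun_prop

/-- Coefficients beyond the end of the list are zero, which is also the default of `getD`. -/
theorem coeff_ratPoly (p : EltCode) (i : ℕ) :
    (ratPoly p).coeff i = ratVal (p.getD i (0, 0, 0)) := by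
  induction p generalizing i with
  | nil => simp [ratPoly, ratVal]
  | cons c l ih =>
    cases i with
    | zero => simp [ratPoly]
    | succ i => simp [ratPoly, coeff_C_succ, ih]

theorem ratPoly_polyAdd (p q : EltCode) : ratPoly (polyAdd p q) = ratPoly p + ratPoly q := by
  ext i
  rw [coeff_add, coeff_ratPoly, coeff_ratPoly, coeff_ratPoly, ← ratVal_ratAdd, polyAdd]
  rcases lt_or_ge i (max p.length q.length) with h | h
  · rw [List.getD_eq_getElem _ _ (by simpa using h)]
    simp
  · rw [List.getD_eq_default _ _ (by simpa using h),
      List.getD_eq_default _ _ ((le_max_left _ _).trans h),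
      List.getD_eq_default _ _ ((le_max_right _ _).trans h)]
    simp [ratVal_ratAdd, ratVal_zero]

theorem ratPoly_polyNeg (p : EltCode) : ratPoly (polyNeg p) = -ratPoly p := by
  induction p with
  | nil => simp [polyNeg, ratPoly]
  | cons c l ih =>
    rw [polyNeg, List.map_cons, ratPoly, ← polyNeg, ih, ratPoly, ratVal_ratNeg, C_neg]
    ring

theorem ratPoly_map_ratMul (c : RatCode) (q : EltCode) :
    ratPoly (q.map (ratMul c)) = C (ratVal c) * ratPoly q := by
  induction q with
  | nil => simp [ratPoly]
  | cons b l ih =>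
    rw [List.map_cons, ratPoly, ih, ratPoly, ratVal_ratMul, C_mul]
    ring

theorem ratPoly_polyMul (p q : EltCode) : ratPoly (polyMul p q) = ratPoly p * ratPoly q := by
  induction p with
  | nil => simp [polyMul, ratPoly]
  | cons c l ih =>
    rw [polyMul, List.foldr_cons, ratPoly_polyAdd, ratPoly_map_ratMul, ratPoly, ← polyMul, ih,
      ratPoly, ratVal_zero, C_0]
    ring

theorem ratVal_polyEval (x : RatCode) (p : EltCode) :
    ratVal (polyEval x p) = (ratPoly p).eval (ratVal x) := by
  induction p with
  | nil => simp [polyEval, ratPoly, ratVal_zero]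
  | cons c l ih =>
    rw [polyEval, List.foldr_cons, ← polyEval, ratVal_ratAdd, ratVal_ratMul, ih, ratPoly]
    simp

theorem exists_ratPoly (p : ℚ[X]) : ∃ l, ratPoly l = p := by
  choose c hc using exists_ratVal
  refine ⟨(List.range (p.natDegree + 1)).map fun i => c (p.coeff i), ?_⟩
  ext i
  rw [coeff_ratPoly]
  rcases lt_or_ge i (p.natDegree + 1) with h | h
  · rw [List.getD_eq_getElem _ _ (by simpa using h)]
    simp [hc]
  · rw [List.getD_eq_default _ _ (by simpa using h), coeff_eq_zero_of_natDegree_lt (by omega),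
      ratVal_zero]

theorem ratPoly_eq_zero_iff (p : EltCode) :
    ratPoly p = 0 ↔ ∀ i < p.length, ratVal (p.getD i (0, 0, 0)) = ratVal (0, 0, 0) := by
  simp only [ratVal_zero, Polynomial.ext_iff, coeff_ratPoly, coeff_zero]
  refine ⟨fun h i _ => h i, fun h i => ?_⟩
  rcases lt_or_ge i p.length with hi | hi
  · exact h i hi
  · rw [List.getD_eq_default _ _ hi, ratVal_zero]

theorem semiDec_ratPoly_eq {α : Type} [Primcodable α] {f g : α → EltCode} (hf : Primrec f)
    (hg : Primrec g) : SemiDec fun a => ratPoly (f a) = ratPoly (g a) := by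
  have h1 : SemiDec fun a => ∀ i < (polyAdd (f a) (polyNeg (g a))).length,
      ratVal ((polyAdd (f a) (polyNeg (g a))).getD i (0, 0, 0)) = ratVal (0, 0, 0) :=
    SemiDec.forall_lt (by fun_prop) (semiDec_ratVal_eq (by fun_prop) (by fun_prop))
  exact h1.of_eq fun a => by
    rw [← ratPoly_eq_zero_iff, ratPoly_polyAdd, ratPoly_polyNeg, ← sub_eq_add_neg, sub_eq_zero]

theorem eltVal_polyAdd (x : ℝ) (p q : EltCode) :
    eltVal x (polyAdd p q) = eltVal x p + eltVal x q := by simp [eltVal, ratPoly_polyAdd]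

theorem eltVal_polyNeg (x : ℝ) (p : EltCode) : eltVal x (polyNeg p) = -eltVal x p := by
  simp [eltVal, ratPoly_polyNeg]

theorem eltVal_polyMul (x : ℝ) (p q : EltCode) :
    eltVal x (polyMul p q) = eltVal x p * eltVal x q := by simp [eltVal, ratPoly_polyMul]

theorem eltVal_singleton (x : ℝ) (c : RatCode) : eltVal x [c] = (ratVal c : ℝ) := by
  simp [eltVal, ratPoly]

theorem eltVal_nil (x : ℝ) : eltVal x [] = 0 := by
  simp [eltVal, ratPoly]

theorem eltVal_cons (x : ℝ) (c : RatCode) (l : EltCode) :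
    eltVal x (c :: l) = (ratVal c : ℝ) + x * eltVal x l := by
  simp [eltVal, ratPoly]

theorem eltVal_ratVal (x : RatCode) (p : EltCode) :
    eltVal (ratVal x : ℝ) p = (ratVal (polyEval x p) : ℝ) := by
  rw [ratVal_polyEval, eltVal, ← eq_ratCast (algebraMap ℚ ℝ), aeval_algebraMap_apply,
    eq_ratCast, coe_aeval_eq_eval]

end PolynomialCodes

/-! ### Signs of elements of the number field -/

section Signs

/-- The value of a polynomial at `a`, together with a bound for its variation on the points
`x` with `|x| ≤ M` and `|x - a| ≤ s`. -/
def polyEvalErr (M s a : RatCode) (p : EltCode) : RatCode × RatCode :=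
  p.foldr (fun c acc => (ratAdd c (ratMul a acc.1),
    ratAdd (ratMul M acc.2) (ratMul s (ratAbs acc.1)))) ((0, 0, 0), (0, 0, 0))

@[fun_prop] theorem primrec_polyEvalErr {β : Type*} [Primcodable β] {f g h : β → RatCode}
    {p : β → EltCode} (hf : Primrec f) (hg : Primrec g) (hh : Primrec h) (hp : Primrec p) :
    Primrec fun x => polyEvalErr (f x) (g x) (h x) (p x) := by unfold polyEvalErr; fun_prop

theorem polyEvalErr_cons (M s a c : RatCode) (p : EltCode) :
    polyEvalErr M s a (c :: p) = (ratAdd c (ratMul a (polyEvalErr M s a p).1),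
      ratAdd (ratMul M (polyEvalErr M s a p).2) (ratMul s (ratAbs (polyEvalErr M s a p).1))) := rfl

theorem polyEvalErr_fst (M s a : RatCode) (p : EltCode) :
    (polyEvalErr M s a p).1 = polyEval a p := by
  induction p with
  | nil => rfl
  | cons c l ih => rw [polyEvalErr_cons, ih]; rfl

/-- The second component of `polyEvalErr` does bound the variation. -/
theorem abs_eltVal_sub_le {M s a : RatCode} {x : ℝ} (hM : |x| ≤ (ratVal M : ℝ))
    (hs : |x - (ratVal a : ℝ)| ≤ (ratVal s : ℝ)) (p : EltCode) :
    |eltVal x p - eltVal (ratVal a : ℝ) p| ≤ (ratVal (polyEvalErr M s a p).2 : ℝ) := by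
  induction p with
  | nil => simp [polyEvalErr, ratVal_zero, eltVal_nil]
  | cons c l ih =>
    rw [polyEvalErr_cons, eltVal_cons, eltVal_cons]
    simp only [ratVal_ratAdd, ratVal_ratMul, ratVal_ratAbs, polyEvalErr_fst]
    push_cast
    rw [← eltVal_ratVal]
    have h1 : (ratVal c : ℝ) + x * eltVal x l - (ratVal c + ratVal a * eltVal (ratVal a : ℝ) l) =
        x * (eltVal x l - eltVal (ratVal a : ℝ) l) + (x - ratVal a) * eltVal (ratVal a : ℝ) l := by
      ring
    rw [h1]
    refine (abs_add_le _ _).trans (add_le_add ?_ ?_)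
    · rw [abs_mul]
      exact mul_le_mul hM ih (abs_nonneg _) ((abs_nonneg _).trans hM)
    · rw [abs_mul]
      exact mul_le_mul_of_nonneg_right hs (abs_nonneg _)

/-- On bounded sets the variation bound is at most linear in the distance. -/
theorem exists_polyEvalErr_le (M : RatCode) (hM : 0 ≤ ratVal M) (p : EltCode) :
    ∃ E B : ℚ, 0 ≤ E ∧ ∀ a s : RatCode, |ratVal a| ≤ ratVal M → 0 ≤ ratVal s →
      ratVal (polyEvalErr M s a p).2 ≤ ratVal s * E ∧ |ratVal (polyEval a p)| ≤ B := by
  induction p with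
  | nil => exact ⟨0, 0, le_rfl, fun a s _ _ => by simp [polyEvalErr, polyEval, ratVal_zero]⟩
  | cons c l ih =>
    obtain ⟨E, B, hE, h⟩ := ih
    refine ⟨ratVal M * E + |B|, |ratVal c| + ratVal M * B, by positivity, fun a s ha hs => ?_⟩
    obtain ⟨h1, h2⟩ := h a s ha hs
    rw [polyEvalErr_cons]
    have h3 : polyEval a (c :: l) = ratAdd c (ratMul a (polyEval a l)) := rfl
    rw [h3]
    simp only [ratVal_ratAdd, ratVal_ratMul, ratVal_ratAbs, polyEvalErr_fst]
    constructor
    · have h4 := mul_le_mul_of_nonneg_left h1 hM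
      have h5 := mul_le_mul_of_nonneg_left (h2.trans (le_abs_self B)) hs
      linarith
    · refine (abs_add_le _ _).trans (add_le_add le_rfl ?_)
      rw [abs_mul]
      exact mul_le_mul ha h2 (abs_nonneg _) hM

/-- A certificate for the positivity of `p` at the number coded by `F`: an interval `(a, b)` where
the defining polynomial changes its sign and `p` is positive. -/
def PosTest (F : FieldCode) (p : EltCode) : Prop :=
  ∃ w : RatCode × RatCode × RatCode,
    ratVal F.2.1 ≤ ratVal w.1 ∧ ratVal w.2.1 ≤ ratVal F.2.2 ∧ ratVal w.1 < ratVal w.2.1 ∧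
    ratVal (ratMul (polyEval w.1 F.1) (polyEval w.2.1 F.1)) < ratVal (0, 0, 0) ∧
    ratVal (ratAbs w.1) ≤ ratVal w.2.2 ∧ ratVal (ratAbs w.2.1) ≤ ratVal w.2.2 ∧
    ratVal (polyEvalErr w.2.2 (ratAdd w.2.1 (ratNeg w.1)) w.1 p).2 < ratVal (polyEval w.1 p)

theorem semiDec_posTest {β : Type} [Primcodable β] {F : β → FieldCode} {p : β → EltCode}
    (hF : Primrec F) (hp : Primrec p) : SemiDec fun x => PosTest (F x) (p x) := by
  unfold PosTest
  refine SemiDec.exists_right ?_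
  refine SemiDec.and (semiDec_ratVal_le (by fun_prop) (by fun_prop)) ?_
  refine SemiDec.and (semiDec_ratVal_le (by fun_prop) (by fun_prop)) ?_
  refine SemiDec.and (semiDec_ratVal_lt (by fun_prop) (by fun_prop)) ?_
  refine SemiDec.and (semiDec_ratVal_lt (by fun_prop) (by fun_prop)) ?_
  refine SemiDec.and (semiDec_ratVal_le (by fun_prop) (by fun_prop)) ?_
  refine SemiDec.and (semiDec_ratVal_le (by fun_prop) (by fun_prop)) ?_
  exact semiDec_ratVal_lt (by fun_prop) (by fun_prop)

variable {F : FieldCode} {α : ℝ}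

theorem Isolates.root (h : Isolates F α) :
    aeval α (ratPoly F.1) = 0 ∧ (ratVal F.2.1 : ℝ) < α ∧ α < (ratVal F.2.2 : ℝ) :=
  (h.2 α).2 rfl

/-- The sign change forces a root into the interval, and `α` is the only candidate. -/
theorem eltVal_pos_of_posTest (h : Isolates F α) {p : EltCode} (hp : PosTest F p) :
    0 < eltVal α p := by
  obtain ⟨⟨a, b, M⟩, hlo, hhi, hab, hsign, haM, hbM, herr⟩ := hp
  simp only at *
  rw [ratVal_ratMul, ratVal_zero] at hsign
  rw [ratVal_ratAbs] at haM hbM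
  have hab' : (ratVal a : ℝ) < ratVal b := by exact_mod_cast hab
  have hcont : ContinuousOn (fun x : ℝ => eltVal x F.1) (Set.Icc (ratVal a : ℝ) (ratVal b)) := by
    unfold eltVal
    exact (Polynomial.continuous_aeval _).continuousOn
  have hsign' : eltVal (ratVal a : ℝ) F.1 * eltVal (ratVal b : ℝ) F.1 < 0 := by
    rw [eltVal_ratVal, eltVal_ratVal]
    exact_mod_cast hsign
  -- the sign change locates a root, which the isolating interval identifies
  have hroot : ∃ x ∈ Set.Ioo (ratVal a : ℝ) (ratVal b), eltVal x F.1 = 0 := by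
    rcases mul_neg_iff.1 hsign' with ⟨h1, h2⟩ | ⟨h1, h2⟩
    · exact intermediate_value_Ioo' hab'.le hcont ⟨h2, h1⟩
    · exact intermediate_value_Ioo hab'.le hcont ⟨h1, h2⟩
  obtain ⟨x, ⟨hax, hxb⟩, hx⟩ := hroot
  have hlo' : (ratVal F.2.1 : ℝ) ≤ ratVal a := by exact_mod_cast hlo
  have hhi' : (ratVal b : ℝ) ≤ ratVal F.2.2 := by exact_mod_cast hhi
  obtain rfl : x = α := (h.2 x).1 ⟨hx, by linarith, by linarith⟩
  have haM' : |(ratVal a : ℝ)| ≤ ratVal M := by exact_mod_cast haM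
  have hbM' : |(ratVal b : ℝ)| ≤ ratVal M := by exact_mod_cast hbM
  have hxM : |x| ≤ (ratVal M : ℝ) := by
    rw [abs_le] at haM' hbM' ⊢
    constructor <;> linarith
  have hxs : |x - (ratVal a : ℝ)| ≤ (ratVal (ratAdd b (ratNeg a)) : ℝ) := by
    rw [ratVal_ratAdd, ratVal_ratNeg]
    push_cast
    rw [abs_of_pos (by linarith)]
    linarith
  have h1 := abs_eltVal_sub_le hxM hxs p
  have h2 : (ratVal (polyEvalErr M (ratAdd b (ratNeg a)) a p).2 : ℝ) < eltVal (ratVal a : ℝ) p := by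
    rw [eltVal_ratVal]
    exact_mod_cast herr
  linarith [(abs_le.1 h1).1]

/-- The defining polynomial is squarefree, so it changes its sign at the simple root `α`; the
cofactor of `X - α` keeps its sign nearby. -/
theorem Isolates.exists_sign_change (h : Isolates F α) :
    ∃ δ > 0, ∀ a b : ℝ, α - δ < a → a < α → α < b → b < α + δ →
      eltVal a F.1 * eltVal b F.1 < 0 := by
  set f : ℝ[X] := (ratPoly F.1).map (algebraMap ℚ ℝ) with hf
  have heval : ∀ x : ℝ, eltVal x F.1 = f.eval x := fun x => by
    rw [hf, eltVal, eval_map_algebraMap]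
  have hsq : Squarefree f := by
    have : (ratPoly F.1).Separable := PerfectField.separable_iff_squarefree.2 h.1
    exact (this.map (f := algebraMap ℚ ℝ)).squarefree
  obtain ⟨k, hk⟩ : X - C α ∣ f := dvd_iff_isRoot.2 (by
    rw [IsRoot, ← heval]
    exact h.root.1)
  have hkα : k.eval α ≠ 0 := by
    intro h0
    obtain ⟨l, hl⟩ := dvd_iff_isRoot.2 h0
    have := hsq (X - C α) ⟨l, by rw [hk, hl, mul_assoc]⟩
    exact not_isUnit_X_sub_C α this
  have hev : ∀ᶠ x in 𝓝 α, 0 < k.eval x * k.eval α := by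
    have hc : ContinuousAt (fun x => k.eval x * k.eval α) α := by fun_prop
    exact hc.eventually (lt_mem_nhds (mul_self_pos.2 hkα))
  obtain ⟨δ, hδ, hball⟩ := Metric.eventually_nhds_iff.1 hev
  refine ⟨δ, hδ, fun a b h1 h2 h3 h4 => ?_⟩
  have ha : 0 < k.eval a * k.eval α := hball (by rw [Real.dist_eq, abs_lt]; constructor <;> linarith)
  have hb : 0 < k.eval b * k.eval α := hball (by rw [Real.dist_eq, abs_lt]; constructor <;> linarith)
  have hab : 0 < k.eval a * k.eval b := by
    have : 0 < (k.eval a * k.eval b) * (k.eval α * k.eval α) := by nlinarith [mul_pos ha hb]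
    exact pos_of_mul_pos_left this (mul_self_nonneg _)
  rw [heval, heval, hk, eval_mul, eval_mul]
  simp only [eval_sub, eval_X, eval_C]
  have hneg : (a - α) * (b - α) < 0 := mul_neg_of_neg_of_pos (by linarith) (by linarith)
  nlinarith [mul_neg_of_neg_of_pos hneg hab]

theorem posTest_of_eltVal_pos (h : Isolates F α) {p : EltCode} (hp : 0 < eltVal α p) :
    PosTest F p := by
  obtain ⟨-, hlo, hhi⟩ := h.root
  obtain ⟨δ, hδ, hsign⟩ := h.exists_sign_change
  obtain ⟨Mq, hMq⟩ := exists_rat_gt (|α| + 1)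
  obtain ⟨M, rfl⟩ := exists_ratVal Mq
  have hM0' : (0 : ℝ) < ratVal M := by linarith [abs_nonneg α]
  have hM0 : 0 < ratVal M := by exact_mod_cast hM0'
  obtain ⟨E, B, hE, herr⟩ := exists_polyEvalErr_le M hM0.le p
  have hcont : Continuous fun x : ℝ => eltVal x p := by
    unfold eltVal
    exact Polynomial.continuous_aeval _
  obtain ⟨η, hη, hball⟩ := Metric.eventually_nhds_iff.1
    (hcont.continuousAt.eventually (lt_mem_nhds (half_lt_self hp)))
  have hE' : (0 : ℝ) ≤ E := by exact_mod_cast hE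
  -- a radius that is small enough for all requirements
  set ρ := min (min δ 1) (min η (eltVal α p / (4 * (E + 1)))) with hρdef
  have hρ : 0 < ρ := lt_min (lt_min hδ one_pos) (lt_min hη (by positivity))
  have hρδ : ρ ≤ δ := (min_le_left _ _).trans (min_le_left _ _)
  have hρ1 : ρ ≤ 1 := (min_le_left _ _).trans (min_le_right _ _)
  have hρη : ρ ≤ η := (min_le_right _ _).trans (min_le_left _ _)
  have hρE : ρ ≤ eltVal α p / (4 * (E + 1)) := (min_le_right _ _).trans (min_le_right _ _)
  obtain ⟨aq, ha1, ha2⟩ := exists_rat_btwn (max_lt hlo (show α - ρ < α by linarith))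
  obtain ⟨bq, hb1, hb2⟩ := exists_rat_btwn (lt_min hhi (show α < α + ρ by linarith))
  obtain ⟨a, rfl⟩ := exists_ratVal aq
  obtain ⟨b, rfl⟩ := exists_ratVal bq
  have ha3 := (le_max_left _ _).trans ha1.le
  have ha4 := lt_of_le_of_lt (le_max_right _ _) ha1
  have hb3 := hb2.le.trans (min_le_left _ _)
  have hb4 := lt_of_lt_of_le hb2 (min_le_right _ _)
  have hαle := abs_le.1 (le_refl |α|)
  have haM : |(ratVal a : ℝ)| ≤ ratVal M := by
    rw [abs_le]; constructor <;> linarith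
  have hbM : |(ratVal b : ℝ)| ≤ ratVal M := by
    rw [abs_le]; constructor <;> linarith
  refine ⟨(a, b, M), by exact_mod_cast ha3, by exact_mod_cast hb3, by exact_mod_cast ha2.trans hb1,
    ?_, ?_, ?_, ?_⟩
  · have := hsign _ _ (by linarith : α - δ < ratVal a) ha2 hb1 (by linarith)
    rw [eltVal_ratVal, eltVal_ratVal] at this
    rw [ratVal_ratMul, ratVal_zero]
    exact_mod_cast this
  · rw [ratVal_ratAbs]
    exact_mod_cast haM
  · rw [ratVal_ratAbs]
    exact_mod_cast hbM
  · have hs : ratVal (ratAdd b (ratNeg a)) = ratVal b - ratVal a := by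
      rw [ratVal_ratAdd, ratVal_ratNeg, sub_eq_add_neg]
    have hs0 : 0 ≤ ratVal (ratAdd b (ratNeg a)) := by
      rw [hs, sub_nonneg]
      exact_mod_cast (ha2.trans hb1).le
    have h1 := (herr a (ratAdd b (ratNeg a)) (by exact_mod_cast haM) hs0).1
    rw [hs] at h1
    have h2 : (ratVal (polyEvalErr M (ratAdd b (ratNeg a)) a p).2 : ℝ) ≤
        (ratVal b - ratVal a) * E := by exact_mod_cast h1
    have h3 : eltVal α p / 2 < eltVal (ratVal a : ℝ) p :=
      hball (by rw [Real.dist_eq, abs_lt]; constructor <;> linarith)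
    have h4 : ((ratVal b : ℝ) - ratVal a) * E ≤ eltVal α p / 2 := by
      have h5 : ((ratVal b : ℝ) - ratVal a) ≤ 2 * ρ := by linarith
      have h6 : ρ * (4 * (E + 1)) ≤ eltVal α p := (le_div_iff₀ (by positivity)).1 hρE
      nlinarith
    rw [eltVal_ratVal] at h3
    have h7 : (ratVal (polyEvalErr M (ratAdd b (ratNeg a)) a p).2 : ℝ) < ratVal (polyEval a p) := by
      linarith
    exact_mod_cast h7

theorem posTest_iff (h : Isolates F α) {p : EltCode} : PosTest F p ↔ 0 < eltVal α p :=
  ⟨eltVal_pos_of_posTest h, posTest_of_eltVal_pos h⟩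

/-- A certificate that `p` vanishes at the number coded by `F`: a common factor of `p` and the
defining polynomial, such that the cofactor in the latter does not vanish there. -/
def ZeroTest (F : FieldCode) (p : EltCode) : Prop :=
  ∃ w : EltCode × EltCode × EltCode, ratPoly F.1 = ratPoly (polyMul w.1 w.2.1) ∧
    ratPoly p = ratPoly (polyMul w.1 w.2.2) ∧ (PosTest F w.2.1 ∨ PosTest F (polyNeg w.2.1))

theorem semiDec_zeroTest {β : Type} [Primcodable β] {F : β → FieldCode} {p : β → EltCode}
    (hF : Primrec F) (hp : Primrec p) : SemiDec fun x => ZeroTest (F x) (p x) := by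
  unfold ZeroTest
  refine SemiDec.exists_right ?_
  refine SemiDec.and (semiDec_ratPoly_eq (by fun_prop) (by fun_prop)) ?_
  refine SemiDec.and (semiDec_ratPoly_eq (by fun_prop) (by fun_prop)) ?_
  exact SemiDec.or (semiDec_posTest (by fun_prop) (by fun_prop))
    (semiDec_posTest (by fun_prop) (by fun_prop))

theorem Isolates.isIntegral (h : Isolates F α) : IsIntegral ℚ α :=
  isAlgebraic_iff_isIntegral.1 ⟨ratPoly F.1, h.1.ne_zero, h.root.1⟩

/-- The common factor can be taken to be the minimal polynomial of `α`: by squarefreeness it divides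
the defining polynomial only once. -/
theorem zeroTest_iff (h : Isolates F α) {p : EltCode} : ZeroTest F p ↔ eltVal α p = 0 := by
  constructor
  · rintro ⟨⟨g, u, k⟩, h1, h2, h3⟩
    simp only at *
    have hu : eltVal α u ≠ 0 := by
      rw [posTest_iff h, posTest_iff h, eltVal_polyNeg, neg_pos] at h3
      rcases h3 with h3 | h3
      · exact h3.ne'
      · exact h3.ne
    have hgu : eltVal α g * eltVal α u = 0 := by
      rw [← eltVal_polyMul, eltVal, ← h1]
      exact h.root.1
    rw [eltVal, h2, ← eltVal, eltVal_polyMul, (mul_eq_zero.1 hgu).resolve_right hu, zero_mul]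
  · intro hp
    obtain ⟨u, hu⟩ := minpoly.dvd ℚ α h.root.1
    obtain ⟨k, hk⟩ := minpoly.dvd ℚ α hp
    obtain ⟨g', hg'⟩ := exists_ratPoly (minpoly ℚ α)
    obtain ⟨u', rfl⟩ := exists_ratPoly u
    obtain ⟨k', rfl⟩ := exists_ratPoly k
    refine ⟨(g', u', k'), by rw [ratPoly_polyMul, hg']; exact hu,
      by rw [ratPoly_polyMul, hg']; exact hk, ?_⟩
    rw [posTest_iff h, posTest_iff h, eltVal_polyNeg, neg_pos]
    have hu0 : eltVal α u' ≠ 0 := by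
      intro h0
      obtain ⟨l, hl⟩ := minpoly.dvd ℚ α h0
      exact minpoly.not_isUnit ℚ α (h.1 _ ⟨l, by rw [hu, hl, mul_assoc]⟩)
    exact (lt_or_gt_of_ne hu0).symm

/-- A certificate that `p` is nonnegative at the number coded by `F`. -/
def NonnegTest (F : FieldCode) (p : EltCode) : Prop := PosTest F p ∨ ZeroTest F p

theorem semiDec_nonnegTest {β : Type} [Primcodable β] {F : β → FieldCode} {p : β → EltCode}
    (hF : Primrec F) (hp : Primrec p) : SemiDec fun x => NonnegTest (F x) (p x) :=
  (semiDec_posTest hF hp).or (semiDec_zeroTest hF hp)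

theorem nonnegTest_iff (h : Isolates F α) {p : EltCode} : NonnegTest F p ↔ 0 ≤ eltVal α p := by
  rw [NonnegTest, posTest_iff h, zeroTest_iff h, le_iff_lt_or_eq, eq_comm]

/-- `ℚ(α)` is closed under division. -/
theorem exists_eltVal_div (h : Isolates F α) (p q : EltCode) :
    ∃ c, eltVal α c = eltVal α p / eltVal α q := by
  have hK : ∀ x ∈ Algebra.adjoin ℚ {α}, ∃ c, eltVal α c = x := by
    intro x hx
    rw [Algebra.adjoin_singleton_eq_range_aeval] at hx
    obtain ⟨f, rfl⟩ := hx
    obtain ⟨c, rfl⟩ := exists_ratPoly f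
    exact ⟨c, rfl⟩
  have hmem : ∀ c, eltVal α c ∈ IntermediateField.adjoin ℚ {α} := fun c => by
    have : eltVal α c ∈ Algebra.adjoin ℚ {α} := aeval_mem_adjoin_singleton ℚ α
    exact IntermediateField.algebra_adjoin_le_adjoin ℚ {α} this
  have hdiv := div_mem (hmem p) (hmem q)
  apply hK
  rwa [← IntermediateField.adjoin_simple_toSubalgebra_of_isAlgebraic h.isIntegral.isAlgebraic]

end Signs

/-! ### Terms of the solution -/

section Terms

/-- The value of a polynomial over `ℚ(α)` at an element of `ℚ(α)`. -/
def eltPolyAt (x : EltCode) (l : List EltCode) : EltCode :=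
  l.foldr (fun c acc => polyAdd c (polyMul x acc)) []

/-- The dot product of two vectors of length `d` over `ℚ(α)`. -/
def eltDot (d : ℕ) (a b : List EltCode) : EltCode :=
  (List.range d).foldr (fun j acc => polyAdd (polyMul (a.getD j []) (b.getD j [])) acc) []

section Primrec

variable {β : Type*} [Primcodable β]

@[fun_prop] theorem primrec_eltPolyAt {x : β → EltCode} {l : β → List EltCode} (hx : Primrec x)
    (hl : Primrec l) : Primrec fun y => eltPolyAt (x y) (l y) := by unfold eltPolyAt; fun_prop

@[fun_prop] theorem primrec_eltDot {d : β → ℕ} {a b : β → List EltCode} (hd : Primrec d)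
    (ha : Primrec a) (hb : Primrec b) : Primrec fun y => eltDot (d y) (a y) (b y) := by
  unfold eltDot; fun_prop

@[fun_prop] theorem primrec_entry {I : β → Input} {i j : β → ℕ} (hI : Primrec I)
    (hi : Primrec i) (hj : Primrec j) : Primrec fun y => (I y).entry (i y) (j y) := by
  unfold Input.entry; fun_prop

end Primrec

variable {α : ℝ}

theorem eltVal_eltPolyAt (x : EltCode) (l : List EltCode) :
    eltVal α (eltPolyAt x l) = (eltPoly α l).eval (eltVal α x) := by
  induction l with
  | nil => simp [eltPolyAt, eltPoly, eltVal_nil]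
  | cons c l ih =>
    rw [eltPolyAt, List.foldr_cons, ← eltPolyAt, eltVal_polyAdd, eltVal_polyMul, ih, eltPoly]
    simp

theorem eltVal_eltPolyAt_ratNat (n : ℕ) (l : List EltCode) :
    eltVal α (eltPolyAt [ratNat n] l) = (eltPoly α l).eval (n : ℝ) := by
  rw [eltVal_eltPolyAt, eltVal_singleton, ratVal_ratNat, Rat.cast_natCast]

/-- A homomorphism from a coded addition turns iterated addition into a sum. -/
theorem map_foldr_range {σ R : Type*} [AddCommMonoid R] (φ : σ → R) {add : σ → σ → σ}
    (hadd : ∀ x y, φ (add x y) = φ x + φ y) (g : ℕ → σ) (z : σ) (n : ℕ) :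
    φ ((List.range n).foldr (fun j acc => add (g j) acc) z) = ∑ j : Fin n, φ (g j) + φ z := by
  induction n generalizing z with
  | zero => simp
  | succ n ih =>
    rw [List.range_succ, List.foldr_append, List.foldr_cons, List.foldr_nil, ih, hadd,
      Fin.sum_univ_castSucc, add_assoc]
    simp

theorem eltVal_eltDot (d : ℕ) (a b : List EltCode) : eltVal α (eltDot d a b) =
    ∑ j : Fin d, eltVal α (a.getD j []) * eltVal α (b.getD j []) := by
  rw [eltDot, map_foldr_range (eltVal α) (eltVal_polyAdd α)
    (fun j => polyMul (a.getD j []) (b.getD j [])), eltVal_nil, add_zero]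
  simp only [eltVal_polyMul]

/-- A certificate that `V` represents the `n`-th term of the solution: codes of the terms up to `n`
and, for each step, codes of the entries of the matrix. The latter are characterized by
multiplication with the denominators, so that no division has to be carried out. -/
def OrbitTest (I : Input) (n : ℕ) (V : List EltCode) : Prop :=
  ∃ t : List (List EltCode), t.getD 0 [] = I.2.2.2 ∧ t.getD n [] = V ∧
    ∀ k < n, ∀ i < I.1, ∃ a : List EltCode,
      (∀ j < I.1, ZeroTest I.2.1 (polyAdd
        (polyMul (a.getD j []) (eltPolyAt [ratNat k] (I.entry i j).2))
        (polyNeg (eltPolyAt [ratNat k] (I.entry i j).1)))) ∧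
      ZeroTest I.2.1 (polyAdd ((t.getD (k + 1) []).getD i [])
        (polyNeg (eltDot I.1 a (t.getD k []))))

theorem semiDec_orbitTest {β : Type} [Primcodable β] {I : β → Input} {n : β → ℕ}
    {V : β → List EltCode} (hI : Primrec I) (hn : Primrec n) (hV : Primrec V) :
    SemiDec fun x => OrbitTest (I x) (n x) (V x) := by
  unfold OrbitTest
  refine SemiDec.exists_right ?_
  refine SemiDec.and (SemiDec.eq (by fun_prop) (by fun_prop)) ?_
  refine SemiDec.and (SemiDec.eq (by fun_prop) (by fun_prop)) ?_
  refine SemiDec.forall_lt (by fun_prop) ?_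
  refine SemiDec.forall_lt (by fun_prop) ?_
  refine SemiDec.exists_right ?_
  refine SemiDec.and ?_ (semiDec_zeroTest (by fun_prop) (by fun_prop))
  refine SemiDec.forall_lt (by fun_prop) ?_
  exact semiDec_zeroTest (by fun_prop) (by fun_prop)

variable {I : Input}

theorem OrbitTest.eltVal_eq (h : I.WellFormed α) {n : ℕ} {V : List EltCode}
    (hV : OrbitTest I n V) (i : Fin I.dim) :
    eltVal α (V.getD i []) = orbit (I.mat α) (I.vec α) n i := by
  obtain ⟨t, h0, hn, hstep⟩ := hV
  have key : ∀ k ≤ n, ∀ i : Fin I.dim,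
      eltVal α ((t.getD k []).getD i []) = orbit (I.mat α) (I.vec α) k i := by
    intro k
    induction k with
    | zero => intro _ i; rw [h0]; rfl
    | succ k ih =>
      intro hk i
      obtain ⟨a, ha, hz⟩ := hstep k hk i i.2
      rw [zeroTest_iff h.1, eltVal_polyAdd, eltVal_polyNeg, ← sub_eq_add_neg, sub_eq_zero,
        eltVal_eltDot] at hz
      rw [hz, orbit, mulVec_apply_eq_sum]
      refine Finset.sum_congr rfl fun (j : Fin I.dim) _ => ?_
      have haj := ha j j.2
      rw [zeroTest_iff h.1, eltVal_polyAdd, eltVal_polyNeg, ← sub_eq_add_neg, sub_eq_zero,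
        eltVal_polyMul, eltVal_eltPolyAt_ratNat, eltVal_eltPolyAt_ratNat] at haj
      rw [ih (Nat.le_of_succ_le hk) j, Input.mat, Matrix.of_apply,
        eq_div_of_mul_eq (h.2 k i j) haj]
  rw [← hn]
  exact key n le_rfl i

theorem exists_list_of_fin {σ : Type*} (z : σ) {d : ℕ} (f : Fin d → σ) :
    ∃ l : List σ, ∀ i : Fin d, l.getD i z = f i :=
  ⟨List.ofFn f, fun i => by rw [List.getD_eq_getElem _ _ (by simp)]; simp⟩

theorem exists_matRow (h : I.WellFormed α) (k : ℕ) (i : Fin I.dim) : ∃ a : List EltCode,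
    ∀ j : Fin I.dim, eltVal α (a.getD j []) = I.mat α k i j := by
  choose c hc using fun j : Fin I.dim => exists_eltVal_div h.1
    (eltPolyAt [ratNat k] (I.entry i j).1) (eltPolyAt [ratNat k] (I.entry i j).2)
  obtain ⟨a, ha⟩ := exists_list_of_fin [] c
  refine ⟨a, fun j => ?_⟩
  rw [ha, hc, eltVal_eltPolyAt_ratNat, eltVal_eltPolyAt_ratNat]
  rfl

theorem exists_orbitTest (h : I.WellFormed α) (n : ℕ) : ∃ V, OrbitTest I n V := by
  have hW : ∀ k, ∃ W : List EltCode, ∀ i : Fin I.dim,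
      eltVal α (W.getD i []) = orbit (I.mat α) (I.vec α) k i := by
    intro k
    induction k with
    | zero => exact ⟨I.2.2.2, fun i => rfl⟩
    | succ k ih =>
      obtain ⟨W, hW⟩ := ih
      choose a ha using exists_matRow h k
      obtain ⟨W', hW'⟩ := exists_list_of_fin [] fun i => eltDot I.dim (a i) W
      refine ⟨W', fun i => ?_⟩
      rw [hW', eltVal_eltDot, orbit, mulVec_apply_eq_sum]
      exact Finset.sum_congr rfl fun j _ => by rw [ha, hW]
  choose W hW using hW
  set W' : ℕ → List EltCode := fun k => if k = 0 then I.2.2.2 else W k with hW'def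
  have hW' : ∀ k, ∀ i : Fin I.dim,
      eltVal α ((W' k).getD i []) = orbit (I.mat α) (I.vec α) k i := by
    intro k i
    rcases Nat.eq_zero_or_pos k with rfl | hk
    · rfl
    · simp only [hW'def, hk.ne', if_false, hW]
  have ht : ∀ k ≤ n, ((List.range (n + 1)).map W').getD k [] = W' k := fun k hk => by
    rw [List.getD_eq_getElem _ _ (by simpa using Nat.lt_succ_of_le hk)]
    simp
  refine ⟨W' n, (List.range (n + 1)).map W', ht 0 (Nat.zero_le _), ht n le_rfl,
    fun k hk i hi => ?_⟩
  obtain ⟨a, ha⟩ := exists_matRow h k ⟨i, hi⟩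
  refine ⟨a, fun j hj => ?_, ?_⟩
  · rw [zeroTest_iff h.1, eltVal_polyAdd, eltVal_polyNeg, ← sub_eq_add_neg, sub_eq_zero,
      eltVal_polyMul, eltVal_eltPolyAt_ratNat, eltVal_eltPolyAt_ratNat]
    rw [ha ⟨j, hj⟩, Input.mat, Matrix.of_apply]
    exact div_mul_cancel₀ _ (h.2 k ⟨i, hi⟩ ⟨j, hj⟩)
  · rw [zeroTest_iff h.1, eltVal_polyAdd, eltVal_polyNeg, ← sub_eq_add_neg, sub_eq_zero,
      ht k hk.le, ht (k + 1) hk, eltVal_eltDot, hW' (k + 1) ⟨i, hi⟩, orbit, mulVec_apply_eq_sum]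
    exact Finset.sum_congr rfl fun (j : Fin I.dim) _ => by rw [hW' k j]; exact congrArg (· * _) (ha j).symm

end Terms

/-! ### Bounds for rational functions on a half-line -/

section Bounds

variable {α : ℝ}

/-- The coefficients of `σ (p - c q)`, evaluated by Horner's rule at `K`, where the first `s`
coefficients are dropped. -/
def hornerDiff (σ c : RatCode) (p q : List EltCode) (K s : ℕ) : EltCode :=
  polyMul [σ] (polyAdd (eltPolyAt [ratNat K] (p.drop s))
    (polyNeg (polyMul [c] (eltPolyAt [ratNat K] (q.drop s)))))

@[fun_prop] theorem primrec_hornerDiff {β : Type*} [Primcodable β] {σ c : β → RatCode}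
    {p q : β → List EltCode} {K s : β → ℕ} (hσ : Primrec σ) (hc : Primrec c) (hp : Primrec p)
    (hq : Primrec q) (hK : Primrec K) (hs : Primrec s) :
    Primrec fun y => hornerDiff (σ y) (c y) (p y) (q y) (K y) (s y) := by
  unfold hornerDiff; fun_prop

/-- The polynomial `σ (p - c q)` without its first `s` coefficients. -/
noncomputable def hornerPoly (α σ c : ℝ) (p q : List EltCode) (s : ℕ) : ℝ[X] :=
  C σ * (eltPoly α (p.drop s) - C c * eltPoly α (q.drop s))

theorem eltVal_hornerDiff (σ c : RatCode) (p q : List EltCode) (K s : ℕ) :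
    eltVal α (hornerDiff σ c p q K s) =
      (hornerPoly α (ratVal σ) (ratVal c) p q s).eval (K : ℝ) := by
  simp only [hornerDiff, hornerPoly, eltVal_polyMul, eltVal_polyAdd, eltVal_polyNeg,
    eltVal_singleton, eltVal_eltPolyAt_ratNat, eval_mul, eval_sub, eval_C]
  ring

theorem eltPoly_drop (l : List EltCode) (s : ℕ) : eltPoly α (l.drop s) =
    C (eltVal α (l.getD s [])) + X * eltPoly α (l.drop (s + 1)) := by
  rcases lt_or_ge s l.length with h | h
  · rw [List.drop_eq_getElem_cons h, List.getD_eq_getElem _ _ h, eltPoly]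
  · rw [List.drop_eq_nil_of_le h, List.drop_eq_nil_of_le (h.trans (Nat.le_succ s)),
      List.getD_eq_default _ _ h, eltVal_nil]
    simp [eltPoly]

theorem hornerPoly_eq (σ c : ℝ) (p q : List EltCode) (s : ℕ) :
    ∃ a : ℝ, hornerPoly α σ c p q s = C a + X * hornerPoly α σ c p q (s + 1) := by
  refine ⟨σ * (eltVal α (p.getD s []) - c * eltVal α (q.getD s [])), ?_⟩
  rw [hornerPoly, hornerPoly, eltPoly_drop p, eltPoly_drop q]
  simp only [C_mul, C_sub]
  ring

theorem hornerPoly_eq_zero (σ c : ℝ) (p q : List EltCode) {s : ℕ}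
    (hs : max p.length q.length ≤ s) : hornerPoly α σ c p q s = 0 := by
  rw [hornerPoly, List.drop_eq_nil_of_le ((le_max_left _ _).trans hs),
    List.drop_eq_nil_of_le ((le_max_right _ _).trans hs)]
  simp [eltPoly]

/-- If all intermediate results of Horner's rule at `K` are nonnegative, then the polynomial is
nonnegative on `[K, ∞)`. -/
theorem hornerPoly_nonneg {σ c : ℝ} {p q : List EltCode} {K : ℕ}
    (h : ∀ s < max p.length q.length, 0 ≤ (hornerPoly α σ c p q s).eval (K : ℝ)) {x : ℝ}
    (hx : (K : ℝ) ≤ x) (s : ℕ) : 0 ≤ (hornerPoly α σ c p q s).eval x := by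
  have key : ∀ k s, max p.length q.length ≤ s + k → 0 ≤ (hornerPoly α σ c p q s).eval (K : ℝ) ∧
      (hornerPoly α σ c p q s).eval (K : ℝ) ≤ (hornerPoly α σ c p q s).eval x := by
    intro k
    induction k with
    | zero => intro s hs; rw [hornerPoly_eq_zero σ c p q (by simpa using hs)]; simp
    | succ k ih =>
      intro s hs
      obtain ⟨h1, h2⟩ := ih (s + 1) (by omega)
      have hK : (0 : ℝ) ≤ K := Nat.cast_nonneg K
      constructor
      · rcases lt_or_ge s (max p.length q.length) with h3 | h3
        · exact h s h3
        · rw [hornerPoly_eq_zero σ c p q h3]; simp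
      · obtain ⟨a, ha⟩ := hornerPoly_eq (α := α) σ c p q s
        rw [ha]
        simp only [eval_add, eval_C, eval_mul, eval_X]
        have := mul_le_mul hx h2 h1 (hK.trans hx)
        linarith
  obtain ⟨h1, h2⟩ := key (max p.length q.length) s (Nat.le_add_left _ _)
  exact h1.trans h2

theorem eventually_eval_nonneg {g : ℝ[X]} (hg : 0 ≤ g.leadingCoeff) :
    ∀ᶠ n : ℕ in atTop, 0 ≤ g.eval (n : ℝ) := by
  rcases lt_or_ge 0 g.degree with h | h
  · exact tendsto_natCast_atTop_atTop.eventually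
      ((g.tendsto_atTop_of_leadingCoeff_nonneg h hg).eventually_ge_atTop 0)
  · rw [eq_C_of_degree_le_zero h] at hg ⊢
    exact Eventually.of_forall fun n => by simpa using hg

theorem leadingCoeff_nonneg_of_eventually {g : ℝ[X]}
    (hg : ∀ᶠ n : ℕ in atTop, 0 < g.eval (n : ℝ)) : 0 ≤ g.leadingCoeff := by
  by_contra h
  push Not at h
  have h1 : ∀ᶠ n : ℕ in atTop, 0 ≤ (-g).eval (n : ℝ) :=
    eventually_eval_nonneg (by rw [leadingCoeff_neg]; linarith)
  obtain ⟨n, h2, h3⟩ := (hg.and h1).exists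
  rw [eval_neg] at h3
  linarith

/-- Dropping low coefficients keeps the leading coefficient, so all intermediate results of Horner's
rule are nonnegative far out if the polynomial is positive there. -/
theorem eventually_hornerPoly_nonneg {σ c : ℝ} {p q : List EltCode}
    (h : ∀ᶠ n : ℕ in atTop, 0 < (hornerPoly α σ c p q 0).eval (n : ℝ)) :
    ∀ᶠ K : ℕ in atTop, ∀ s < max p.length q.length,
      0 ≤ (hornerPoly α σ c p q s).eval (K : ℝ) := by
  have hlc : ∀ s, 0 ≤ (hornerPoly α σ c p q s).leadingCoeff := by
    intro s
    induction s with
    | zero => exact leadingCoeff_nonneg_of_eventually h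
    | succ s ih =>
      obtain ⟨a, ha⟩ := hornerPoly_eq (α := α) σ c p q s
      by_cases h0 : hornerPoly α σ c p q (s + 1) = 0
      · rw [h0, leadingCoeff_zero]
      · rw [ha, leadingCoeff_add_of_degree_lt, leadingCoeff_mul, leadingCoeff_X, one_mul] at ih
        · exact ih
        · refine lt_of_le_of_lt degree_C_le ?_
          rw [X_mul, degree_mul_X, degree_eq_natDegree h0]
          exact_mod_cast Nat.succ_pos _
  exact (Set.finite_lt_nat _).eventually_all.2 fun s _ => eventually_eval_nonneg (hlc s)

/-- A certificate for the bounds `lo ≤ p (n) / q (n) ≤ hi` for all `n ≥ K`. The number `σ` has the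
sign of `q` on this half-line. -/
def BoundTest (F : FieldCode) (p q : List EltCode) (K : ℕ) (lo hi : RatCode) : Prop :=
  ∃ σ : RatCode, ratVal σ ≠ ratVal (0, 0, 0) ∧ ∀ s < max p.length q.length,
    NonnegTest F (hornerDiff σ lo p q K s) ∧ NonnegTest F (hornerDiff (ratNeg σ) hi p q K s)

theorem semiDec_boundTest {β : Type} [Primcodable β] {F : β → FieldCode}
    {p q : β → List EltCode} {K : β → ℕ} {lo hi : β → RatCode} (hF : Primrec F) (hp : Primrec p)
    (hq : Primrec q) (hK : Primrec K) (hlo : Primrec lo) (hhi : Primrec hi) :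
    SemiDec fun x => BoundTest (F x) (p x) (q x) (K x) (lo x) (hi x) := by
  unfold BoundTest
  refine SemiDec.exists_right ?_
  refine SemiDec.and (semiDec_ratVal_ne (by fun_prop) (by fun_prop)) ?_
  refine SemiDec.forall_lt (by fun_prop) ?_
  exact SemiDec.and (semiDec_nonnegTest (by fun_prop) (by fun_prop))
    (semiDec_nonnegTest (by fun_prop) (by fun_prop))

variable {F : FieldCode} {p q : List EltCode}

theorem BoundTest.bounds (hF : Isolates F α) {K : ℕ} {lo hi : RatCode}
    (h : BoundTest F p q K lo hi) (hlt : ratVal lo < ratVal hi) {n : ℕ} (hn : K ≤ n)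
    (hq : (eltPoly α q).eval (n : ℝ) ≠ 0) :
    (ratVal lo : ℝ) ≤ (eltPoly α p).eval (n : ℝ) / (eltPoly α q).eval (n : ℝ) ∧
      (eltPoly α p).eval (n : ℝ) / (eltPoly α q).eval (n : ℝ) ≤ (ratVal hi : ℝ) := by
  obtain ⟨σ, hσ, hs⟩ := h
  rw [ratVal_zero] at hσ
  have hσ' : (ratVal σ : ℝ) ≠ 0 := by exact_mod_cast hσ
  have hlt' : (ratVal lo : ℝ) < ratVal hi := by exact_mod_cast hlt
  have hn' : (K : ℝ) ≤ n := by exact_mod_cast hn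
  simp only [nonnegTest_iff hF, eltVal_hornerDiff] at hs
  have h1 := hornerPoly_nonneg (fun s hs' => (hs s hs').1) hn' 0
  have h2 := hornerPoly_nonneg (fun s hs' => (hs s hs').2) hn' 0
  simp only [hornerPoly, ratVal_ratNeg, List.drop_zero, eval_mul, eval_sub, eval_C,
    Rat.cast_neg] at h1 h2
  set P := (eltPoly α p).eval (n : ℝ)
  set Q := (eltPoly α q).eval (n : ℝ)
  -- the sum of both inequalities gives the sign of the denominator
  have h3 : 0 ≤ ((ratVal hi : ℝ) - ratVal lo) * (ratVal σ * Q) := by linarith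
  have h4 : 0 < ratVal σ * Q :=
    lt_of_le_of_ne (nonneg_of_mul_nonneg_right h3 (by linarith)) (Ne.symm (mul_ne_zero hσ' hq))
  have h5 : P / Q = (ratVal σ * P) / (ratVal σ * Q) := (mul_div_mul_left _ _ hσ').symm
  rw [h5, le_div_iff₀ h4, div_le_iff₀ h4]
  constructor <;> linarith

/-- Strict bounds for the limit of a rational function are certified on some half-line. -/
theorem eventually_boundTest (hF : Isolates F α) {lo hi : RatCode} {l : ℝ}
    (hq : ∀ n : ℕ, (eltPoly α q).eval (n : ℝ) ≠ 0)
    (hl : Tendsto (fun n : ℕ => (eltPoly α p).eval (n : ℝ) / (eltPoly α q).eval (n : ℝ)) atTop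
      (𝓝 l)) (hlo : (ratVal lo : ℝ) < l) (hhi : l < (ratVal hi : ℝ)) :
    ∀ᶠ K in atTop, BoundTest F p q K lo hi := by
  obtain ⟨σ, hσ, hσq⟩ : ∃ σ : RatCode, ratVal σ ≠ 0 ∧
      ∀ᶠ n : ℕ in atTop, 0 < (ratVal σ : ℝ) * (eltPoly α q).eval (n : ℝ) := by
    have key : ∀ σ : ℚ, σ ≠ 0 → 0 ≤ (σ : ℝ) * (eltPoly α q).leadingCoeff →
        ∃ σ : RatCode, ratVal σ ≠ 0 ∧
          ∀ᶠ n : ℕ in atTop, 0 < (ratVal σ : ℝ) * (eltPoly α q).eval (n : ℝ) := by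
      intro σ hσ h
      obtain ⟨σ', rfl⟩ := exists_ratVal σ
      refine ⟨σ', hσ, ?_⟩
      have h1 : 0 ≤ (C (ratVal σ' : ℝ) * eltPoly α q).leadingCoeff := by
        rwa [leadingCoeff_mul, leadingCoeff_C]
      filter_upwards [eventually_eval_nonneg h1] with n hn
      rw [eval_mul, eval_C] at hn
      exact lt_of_le_of_ne hn (Ne.symm (mul_ne_zero (by exact_mod_cast hσ) (hq n)))
    rcases le_total 0 (eltPoly α q).leadingCoeff with h | h
    · exact key 1 one_ne_zero (by simpa using h)
    · exact key (-1) (by norm_num) (by simpa using h)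
  have h1 : ∀ᶠ n : ℕ in atTop,
      0 < (hornerPoly α (ratVal σ) (ratVal lo) p q 0).eval (n : ℝ) := by
    filter_upwards [hσq, hl.eventually (lt_mem_nhds hlo)] with n hn hn'
    have := mul_pos hn (sub_pos.2 hn')
    simp only [hornerPoly, List.drop_zero, eval_mul, eval_sub, eval_C]
    have h0 := hq n
    field_simp at this
    linarith
  have h2 : ∀ᶠ n : ℕ in atTop,
      0 < (hornerPoly α (ratVal (ratNeg σ)) (ratVal hi) p q 0).eval (n : ℝ) := by
    filter_upwards [hσq, hl.eventually (gt_mem_nhds hhi)] with n hn hn'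
    have := mul_pos hn (sub_pos.2 hn')
    simp only [hornerPoly, List.drop_zero, eval_mul, eval_sub, eval_C, ratVal_ratNeg, Rat.cast_neg]
    have h0 := hq n
    field_simp at this
    linarith
  filter_upwards [eventually_hornerPoly_nonneg h1, eventually_hornerPoly_nonneg h2] with K hK1 hK2
  refine ⟨σ, by rwa [ratVal_zero], fun s hs => ?_⟩
  rw [nonnegTest_iff hF, nonnegTest_iff hF, eltVal_hornerDiff, eltVal_hornerDiff]
  exact ⟨hK1 s hs, hK2 s hs⟩

end Bounds

/-! ### Rational matrices and perturbation of products -/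

section RationalMatrices

/-- The entries of a matrix given by its rows. -/
def ratEntry (M : List (List RatCode)) (i j : ℕ) : RatCode := (M.getD i []).getD j (0, 0, 0)

/-- Multiplication of `d × d` matrices given by their rows. -/
def ratMatMul (d : ℕ) (M N : List (List RatCode)) : List (List RatCode) :=
  (List.range d).map fun i => (List.range d).map fun j =>
    (List.range d).foldr (fun k acc => ratAdd (ratMul (ratEntry M i k) (ratEntry N k j)) acc)
      (0, 0, 0)

/-- Powers of rational numbers. -/
def ratPow (x : RatCode) (n : ℕ) : RatCode := (ratMul x)^[n] (ratNat 1)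

/-- The matrix with the given rows. -/
noncomputable def realMat (d : ℕ) (M : List (List RatCode)) : Matrix (Fin d) (Fin d) ℝ :=
  Matrix.of fun i j => (ratVal (ratEntry M i j) : ℝ)

section Primrec

variable {β : Type*} [Primcodable β]

@[fun_prop] theorem primrec_ratEntry {M : β → List (List RatCode)} {i j : β → ℕ}
    (hM : Primrec M) (hi : Primrec i) (hj : Primrec j) :
    Primrec fun x => ratEntry (M x) (i x) (j x) := by unfold ratEntry; fun_prop

@[fun_prop] theorem primrec_ratMatMul {d : β → ℕ} {M N : β → List (List RatCode)}
    (hd : Primrec d) (hM : Primrec M) (hN : Primrec N) :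
    Primrec fun x => ratMatMul (d x) (M x) (N x) := by unfold ratMatMul; fun_prop

@[fun_prop] theorem primrec_ratPow {x : β → RatCode} {n : β → ℕ} (hx : Primrec x)
    (hn : Primrec n) : Primrec fun y => ratPow (x y) (n y) := by unfold ratPow; fun_prop

end Primrec

theorem ratVal_ratPow (x : RatCode) (n : ℕ) : ratVal (ratPow x n) = ratVal x ^ n := by
  rw [ratPow]
  induction n with
  | zero => simp [ratVal_ratNat]
  | succ n ih => rw [Function.iterate_succ_apply', ratVal_ratMul, ih, pow_succ']

theorem getD_map_range {σ : Type*} (f : ℕ → σ) (z : σ) {n i : ℕ} (hi : i < n) :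
    ((List.range n).map f).getD i z = f i := by
  rw [List.getD_eq_getElem _ _ (by simpa using hi)]
  simp

theorem realMat_ratMatMul (d : ℕ) (M N : List (List RatCode)) :
    realMat d (ratMatMul d M N) = realMat d M * realMat d N := by
  ext i j
  have h1 : ratEntry (ratMatMul d M N) i j = (List.range d).foldr (fun k acc =>
      ratAdd (ratMul (ratEntry M i k) (ratEntry N k j)) acc) (0, 0, 0) := by
    rw [ratEntry, ratMatMul, getD_map_range _ _ i.2, getD_map_range _ _ j.2]
  rw [realMat, Matrix.of_apply, h1, map_foldr_range ratVal ratVal_ratAdd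
    (fun k => ratMul (ratEntry M i k) (ratEntry N k j)), ratVal_zero, add_zero, Matrix.mul_apply]
  push_cast
  exact Finset.sum_congr rfl fun k _ => by rw [ratVal_ratMul]; push_cast; rfl

theorem realMat_iterate (d : ℕ) (M N : List (List RatCode)) (n : ℕ) :
    realMat d ((ratMatMul d M)^[n] N) = realMat d M ^ n * realMat d N := by
  induction n with
  | zero => simp
  | succ n ih => rw [Function.iterate_succ_apply', realMat_ratMatMul, ih, pow_succ', mul_assoc]

theorem exists_ratEntry (d : ℕ) (M : Matrix (Fin d) (Fin d) ℚ) :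
    ∃ l : List (List RatCode), ∀ i j : Fin d, ratVal (ratEntry l i j) = M i j := by
  choose c hc using exists_ratVal
  choose r hr using fun i : Fin d =>
    exists_list_of_fin ((0, 0, 0) : RatCode) (fun j : Fin d => c (M i j))
  obtain ⟨l, hl⟩ := exists_list_of_fin [] r
  exact ⟨l, fun i j => by rw [ratEntry, hl, hr, hc]⟩

end RationalMatrices

section Perturbation

attribute [local instance] Matrix.linftyOpNormedAddCommGroup Matrix.linftyOpNormedRing

variable {d : ℕ}

theorem linfty_norm_le {M : Matrix (Fin d) (Fin d) ℝ} {b : ℝ} (hb : 0 ≤ b)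
    (h : ∀ i j, |M i j| ≤ b) : ‖M‖ ≤ d * b := by
  lift b to NNReal using hb
  rw [Matrix.linfty_opNorm_def]
  have h1 : (Finset.univ.sup fun i : Fin d => ∑ j, ‖M i j‖₊) ≤ (d : NNReal) * b := by
    refine Finset.sup_le fun i _ => ?_
    calc ∑ j, ‖M i j‖₊ ≤ ∑ _j : Fin d, b :=
          Finset.sum_le_sum fun j _ => NNReal.coe_le_coe.1 (h i j)
      _ = (d : NNReal) * b := by simp
  exact_mod_cast NNReal.coe_le_coe.2 h1

theorem abs_entry_le_linfty_norm (M : Matrix (Fin d) (Fin d) ℝ) (i j : Fin d) :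
    |M i j| ≤ ‖M‖ := by
  rw [Matrix.linfty_opNorm_def]
  have h1 : ‖M i j‖₊ ≤ Finset.univ.sup fun i : Fin d => ∑ j, ‖M i j‖₊ :=
    (Finset.single_le_sum (f := fun j => ‖M i j‖₊) (fun _ _ => zero_le)
      (Finset.mem_univ j)).trans (Finset.le_sup (f := fun i : Fin d => ∑ j, ‖M i j‖₊)
      (Finset.mem_univ i))
  exact NNReal.coe_le_coe.2 h1

/-- A product changes little if its factors do. -/
theorem abs_mul_stepProd_mul_sub_le {A : ℕ → Matrix (Fin d) (Fin d) ℝ}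
    {T S M : Matrix (Fin d) (Fin d) ℝ} {b ε : ℝ} (hb : 0 ≤ b) (hε : 0 ≤ ε) {n : ℕ}
    (hT : ∀ i j, |T i j| ≤ b) (hS : ∀ i j, |S i j| ≤ b) (hM : ∀ i j, |M i j| ≤ b)
    (hA : ∀ k ≥ n, ∀ i j, |A k i j| ≤ b) (hAM : ∀ k ≥ n, ∀ i j, |A k i j - M i j| ≤ ε)
    (m : ℕ) (i j : Fin d) : |(T * stepProd A n m * S) i j - (T * M ^ m * S) i j| ≤
      m * (d * ε) * (d * b) ^ (m + 1) := by
  set B : ℝ := d * b with hB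
  have hB0 : 0 ≤ B := by positivity
  have hpow : ∀ k, ‖M ^ k * S‖ ≤ B ^ (k + 1) := by
    intro k
    induction k with
    | zero => simpa using linfty_norm_le hb hS
    | succ k ih =>
      rw [pow_succ', mul_assoc, pow_succ' B (k + 1)]
      exact (norm_mul_le _ _).trans
        (mul_le_mul (linfty_norm_le hb hM) ih (norm_nonneg _) hB0)
  have hdiff : ∀ k, ‖stepProd A n k * S - M ^ k * S‖ ≤ k * (d * ε) * B ^ k := by
    intro k
    induction k with
    | zero => simp [stepProd]
    | succ k ih =>
      have h1 : stepProd A n (k + 1) * S - M ^ (k + 1) * S =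
          A (n + k) * (stepProd A n k * S - M ^ k * S) + (A (n + k) - M) * (M ^ k * S) := by
        rw [stepProd, pow_succ']
        noncomm_ring
      have h2 : ‖A (n + k)‖ ≤ B := linfty_norm_le hb (hA _ (Nat.le_add_right _ _))
      have h3 : ‖A (n + k) - M‖ ≤ d * ε :=
        linfty_norm_le hε fun i j => hAM _ (Nat.le_add_right _ _) i j
      rw [h1]
      refine (norm_add_le _ _).trans ?_
      have h4 := (norm_mul_le (A (n + k)) (stepProd A n k * S - M ^ k * S)).trans
        (mul_le_mul h2 ih (norm_nonneg _) hB0)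
      have h5 := (norm_mul_le (A (n + k) - M) (M ^ k * S)).trans
        (mul_le_mul h3 (hpow k) (norm_nonneg _) (by positivity))
      push_cast
      rw [pow_succ] at h5 ⊢
      linarith
  have h6 : (T * stepProd A n m * S) i j - (T * M ^ m * S) i j =
      (T * (stepProd A n m * S - M ^ m * S)) i j := by
    rw [mul_sub, Matrix.sub_apply, mul_assoc, mul_assoc]
  rw [h6]
  refine (abs_entry_le_linfty_norm _ i j).trans ((norm_mul_le _ _).trans ?_)
  refine (mul_le_mul (linfty_norm_le hb hT) (hdiff m) (norm_nonneg _) hB0).trans (le_of_eq ?_)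
  rw [← hB, pow_succ]
  ring

end Perturbation

/-! ### Certificates for positive conjugated products -/

section ProductTest

theorem stepProd_const {d : ℕ} (L : Matrix (Fin d) (Fin d) ℝ) (n m : ℕ) :
    stepProd (fun _ => L) n m = L ^ m := by
  induction m with
  | zero => simp [stepProd]
  | succ m ih => rw [stepProd, ih, pow_succ']

/-- A certificate for the positivity of `τ T A(n+m-1) ⋯ A(n) T⁻¹` for all `n ≥ K`, where `τ = ±1`
and `m` is odd. It consists of the inverse `S` of `T`, which has to be positive, and of a rational
matrix `M` such that the entries of `A(n) - M` are at most `ε` in absolute value for `n ≥ K`; the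
entries of `τ T M ^ m S` have to exceed the perturbation bound. -/
def ProductTest (τ : RatCode) (I : Input) (T : List (List RatCode)) (m K : ℕ) : Prop :=
  ∃ w : List (List RatCode) × List (List RatCode) × RatCode × RatCode,
    m % 2 = 1 ∧ 0 < ratVal w.2.2.1 ∧ ∀ i < I.1, ∀ j < I.1,
      -- the entries of the identity matrix are written with truncated subtraction
      ratVal (ratEntry (ratMatMul I.1 T w.1) i j) = ratVal (ratNat (1 - ((i - j) + (j - i)))) ∧
      0 < ratVal (ratEntry w.1 i j) ∧
      ratVal (ratAbs (ratEntry T i j)) ≤ ratVal w.2.2.2 ∧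
      ratVal (ratAbs (ratEntry w.1 i j)) ≤ ratVal w.2.2.2 ∧
      ratVal (ratAdd (ratAbs (ratEntry w.2.1 i j)) w.2.2.1) ≤ ratVal w.2.2.2 ∧
      BoundTest I.2.1 (I.entry i j).1 (I.entry i j).2 K
        (ratAdd (ratEntry w.2.1 i j) (ratNeg w.2.2.1)) (ratAdd (ratEntry w.2.1 i j) w.2.2.1) ∧
      ratVal (ratMul (ratMul (ratNat m) (ratMul (ratNat I.1) w.2.2.1))
        (ratPow (ratMul (ratNat I.1) w.2.2.2) (m + 1))) <
      ratVal (ratMul τ (ratEntry (ratMatMul I.1 T ((ratMatMul I.1 w.2.1)^[m] w.1)) i j))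

theorem semiDec_productTest {β : Type} [Primcodable β] (τ : RatCode) {I : β → Input}
    {T : β → List (List RatCode)} {m K : β → ℕ} (hI : Primrec I) (hT : Primrec T)
    (hm : Primrec m) (hK : Primrec K) :
    SemiDec fun x => ProductTest τ (I x) (T x) (m x) (K x) := by
  unfold ProductTest
  refine SemiDec.exists_right ?_
  refine SemiDec.and (SemiDec.eq (by fun_prop) (by fun_prop)) ?_
  refine SemiDec.and (semiDec_ratVal_pos (by fun_prop)) ?_
  refine SemiDec.forall_lt (by fun_prop) ?_
  refine SemiDec.forall_lt (by fun_prop) ?_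
  refine SemiDec.and (semiDec_ratVal_eq (by fun_prop) (by fun_prop)) ?_
  refine SemiDec.and (semiDec_ratVal_pos (by fun_prop)) ?_
  refine SemiDec.and (semiDec_ratVal_le (by fun_prop) (by fun_prop)) ?_
  refine SemiDec.and (semiDec_ratVal_le (by fun_prop) (by fun_prop)) ?_
  refine SemiDec.and (semiDec_ratVal_le (by fun_prop) (by fun_prop)) ?_
  refine SemiDec.and (semiDec_boundTest (by fun_prop) (by fun_prop) (by fun_prop) (by fun_prop)
    (by fun_prop) (by fun_prop)) ?_
  exact semiDec_ratVal_lt (by fun_prop) (by fun_prop)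

variable {I : Input} {α : ℝ} {L : Matrix (Fin I.dim) (Fin I.dim) ℝ} {lam : ℝ}
  {e : Fin I.dim → ℝ}

/-- The matrix `L` is covered as well, being the limit of the `A(n)`: it satisfies the same
bounds `|L - M| ≤ ε`. -/
theorem ProductTest.spec (h : I.WellFormed α) (hL : Tendsto (I.mat α) atTop (𝓝 L)) {τ : RatCode}
    (hτ : |ratVal τ| = 1) {T : List (List RatCode)} {m K : ℕ} (ht : ProductTest τ I T m K) :
    m % 2 = 1 ∧ ∃ G : GL (Fin I.dim) ℚ, (∀ i j, G.val i j = ratVal (ratEntry T i j)) ∧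
      PosMat (toReal G⁻¹).val ∧ PosMat ((ratVal τ : ℝ) • conj G (L ^ m)) ∧
      ∀ n ≥ K, PosMat ((ratVal τ : ℝ) • conj G (stepProd (I.mat α) n m)) := by
  obtain ⟨⟨S, M, ε, b⟩, hm, hε, hall⟩ := ht
  simp only at *
  refine ⟨hm, ?_⟩
  have hε' : (0 : ℝ) < ratVal ε := by exact_mod_cast hε
  let Tq : Matrix (Fin I.dim) (Fin I.dim) ℚ := Matrix.of fun i j => ratVal (ratEntry T i j)
  let Sq : Matrix (Fin I.dim) (Fin I.dim) ℚ := Matrix.of fun i j => ratVal (ratEntry S i j)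
  have hTS : Tq * Sq = 1 := by
    have hr : realMat I.dim T * realMat I.dim S = 1 := by
      rw [← realMat_ratMatMul]
      ext i j
      rw [realMat, Matrix.of_apply]
      refine (congrArg Rat.cast (hall i i.2 j j.2).1).trans ?_
      rw [ratVal_ratNat, Matrix.one_apply]
      split_ifs with hij
      · subst hij; simp
      · have : 1 - ((i : ℕ) - j + (j - i)) = 0 := by
          have : (i : ℕ) ≠ j := fun h => hij (Fin.ext h)
          omega
        rw [this]; simp
    have hinj : Function.Injective fun N : Matrix (Fin I.dim) (Fin I.dim) ℚ =>
        N.map (Rat.castHom ℝ) := Matrix.map_injective (Rat.castHom ℝ).injective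
    apply hinj
    simp only
    rw [Matrix.map_mul, Matrix.map_one _ (map_zero _) (map_one _)]
    exact hr
  let G : GL (Fin I.dim) ℚ := ⟨Tq, Sq, hTS, mul_eq_one_comm.1 hTS⟩
  have hGT : (toReal G).val = realMat I.dim T := rfl
  have hGS : (toReal G⁻¹).val = realMat I.dim S := rfl
  have hconj : ∀ N, conj G N = realMat I.dim T * N * realMat I.dim S := fun N => rfl
  have hSpos : PosMat (realMat I.dim S) := fun i j => by
    have := (hall i i.2 j j.2).2.1
    rw [realMat, Matrix.of_apply]
    exact_mod_cast this
  have hTb : ∀ i j, |realMat I.dim T i j| ≤ ratVal b := fun i j => by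
    have := (hall i i.2 j j.2).2.2.1
    rw [ratVal_ratAbs] at this
    rw [realMat, Matrix.of_apply]
    exact_mod_cast this
  have hSb : ∀ i j, |realMat I.dim S i j| ≤ ratVal b := fun i j => by
    have := (hall i i.2 j j.2).2.2.2.1
    rw [ratVal_ratAbs] at this
    rw [realMat, Matrix.of_apply]
    exact_mod_cast this
  have hMb : ∀ i j, |realMat I.dim M i j| + ratVal ε ≤ ratVal b := fun i j => by
    have := (hall i i.2 j j.2).2.2.2.2.1
    rw [ratVal_ratAdd, ratVal_ratAbs] at this
    rw [realMat, Matrix.of_apply]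
    exact_mod_cast this
  have hbound : ∀ n ≥ K, ∀ i j, |I.mat α n i j - realMat I.dim M i j| ≤ ratVal ε := by
    intro n hn i j
    have h1 := (hall i i.2 j j.2).2.2.2.2.2.1.bounds h.1
      (by rw [ratVal_ratAdd, ratVal_ratAdd, ratVal_ratNeg]; linarith) hn (h.2 n i j)
    rw [ratVal_ratAdd, ratVal_ratAdd, ratVal_ratNeg] at h1
    push_cast at h1
    rw [abs_le, realMat, Matrix.of_apply, Input.mat, Matrix.of_apply]
    constructor <;> linarith [h1.1, h1.2]
  have hlimbound : ∀ i j, |L i j - realMat I.dim M i j| ≤ ratVal ε := fun i j =>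
    le_of_tendsto ((tendsto_matrix_iff.1 hL i j).sub_const _).abs
      ((eventually_ge_atTop K).mono fun n hn => hbound n hn i j)
  have hentry : ∀ x y : ℝ, |x - y| ≤ ratVal ε → |y| + ratVal ε ≤ ratVal b → |x| ≤ ratVal b :=
    fun x y h1 h2 => by
      have := abs_add_le (x - y) y
      rw [sub_add_cancel] at this
      linarith
  have hgap : ∀ i j : Fin I.dim, (m : ℝ) * (I.dim * ratVal ε) * (I.dim * ratVal b) ^ (m + 1) <
      ratVal τ * (realMat I.dim T * realMat I.dim M ^ m * realMat I.dim S) i j := fun i j => by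
    have h1 := (hall i i.2 j j.2).2.2.2.2.2.2
    rw [mul_assoc (realMat I.dim T), ← realMat_iterate, ← realMat_ratMatMul, realMat,
      Matrix.of_apply]
    simp only [ratVal_ratMul, ratVal_ratPow, ratVal_ratNat] at h1
    have h2 := (Rat.cast_lt (K := ℝ)).2 h1
    push_cast at h2
    exact h2
  have hτ' : |(ratVal τ : ℝ)| = 1 := by exact_mod_cast hτ
  have main : ∀ (A : ℕ → Matrix (Fin I.dim) (Fin I.dim) ℝ) (n : ℕ),
      (∀ k ≥ n, ∀ i j, |A k i j - realMat I.dim M i j| ≤ ratVal ε) →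
      PosMat ((ratVal τ : ℝ) • conj G (stepProd A n m)) := by
    intro A n hA i j
    have hb0 : (0 : ℝ) ≤ ratVal b := (abs_nonneg _).trans (hTb i j)
    have h1 := abs_mul_stepProd_mul_sub_le hb0 hε'.le hTb hSb
      (fun i j => by linarith [hMb i j]) (fun k hk i j => hentry _ _ (hA k hk i j) (hMb i j)) hA m i j
    rw [hconj, Matrix.smul_apply, smul_eq_mul]
    have h2 := hgap i j
    have h3 : |(ratVal τ : ℝ) * (realMat I.dim T * stepProd A n m * realMat I.dim S) i j -
        ratVal τ * (realMat I.dim T * realMat I.dim M ^ m * realMat I.dim S) i j| ≤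
        (m : ℝ) * (I.dim * ratVal ε) * (I.dim * ratVal b) ^ (m + 1) := by
      rw [← mul_sub, abs_mul, hτ', one_mul]
      exact h1
    linarith [(abs_le.1 h3).1]
  refine ⟨G, fun i j => rfl, hGS ▸ hSpos, ?_, fun n hn => main _ n fun k hk =>
    hbound k (le_trans hn hk)⟩
  have := main (fun _ => L) 0 fun k _ => hlimbound
  rwa [stepProd_const] at this

theorem exists_rat_forall_le {d : ℕ} (f : Fin d → Fin d → ℝ) : ∃ q : ℚ, ∀ i j, f i j ≤ q := by
  obtain ⟨B, hB⟩ := (Set.finite_range fun x : Fin d × Fin d => f x.1 x.2).bddAbove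
  obtain ⟨q, hq⟩ := exists_rat_gt B
  exact ⟨q, fun i j => (hB ⟨(i, j), rfl⟩).trans hq.le⟩

/-- The test succeeds with `τ = sign lam`: the matrix `T` comes from a narrow cone, and `m` is odd so
that `lam ^ m` has the sign of `lam`. -/
theorem exists_productTest (h : I.WellFormed α) (hyp : Hypotheses (I.mat α) L lam e)
    {τ : RatCode} (hτ : (ratVal τ : ℝ) = SignType.sign lam) :
    ∃ T m, ∀ᶠ K in atTop, ProductTest τ I T m K := by
  obtain ⟨G, hGpos, hGlim⟩ := hyp.exists_narrow_cone
  obtain ⟨m, hm, hmodd⟩ : ∃ m, PosMat ((lam ^ m)⁻¹ • conj G (L ^ m)) ∧ m % 2 = 1 := by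
    obtain ⟨N, hN⟩ := eventually_atTop.1 hGlim
    exact ⟨2 * N + 1, hN _ (by omega), by omega⟩
  obtain ⟨T, hT⟩ := exists_ratEntry I.dim G.val
  obtain ⟨S, hS⟩ := exists_ratEntry I.dim (G⁻¹).val
  have hTr : realMat I.dim T = (toReal G).val := by
    ext i j; rw [realMat, Matrix.of_apply, hT, toReal_apply]
  have hSr : realMat I.dim S = (toReal G⁻¹).val := by
    ext i j; rw [realMat, Matrix.of_apply, hS, toReal_apply]
  have hτ1 : |(ratVal τ : ℝ)| = 1 := by
    rw [hτ]
    rcases lt_or_gt_of_ne hyp.lam_ne_zero with hl | hl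
    · simp [sign_neg hl]
    · simp [sign_pos hl]
  have hpos : ∀ i j, 0 < (ratVal τ : ℝ) * conj G (L ^ m) i j := fun i j => by
    have h1 := hm i j
    rw [Matrix.smul_apply, smul_eq_mul] at h1
    rw [hτ]
    rcases lt_or_gt_of_ne hyp.lam_ne_zero with hl | hl
    · rw [sign_neg hl]
      have h2 : (lam ^ m)⁻¹ < 0 := inv_lt_zero.2 ((Nat.odd_iff.2 hmodd).pow_neg hl)
      have h3 := neg_of_mul_pos_right h1 h2.le
      simpa using h3
    · rw [sign_pos hl]
      have h3 := pos_of_mul_pos_right h1 (inv_pos.2 (pow_pos hl m)).le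
      simpa using h3
  -- a common bound for all entries
  obtain ⟨b, hb⟩ : ∃ b : RatCode, ∀ i j : Fin I.dim, |realMat I.dim T i j| ≤ ratVal b ∧
      |realMat I.dim S i j| ≤ ratVal b ∧ |L i j| + 2 ≤ (ratVal b : ℝ) := by
    obtain ⟨q, hq⟩ := exists_rat_forall_le fun i j =>
      |realMat I.dim T i j| + |realMat I.dim S i j| + (|L i j| + 2)
    obtain ⟨b, rfl⟩ := exists_ratVal q
    refine ⟨b, fun i j => ?_⟩
    have h1 := hq i j
    have h2 := abs_nonneg (realMat I.dim T i j)
    have h3 := abs_nonneg (realMat I.dim S i j)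
    have h4 := abs_nonneg (L i j)
    refine ⟨?_, ?_, ?_⟩ <;> linarith
  -- the perturbation bound is used twice: for `M` as an approximation of `L`, and in the test
  obtain ⟨ε, hε0, hε1, hε⟩ : ∃ ε : RatCode, 0 < ratVal ε ∧ ratVal ε < 1 ∧ ∀ i j : Fin I.dim,
      2 * ((m : ℝ) * (I.dim * ratVal ε) * (I.dim * ratVal b) ^ (m + 1)) <
        ratVal τ * conj G (L ^ m) i j := by
    have h1 : ∀ᶠ ε in 𝓝 (0 : ℝ), ∀ i j : Fin I.dim,
        2 * ((m : ℝ) * (I.dim * ε) * (I.dim * ratVal b) ^ (m + 1)) <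
          ratVal τ * conj G (L ^ m) i j := by
      refine eventually_all.2 fun i => eventually_all.2 fun j => ?_
      have hc : ContinuousAt (fun ε : ℝ =>
        2 * ((m : ℝ) * (I.dim * ε) * (I.dim * ratVal b) ^ (m + 1))) 0 := by fun_prop
      exact hc.eventually (gt_mem_nhds (by simpa using hpos i j))
    obtain ⟨u, hu, hsub⟩ := exists_Ico_subset_of_mem_nhds
      (h1.and (gt_mem_nhds (zero_lt_one' ℝ))) ⟨1, one_pos⟩
    obtain ⟨q, hq0, hqu⟩ := exists_rat_btwn hu
    obtain ⟨ε, rfl⟩ := exists_ratVal q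
    obtain ⟨h2, h3⟩ := hsub ⟨hq0.le, hqu⟩
    exact ⟨ε, by exact_mod_cast hq0, by exact_mod_cast h3, h2⟩
  have hε0' : (0 : ℝ) < ratVal ε := by exact_mod_cast hε0
  have hε1' : (ratVal ε : ℝ) < 1 := by exact_mod_cast hε1
  obtain ⟨M, hM⟩ : ∃ M : List (List RatCode), ∀ i j : Fin I.dim,
      |realMat I.dim M i j - L i j| < ratVal ε := by
    choose q hq1 hq2 using fun i j : Fin I.dim =>
      exists_rat_btwn (show L i j < L i j + ratVal ε by linarith)
    obtain ⟨M, hM⟩ := exists_ratEntry I.dim (Matrix.of q)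
    refine ⟨M, fun i j => ?_⟩
    rw [realMat, Matrix.of_apply, hM, Matrix.of_apply, abs_lt]
    constructor <;> linarith [hq1 i j, hq2 i j]
  have hMb : ∀ i j, |realMat I.dim M i j| + ratVal ε ≤ (ratVal b : ℝ) := fun i j => by
    have h1 := abs_add_le (realMat I.dim M i j - L i j) (L i j)
    rw [sub_add_cancel] at h1
    linarith [hM i j, (hb i j).2.2]
  have hgap : ∀ i j : Fin I.dim, (m : ℝ) * (I.dim * ratVal ε) * (I.dim * ratVal b) ^ (m + 1) <
      ratVal τ * (realMat I.dim T * realMat I.dim M ^ m * realMat I.dim S) i j := fun i j => by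
    have h1 := abs_mul_stepProd_mul_sub_le (A := fun _ => realMat I.dim M) (M := L) (n := 0)
      ((abs_nonneg _).trans (hb i j).1) hε0'.le (fun i j => (hb i j).1) (fun i j => (hb i j).2.1)
      (fun i j => by linarith [(hb i j).2.2]) (fun _ _ i j => by linarith [hMb i j])
      (fun _ _ i j => (hM i j).le) m i j
    rw [stepProd_const] at h1
    have h2 := hε i j
    have h3 : conj G (L ^ m) = realMat I.dim T * L ^ m * realMat I.dim S := by
      rw [conj, hTr, hSr]
    rw [h3] at h2
    have h4 : |(ratVal τ : ℝ) * (realMat I.dim T * realMat I.dim M ^ m * realMat I.dim S) i j -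
        ratVal τ * (realMat I.dim T * L ^ m * realMat I.dim S) i j| ≤
        (m : ℝ) * (I.dim * ratVal ε) * (I.dim * ratVal b) ^ (m + 1) := by
      rw [← mul_sub, abs_mul, hτ1, one_mul]
      exact h1
    linarith [(abs_le.1 h4).1]
  have hbt : ∀ᶠ K in atTop, ∀ i j : Fin I.dim, BoundTest I.2.1 (I.entry i j).1 (I.entry i j).2 K
      (ratAdd (ratEntry M i j) (ratNeg ε)) (ratAdd (ratEntry M i j) ε) := by
    refine eventually_all.2 fun i => eventually_all.2 fun j => ?_
    have h1 := abs_lt.1 (hM i j)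
    rw [realMat, Matrix.of_apply] at h1
    refine eventually_boundTest h.1 (fun n => h.2 n i j) (tendsto_matrix_iff.1 hyp.tendsto i j) ?_ ?_
    · rw [ratVal_ratAdd, ratVal_ratNeg]; push_cast; linarith [h1.2]
    · rw [ratVal_ratAdd]; push_cast; linarith [h1.1]
  refine ⟨T, m, hbt.mono fun K hK => ⟨(S, M, ε, b), hmodd, hε0, fun i hi j hj => ?_⟩⟩
  refine ⟨?_, ?_, ?_, ?_, ?_, hK ⟨i, hi⟩ ⟨j, hj⟩, ?_⟩
  · have h1 : realMat I.dim (ratMatMul I.dim T S) = 1 := by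
      rw [realMat_ratMatMul, hTr, hSr, toReal_mul_inv]
    have h2 := congrFun (congrFun h1 ⟨i, hi⟩) ⟨j, hj⟩
    rw [realMat, Matrix.of_apply, Matrix.one_apply] at h2
    have h3 : (ratVal (ratEntry (ratMatMul I.dim T S) i j) : ℝ) =
        ((1 - ((i - j) + (j - i)) : ℕ) : ℝ) := by
      refine h2.trans ?_
      split_ifs with hij
      · have : i = j := congrArg Fin.val hij
        subst this; simp
      · have h4 : i ≠ j := fun h => hij (Fin.ext h)
        have : 1 - (i - j + (j - i)) = 0 := by omega
        rw [this]; simp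
    rw [ratVal_ratNat]
    exact_mod_cast h3
  · have h1 := hGpos ⟨i, hi⟩ ⟨j, hj⟩
    rw [← hSr, realMat, Matrix.of_apply] at h1
    exact_mod_cast h1
  · have h1 := (hb ⟨i, hi⟩ ⟨j, hj⟩).1
    rw [realMat, Matrix.of_apply] at h1
    rw [ratVal_ratAbs]
    exact_mod_cast h1
  · have h1 := (hb ⟨i, hi⟩ ⟨j, hj⟩).2.1
    rw [realMat, Matrix.of_apply] at h1
    rw [ratVal_ratAbs]
    exact_mod_cast h1
  · have h1 := hMb ⟨i, hi⟩ ⟨j, hj⟩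
    rw [realMat, Matrix.of_apply] at h1
    rw [ratVal_ratAdd, ratVal_ratAbs]
    exact_mod_cast h1
  · have h1 := hgap ⟨i, hi⟩ ⟨j, hj⟩
    rw [mul_assoc (realMat I.dim T), ← realMat_iterate, ← realMat_ratMatMul, realMat,
      Matrix.of_apply] at h1
    simp only [ratVal_ratMul, ratVal_ratPow, ratVal_ratNat]
    have h2 : ∀ x y : ℚ, (x : ℝ) < y → x < y := fun x y hxy => by exact_mod_cast hxy
    apply h2
    push_cast
    exact h1

end ProductTest

/-! ### The machine -/

section Machine

/-- A certificate that some term of the solution has a negative coordinate. -/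
def NegativeTermTest (I : Input) : Prop :=
  ∃ w : ℕ × List EltCode × ℕ, OrbitTest I w.1 w.2.1 ∧ w.2.2 < I.1 ∧
    PosTest I.2.1 (polyNeg (w.2.1.getD w.2.2 []))

/-- A certificate that the terms up to index `N` are nonnegative. -/
def NonnegTermsTest (I : Input) (N : ℕ) : Prop :=
  ∀ n < N + 1, ∃ V : List EltCode, OrbitTest I n V ∧ ∀ i < I.1, NonnegTest I.2.1 (V.getD i [])

/-- A certificate that the vectors `T U_N, ..., T U_(N+m-1)` are positive. -/
def EnteredTest (I : Input) (T : List (List RatCode)) (N m : ℕ) : Prop :=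
  ∀ k < m, ∃ V : List EltCode, OrbitTest I (N + k) V ∧
    ∀ i < I.1, PosTest I.2.1 (eltDot I.1 ((T.getD i []).map fun c => [c]) V)

/-- The outputs that are justified by a certificate. The radius is always infinite. -/
def Justified (I : Input) (out : Output) : Prop :=
  (out = none ∧ ((∃ w : List (List RatCode) × ℕ × ℕ, ProductTest (0, 1, 0) I w.1 w.2.1 w.2.2) ∨
    NegativeTermTest I)) ∨
  ∃ w : List (List RatCode) × ℕ × ℕ, out = some (w.1, none, w.2.1, w.2.2) ∧
    ProductTest (1, 0, 0) I w.1 w.2.2 w.2.1 ∧ NonnegTermsTest I w.2.1 ∧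
    EnteredTest I w.1 w.2.1 w.2.2

theorem semiDec_justified : SemiDec fun x : Input × Output => Justified x.1 x.2 := by
  unfold Justified
  refine SemiDec.or (SemiDec.and (SemiDec.eq (by fun_prop) (by fun_prop)) (SemiDec.or ?_ ?_)) ?_
  · refine SemiDec.exists_right ?_
    exact semiDec_productTest _ (by fun_prop) (by fun_prop) (by fun_prop) (by fun_prop)
  · unfold NegativeTermTest
    refine SemiDec.exists_right ?_
    refine SemiDec.and (semiDec_orbitTest (by fun_prop) (by fun_prop) (by fun_prop)) ?_
    refine SemiDec.and (SemiDec.nat_lt (by fun_prop) (by fun_prop)) ?_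
    exact semiDec_posTest (by fun_prop) (by fun_prop)
  · refine SemiDec.exists_right ?_
    refine SemiDec.and (SemiDec.eq (by fun_prop) (Primrec.option_some.comp (by fun_prop))) ?_
    refine SemiDec.and
      (semiDec_productTest _ (by fun_prop) (by fun_prop) (by fun_prop) (by fun_prop)) ?_
    refine SemiDec.and ?_ ?_
    · unfold NonnegTermsTest
      refine SemiDec.forall_lt (by fun_prop) ?_
      refine SemiDec.exists_right ?_
      refine SemiDec.and (semiDec_orbitTest (by fun_prop) (by fun_prop) (by fun_prop)) ?_
      refine SemiDec.forall_lt (by fun_prop) ?_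
      exact semiDec_nonnegTest (by fun_prop) (by fun_prop)
    · unfold EnteredTest
      refine SemiDec.forall_lt (by fun_prop) ?_
      refine SemiDec.exists_right ?_
      refine SemiDec.and (semiDec_orbitTest (by fun_prop) (by fun_prop) (by fun_prop)) ?_
      refine SemiDec.forall_lt (by fun_prop) ?_
      exact semiDec_posTest (by fun_prop) (by fun_prop)

variable {I : Input} {α : ℝ}

theorem negativeTermTest_iff (h : I.WellFormed α) :
    NegativeTermTest I ↔ ¬ IsPositiveSolution (I.mat α) (I.vec α) := by
  constructor
  · rintro ⟨⟨n, V, i⟩, hV, hi, hneg⟩ hp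
    simp only at *
    rw [posTest_iff h.1, eltVal_polyNeg, hV.eltVal_eq h ⟨i, hi⟩] at hneg
    linarith [hp n ⟨i, hi⟩]
  · intro hp
    obtain ⟨n, hn⟩ := not_forall.1 hp
    obtain ⟨i, hi⟩ := not_forall.1 hn
    obtain ⟨V, hV⟩ := exists_orbitTest h n
    refine ⟨(n, V, i), hV, i.2, ?_⟩
    rw [posTest_iff h.1, eltVal_polyNeg, hV.eltVal_eq h i]
    linarith [not_le.1 hi]

theorem nonnegTermsTest_iff (h : I.WellFormed α) {N : ℕ} :
    NonnegTermsTest I N ↔ ∀ n ≤ N, NonnegVec (orbit (I.mat α) (I.vec α) n) := by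
  constructor
  · intro H n hn i
    obtain ⟨V, hV, hV'⟩ := H n (Nat.lt_succ_of_le hn)
    have := hV' i i.2
    rwa [nonnegTest_iff h.1, hV.eltVal_eq h i] at this
  · intro H n hn
    obtain ⟨V, hV⟩ := exists_orbitTest h n
    refine ⟨V, hV, fun i hi => ?_⟩
    rw [nonnegTest_iff h.1, hV.eltVal_eq h ⟨i, hi⟩]
    exact H n (Nat.le_of_lt_succ hn) ⟨i, hi⟩

theorem eltVal_getD_map_singleton (l : List RatCode) (j : ℕ) :
    eltVal α ((l.map fun c => [c]).getD j []) = (ratVal (l.getD j (0, 0, 0)) : ℝ) := by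
  rcases lt_or_ge j l.length with hj | hj
  · rw [List.getD_eq_getElem _ _ (by simpa using hj), List.getD_eq_getElem _ _ hj, List.getElem_map,
      eltVal_singleton]
  · rw [List.getD_eq_default _ _ (by simpa using hj), List.getD_eq_default _ _ hj, eltVal_nil,
      ratVal_zero, Rat.cast_zero]

theorem enteredTest_iff (h : I.WellFormed α) {G : GL (Fin I.dim) ℚ} {T : List (List RatCode)}
    (hG : ∀ i j, G.val i j = ratVal (ratEntry T i j)) {N m : ℕ} : EnteredTest I T N m ↔
      ∀ k < m, PosVec (tr G (orbit (I.mat α) (I.vec α) (N + k))) := by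
  have key : ∀ (k : ℕ) (V : List EltCode), OrbitTest I (N + k) V → ∀ i : Fin I.dim,
      eltVal α (eltDot I.1 ((T.getD i []).map fun c => [c]) V) =
        tr G (orbit (I.mat α) (I.vec α) (N + k)) i := by
    intro k V hV i
    rw [eltVal_eltDot, tr, mulVec_apply_eq_sum]
    refine Finset.sum_congr rfl fun (j : Fin I.dim) _ => ?_
    rw [hV.eltVal_eq h j, eltVal_getD_map_singleton, toReal_apply, hG]
    rfl
  constructor
  · intro H k hk i
    obtain ⟨V, hV, hV'⟩ := H k hk
    have := hV' i i.2
    rwa [posTest_iff h.1, key k V hV i] at this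
  · intro H k hk
    obtain ⟨V, hV⟩ := exists_orbitTest h (N + k)
    refine ⟨V, hV, fun i hi => ?_⟩
    rw [posTest_iff h.1, key k V hV ⟨i, hi⟩]
    exact H k hk ⟨i, hi⟩

end Machine

section Correctness

variable {d : ℕ} {A : ℕ → Matrix (Fin d) (Fin d) ℝ} {L : Matrix (Fin d) (Fin d) ℝ} {lam : ℝ}
  {e U₀ : Fin d → ℝ}

/-- If `T⁻¹ > 0`, then positivity of `τ T L ^ m T⁻¹` with odd `m` reveals the sign of `lam`. -/
theorem Hypotheses.sign_of_posMat (h : Hypotheses A L lam e) {T : GL (Fin d) ℚ} {m : ℕ} {τ : ℝ}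
    (hT : PosMat (toReal T⁻¹).val) (hm : m % 2 = 1) (hpos : PosMat (τ • conj T (L ^ m))) :
    PosVec (tr T e) ∧ 0 < τ * lam := by
  obtain ⟨i⟩ := h.nonempty
  have hτ : τ ≠ 0 := by
    rintro rfl
    have := hpos i i
    simp at this
  have hsq : PosMat (conj T (L ^ (m + m))) := by
    have h1 := hpos.mul hpos
    rw [smul_mul_smul_comm, ← conj_mul, ← pow_add] at h1
    exact fun i j => pos_of_mul_pos_right (h1 i j) (mul_self_nonneg τ)
  have hlam : 0 < lam ^ (m + m) := by
    rw [pow_add]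
    exact mul_self_pos.2 (pow_ne_zero m h.lam_ne_zero)
  have hv : PosVec (tr T e) := by
    refine (h.constant_sign (by omega) hlam hsq).resolve_right fun hneg => ?_
    have h1 := hT.mulVec hneg i
    rw [mulVec_neg, ← tr, tr_inv_tr] at h1
    have h2 := h.pos i
    simp only [Pi.neg_apply] at h1
    linarith
  refine ⟨hv, ?_⟩
  have h1 := hpos.mulVec hv i
  rw [smul_mulVec, conj_pow_mulVec_of_eigenvector h.eigenvector] at h1
  have h2 : 0 < τ * lam ^ m := by
    have : 0 < τ * lam ^ m * tr T e i := by simpa [mul_assoc] using h1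
    exact pos_of_mul_pos_left this (hv i).le
  obtain ⟨k, hk⟩ : ∃ k, m = 2 * k + 1 := ⟨m / 2, by omega⟩
  rw [hk, pow_succ, pow_mul, mul_left_comm] at h2
  exact pos_of_mul_pos_right h2 (pow_nonneg (sq_nonneg lam) k)

theorem fixSign_eq_self (h : Hypotheses A L lam e) {T : GL (Fin d) ℚ} (hv : PosVec (tr T e)) :
    fixSign e T = T := by
  unfold fixSign
  rw [if_neg]
  intro hneg
  obtain ⟨i⟩ := h.nonempty
  have h1 := hv i
  have h2 := hneg i
  simp only [Pi.neg_apply] at h2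
  linarith

theorem foundR_none {T : GL (Fin d) ℚ} (hT : PosMat (toReal T⁻¹).val) : FoundR e T none :=
  ⟨fun _ hq => (Option.not_mem_none _ hq).elim, fun _ hx => hT.mulVec hx.1⟩

theorem foundK_none {T : GL (Fin d) ℚ} {m K : ℕ}
    (hK : ∀ n ≥ K, PosMat (conj T (stepProd A n m))) : FoundK A e T m none K :=
  fun n hn _ hx => ⟨(hK n hn).mulVec hx.1, fun q hq => by cases hq⟩

theorem exists_legal (h : Hypotheses A L lam e) : ∃ c : Choices d, c.Legal A L lam e := by
  by_cases hlam : 0 < lam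
  · obtain ⟨T, m, hTm⟩ := exists_foundTm h hlam
    obtain ⟨r, hr⟩ := exists_foundR h (posVec_fixSign h hlam hTm)
    obtain ⟨K, hK⟩ := exists_foundK h hlam hTm hr.1
    exact ⟨⟨T, m, r, K⟩, fun _ => ⟨hTm, hr, hK⟩⟩
  · exact ⟨⟨1, 0, none, 0⟩, fun h' => absurd h' hlam⟩

theorem correct_of_returns (h : Hypotheses A L lam e) {c : Choices d} (hc : c.Legal A L lam e)
    (hU : Generic A L lam U₀ ∨ 0 < lam) {o : Outcome d} (ho : Returns A lam e U₀ c o) :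
    o.Correct A lam e U₀ := by
  rcases lt_or_gt_of_ne h.lam_ne_zero with hneg | hlam
  · have hg := hU.resolve_right (not_lt.2 hneg.le)
    cases ho with
    | negativeEigenvalue => exact not_isPositiveSolution_of_neg h hneg hg
    | initialTerm h' => exact absurd hneg (not_lt.2 h'.le)
    | laterTerm h' => exact absurd hneg (not_lt.2 h'.le)
    | certificate h' => exact absurd hneg (not_lt.2 h'.le)
  · exact correct_of_returns_of_pos h hlam hc ho

/-- All runs agree if `lam < 0` or if the solution is not positive. -/
theorem returns_nonPositive (h : Hypotheses A L lam e) {c : Choices d} (hc : c.Legal A L lam e)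
    (hU : lam < 0 ∨ ¬ IsPositiveSolution A U₀) : Returns A lam e U₀ c .nonPositive := by
  rcases lt_or_gt_of_ne h.lam_ne_zero with hneg | hlam
  · exact .negativeEigenvalue hneg
  · have hp := hU.resolve_left (not_lt.2 hlam.le)
    obtain ⟨o, ho⟩ := exists_returns h hc (Or.inr hp)
    cases o with
    | nonPositive => exact ho
    | positive C => exact absurd (correct_of_returns_of_pos h hlam hc ho).isPositiveSolution hp

end Correctness

section Effectivity

variable {I : Input} {α : ℝ} {L : Matrix (Fin I.dim) (Fin I.dim) ℝ} {lam : ℝ}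
  {e : Fin I.dim → ℝ}

/-- What a successful test for `τ = 1` says about the objects to be found by the algorithm. -/
theorem ProductTest.found (h : I.WellFormed α) (hyp : Hypotheses (I.mat α) L lam e)
    {T : List (List RatCode)} {m K : ℕ} (ht : ProductTest (1, 0, 0) I T m K) :
    0 < lam ∧ ∃ G : GL (Fin I.dim) ℚ, (∀ i j, G.val i j = ratVal (ratEntry T i j)) ∧
      fixSign e G = G ∧ (⟨G, m, none, K⟩ : Choices I.dim).Legal (I.mat α) L lam e := by
  have hone : ratVal (1, 0, 0) = 1 := by norm_num [ratVal]
  obtain ⟨hm, G, hG, hinv, hL, hA⟩ := ht.spec h hyp.tendsto (by rw [hone, abs_one])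
  simp only [hone, Rat.cast_one, one_smul] at hL hA
  obtain ⟨hv, hlam⟩ := hyp.sign_of_posMat (τ := 1) hinv hm (by rwa [one_smul])
  have hfix := fixSign_eq_self hyp hv
  refine ⟨by rwa [one_mul] at hlam, G, hG, hfix, fun _ => ⟨⟨?_, hL⟩, ?_, ?_⟩⟩
  · show 0 < m
    omega
  · rw [hfix]; exact foundR_none hinv
  · rw [hfix]; exact foundK_none hA

theorem ProductTest.lam_neg (h : I.WellFormed α) (hyp : Hypotheses (I.mat α) L lam e)
    {T : List (List RatCode)} {m K : ℕ} (ht : ProductTest (0, 1, 0) I T m K) : lam < 0 := by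
  have hone : ratVal (0, 1, 0) = -1 := by norm_num [ratVal]
  obtain ⟨hm, G, -, hinv, hL, -⟩ := ht.spec h hyp.tendsto (by rw [hone, abs_neg, abs_one])
  have := (hyp.sign_of_posMat hinv hm hL).2
  rw [hone] at this
  push_cast at this
  linarith

/-- A justified output is returned by a run of the algorithm. For a certificate, `K` is chosen to be
the index `N` that was found. -/
theorem Justified.exists_returns (h : I.WellFormed α) (hyp : Hypotheses (I.mat α) L lam e)
    {out : Output} (hout : Justified I out) : ∃ c : Choices I.dim, c.Legal (I.mat α) L lam e ∧
      ∃ o, Returns (I.mat α) lam e (I.vec α) c o ∧ Codes out o := by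
  rcases hout with ⟨rfl, hout⟩ | ⟨⟨T, N, m⟩, rfl, hT, hnn, hE⟩
  · obtain ⟨c, hc⟩ := exists_legal hyp
    refine ⟨c, hc, _, returns_nonPositive hyp hc ?_, trivial⟩
    rcases hout with ⟨w, hw⟩ | hneg
    · exact Or.inl (hw.lam_neg h hyp)
    · exact Or.inr ((negativeTermTest_iff h).1 hneg)
  · simp only at *
    obtain ⟨hlam, G, hG, hfix, hc⟩ := hT.found h hyp
    rw [nonnegTermsTest_iff h] at hnn
    rw [enteredTest_iff h hG] at hE
    -- the search for an entrance into the cone succeeds at once, since `K = N` is chosen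
    refine ⟨⟨G, m, none, N⟩, hc, _, .certificate hlam N ⟨le_rfl, hnn, fun j h1 h2 =>
      absurd h1 (not_le.2 h2)⟩ (hnn N le_rfl) fun k hk => ?_, ?_⟩
    · show tr (fixSign e G) _ ∈ coneB none (tr (fixSign e G) e)
      rw [hfix]
      exact ⟨hE k hk, fun q hq => by cases hq⟩
    · refine ⟨?_, rfl, rfl, rfl⟩
      show ∀ i j, (fixSign e G).val i j = _
      rw [hfix]
      exact hG

/-- If no output is justified, then there is a run that does not terminate: whatever it returned, with
the matrix of a successful `ProductTest`, would be justified. -/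
theorem exists_legal_of_not_justified (h : I.WellFormed α) (hyp : Hypotheses (I.mat α) L lam e)
    (hout : ¬ ∃ out, Justified I out) : ∃ c : Choices I.dim, c.Legal (I.mat α) L lam e ∧
      ¬ ∃ o, Returns (I.mat α) lam e (I.vec α) c o := by
  have hlam : 0 < lam := by
    refine (lt_or_gt_of_ne hyp.lam_ne_zero).resolve_left fun hneg => hout ?_
    obtain ⟨T, m, hK⟩ := exists_productTest h hyp (τ := (0, 1, 0))
      (by rw [sign_neg hneg]; norm_num [ratVal])
    obtain ⟨K, hK⟩ := hK.exists
    exact ⟨none, Or.inl ⟨rfl, Or.inl ⟨(T, m, K), hK⟩⟩⟩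
  obtain ⟨T, m, hev⟩ := exists_productTest h hyp (τ := (1, 0, 0))
    (by rw [sign_pos hlam]; norm_num [ratVal])
  obtain ⟨K, hK⟩ := eventually_atTop.1 hev
  obtain ⟨-, G, hG, hfix, hc⟩ := (hK K le_rfl).found h hyp
  refine ⟨_, hc, fun ⟨o, ho⟩ => hout ?_⟩
  have hcorr := correct_of_returns_of_pos hyp hlam hc ho
  cases ho with
  | negativeEigenvalue h' => exact absurd hlam (not_lt.2 h'.le)
  | initialTerm => exact ⟨none, Or.inl ⟨rfl, Or.inr ((negativeTermTest_iff h).2 hcorr)⟩⟩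
  | laterTerm => exact ⟨none, Or.inl ⟨rfl, Or.inr ((negativeTermTest_iff h).2 hcorr)⟩⟩
  | certificate _ i hi hU hE =>
    refine ⟨_, Or.inr ⟨(T, i, m), rfl, hK i hi.1, (nonnegTermsTest_iff h).2 (hi.nonneg hU),
      (enteredTest_iff h hG).2 fun k hk => ?_⟩⟩
    have := (hE k hk).1
    simp only at this
    rwa [hfix] at this

/-- The machine searches for a justified output. -/
theorem exists_machine : ∃ P : Input →. Output, Partrec P ∧
    ∀ (I : Input) (α : ℝ) (L : Matrix (Fin I.dim) (Fin I.dim) ℝ) (lam : ℝ)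
      (e : Fin I.dim → ℝ), I.WellFormed α → Hypotheses (I.mat α) L lam e →
    ∃ c : Choices I.dim, c.Legal (I.mat α) L lam e ∧
      ((P I).Dom ↔ ∃ o, Returns (I.mat α) lam e (I.vec α) c o) ∧
      (∀ out ∈ P I, ∃ o, Returns (I.mat α) lam e (I.vec α) c o ∧ Codes out o) := by
  obtain ⟨P, hP, hdom, hmem⟩ := semiDec_justified.exists_partrec
  refine ⟨P, hP, fun I α L lam e h hyp => ?_⟩
  by_cases hd : (P I).Dom
  · obtain ⟨out, hout⟩ := Part.dom_iff_mem.1 hd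
    obtain ⟨c, hc, o, ho, hcodes⟩ := (hmem I out hout).exists_returns h hyp
    refine ⟨c, hc, ⟨fun _ => ⟨o, ho⟩, fun _ => hd⟩, fun out' hout' => ?_⟩
    rw [Part.mem_unique hout' hout]
    exact ⟨o, ho, hcodes⟩
  · obtain ⟨c, hc, hno⟩ := exists_legal_of_not_justified h hyp fun hex => hd ((hdom I).2 hex)
    exact ⟨c, hc, ⟨fun h' => absurd h' hd, fun h' => absurd h' hno⟩, fun out hout =>
      absurd (Part.dom_iff_mem.2 ⟨out, hout⟩) hd⟩

end Effectivity

end PosProof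

theorem theorem3p2 :
    -- Correctness and termination of the algorithm
    (∀ (d : ℕ) (A : ℕ → Matrix (Fin d) (Fin d) ℝ) (L : Matrix (Fin d) (Fin d) ℝ)
        (lam : ℝ) (e U₀ : Fin d → ℝ), Hypotheses A L lam e →
      -- every search of the algorithm succeeds, whatever the earlier ones have found
      (0 < lam →
        (∃ T m, FoundTm L T m) ∧
        (∀ T m, FoundTm L T m → PosVec (tr (fixSign e T) e) ∧
          (∃ r, FoundR e (fixSign e T) r) ∧
          (∀ r, FoundR e (fixSign e T) r →
            ∃ K, FoundK A e (fixSign e T) m r K))) ∧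
      -- the algorithm terminates if `U₀` is generic, or if the solution is not positive
      (∀ c : Choices d, c.Legal A L lam e →
        (Generic A L lam U₀ ∨ ¬ IsPositiveSolution A U₀) →
        ∃ o, Returns A lam e U₀ c o) ∧
      -- what it returns is correct
      (∀ c : Choices d, c.Legal A L lam e → (Generic A L lam U₀ ∨ 0 < lam) →
        ∀ o, Returns A lam e U₀ c o → o.Correct A lam e U₀) ∧
      -- a certificate proves positivity
      (∀ C : Certificate d, C.Valid A lam e U₀ →
        (∀ n ≥ C.N, orbit A U₀ n ∈ coneC C.T C.r (tr C.T e) ∧ PosVec (orbit A U₀ n)) ∧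
        IsPositiveSolution A U₀)) ∧
    -- The algorithm can be carried out by a machine, on rational functions over `ℚ(α)`
    (∃ P : Input →. Output, Partrec P ∧
      ∀ (I : Input) (α : ℝ) (L : Matrix (Fin I.dim) (Fin I.dim) ℝ) (lam : ℝ)
        (e : Fin I.dim → ℝ), I.WellFormed α → Hypotheses (I.mat α) L lam e →
      ∃ c : Choices I.dim, c.Legal (I.mat α) L lam e ∧
        ((P I).Dom ↔ ∃ o, Returns (I.mat α) lam e (I.vec α) c o) ∧
        (∀ out ∈ P I, ∃ o, Returns (I.mat α) lam e (I.vec α) c o ∧ Codes out o)) ∧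
    -- Proving positivity reduces to deciding genericity: given the answer `b` to the
    -- question whether `U₀` is generic, a machine always halts, and it either reports that `U₀`
    -- is not generic or disproves positivity or produces a certificate
    (∃ F : Input × Bool →. Option Output, Partrec F ∧
      ∀ (I : Input) (α : ℝ) (L : Matrix (Fin I.dim) (Fin I.dim) ℝ) (lam : ℝ)
        (e : Fin I.dim → ℝ), I.WellFormed α → Hypotheses (I.mat α) L lam e →
      ∀ b : Bool, (b = true ↔ Generic (I.mat α) L lam (I.vec α)) →
      (F (I, b)).Dom ∧
      (none ∈ F (I, b) → ¬ Generic (I.mat α) L lam (I.vec α)) ∧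
      (∀ out, some out ∈ F (I, b) → ∃ o : Outcome I.dim, Codes out o ∧
        o.Correct (I.mat α) lam e (I.vec α))) := by
  refine ⟨fun d A L lam e U₀ h => ⟨fun hlam => ⟨exists_foundTm h hlam, fun T m hTm => ?_⟩,
    fun c hc hU => exists_returns h hc hU, fun c hc hU o ho => correct_of_returns h hc hU ho,
    fun C hC => ⟨fun n hn => ?_, hC.isPositiveSolution⟩⟩, exists_machine, ?_⟩
  · have hv := posVec_fixSign h hlam hTm
    exact ⟨hv, exists_foundR h hv, fun r hr => exists_foundK h hlam hTm hr.1⟩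
  · obtain ⟨k, rfl⟩ := Nat.exists_eq_add_of_le hn
    exact ⟨hC.mem_coneC k, hC.cone_pos _ (hC.mem_coneC k)⟩
  · obtain ⟨P, hP, hspec⟩ := exists_machine
    -- for generic data the machine of the second part halts, and otherwise nothing is to be done
    refine ⟨fun x => bif x.2 then (P x.1).map some else Part.some none, ?_,
      fun I α L lam e h hyp b hb => ?_⟩
    · exact Partrec.cond Computable.snd
        ((hP.comp Computable.fst).map (Computable.option_some.comp Computable.snd).to₂)
        (Computable.const none)
    · obtain ⟨c, hc, hdom, hmem⟩ := hspec I α L lam e h hyp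
      cases b with
      | false =>
        have hg : ¬ Generic (I.mat α) L lam (I.vec α) := fun hg => Bool.false_ne_true (hb.2 hg)
        refine ⟨trivial, fun _ => hg, fun out hout => ?_⟩
        exact absurd (Part.mem_some_iff.1 hout) (Option.some_ne_none out)
      | true =>
        have hg : Generic (I.mat α) L lam (I.vec α) := hb.1 rfl
        refine ⟨hdom.2 (exists_returns hyp hc (Or.inl hg)), fun hnone => ?_, fun out hout => ?_⟩
        · obtain ⟨out, -, hout⟩ := (Part.mem_map_iff _).1 hnone
          exact absurd hout (Option.some_ne_none out)
        · obtain ⟨out', hout', heq⟩ := (Part.mem_map_iff _).1 hout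
          obtain rfl := Option.some.inj heq
          obtain ⟨o, ho, hcodes⟩ := hmem _ hout'
          exact ⟨o, hcodes, correct_of_returns hyp hc (Or.inl hg) ho⟩
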